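/- **Definitions.** Regard the cubic lattice in $\mathbb R^3$ as a cell complex with vertex set $\mathbb Z^3$. A *cubic polyhedron* is a set $P$ of unit squares of the lattice that forms a surface (a polyhedral $2$-manifold without boundary) containing every edge of the lattice: each lattice edge lies in exactly two squares of $P$, and the squares of $P$ at each vertex form a single cycle around that vertex. Polyhedra are *congruent* if an isometry preserving the cubic lattice takes one to the other. An edge is a *flange* of $P$ if the two squares of $P$ at it are coplanar. At each vertex the six edges and the squares of $P$ spanned by them form a Hamiltonian cycle in the octahedron; up to isometry this is a *monkey-saddle* (no flange), or a left- or right-handed *screw* (two flanges, in opposite directions along an *axis*). Every screw vertex lies in a bi-infinite *column* of screws with a common axis line, which is described by the sequence $\sigma:\mathbb Z\to\{\text{left},\text{right}\}$ of their handednesses. * $P_\sigma$ is the polyhedron obtained from the column with axis $z$, consisting of screws at $(0,0,k)$ of handedness $\sigma(k)$, by repeated reflection in the planes $x=i+\frac12$, $y=j+\frac12$ ($i,j\in\mathbb Z$). * $P_0$ is obtained from one monkey-saddle vertex by repeated reflection in all planes $x=i+\frac12$, $y=i+\frac12$, $z=i+\frac12$. * A *slab* of $P$ with normal $n$, axis $a$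 and bi-axis $b$ (the three coordinate directions in some order) is the configuration of $P$ at all vertices of a lattice plane perpendicular to $n$, when these are all screws with axis $a$ and consecutive columns along $b$ are mirror images of each other. It is *untwisted* if handedness alternates along its columns. A *sheet* is a plane of monkey-saddles generated by reflection in the two in-plane directions. * For $\tau:\mathbb Z\to\{0,x,y\}$, $P_\tau$ is the polyhedron whose layer in the plane $z=n$ is a sheet if $\tau(n)=0$, and an untwisted slab with normal $z$ and axis $\tau(n)$ otherwise (it is unique up to congruence). * A square $f$ of $P$ is *normal* if none of the four squares adjacent to it in its plane is in $P$. A *tower* of $P$ is the configuration in a $2\times2\times\mathbb Z$ box of vertices around a normal face $f$, with axis perpendicular to $f$, if it is generated by reflection of its layer at $f$ in planes perpendicular to the axis. *Pushing* the tower means removing those squares parallel to the axis on the sides of the unit column over $f$ that are in $P$, and adding those that are not. Any set (finite, infinite or empty) of towers of $P$ with the same axis direction can be pushed simultaneously. * A *pushed polyhedron* is one obtained from $P_0$ by pushing some set of towers in the $z$-direction, then some set of towers of the resulting polyhedron in the $y$-direction, and then some set in the $x$-direction; or obtained from some $P_\tau$ by pushing some set of towers in the $y$-direction and then some set in the $x$-direction.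 * *Removing* a slab with normal $n$ and bi-axis $b$ deletes it and translates the part on the positive side of it by $-e_n+e_b$, so that the two remaining half-spaces fit together. *Inserting* slabs is the inverse operation: $P$ is obtained from $Q$ by inserting (no, finitely many or infinitely many) slabs with normal $n$ if there is a set of slabs of $P$ with normal $n$, not comprising all layers, such that removing all of them takes the remaining layers of $P$, in order, to consecutive layers of $Q$. If the removed slabs fill a half-space of $P$ above (or below) some height, they replace a half-space of $Q$, which is discarded; otherwise the remaining layers make up all of $Q$. **Theorem.** Every cubic polyhedron $P$ is congruent to some $P_\sigma$, or is congruent to a polyhedron $P'$ that is obtained from a pushed polyhedron $Q$ by inserting (no, finitely many or infinitely many) slabs with normal $z$. -/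

import Mathlib

namespace CubicPolyhedra

/-- Integer vectors: vertices of the cubic lattice, and also centres of cells in doubled coordinates.
The cell of the cubic lattice (vertex, edge, square, cube) with centre `p` in `ℝ³` is encoded
by the integer vector `2 p`.  Thus the vertex `v` is encoded by `2 • v`, and squares are encoded by
the vectors with exactly one even coordinate, whose index is the direction of the normal. -/
abbrev Pt : Type := Fin 3 → ℤ

/-- The six directions `±x, ±y, ±z` (an axis `0, 1, 2` and a sign): the vertices of the octahedron
that is the vertex figure of the cubic lattice, or the six lattice edges at a vertex. -/
abbrev Dir : Type := Fin 3 × ℤˣ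

/-- The unit vector of a direction. -/
def vec (d : Dir) : Pt := Pi.single d.1 (d.2 : ℤ)

/-- The unit square that has `v` as a corner and whose two edges at `v` point in the directions
`d` and `e` (for directions `d`, `e` with different axes). -/
def square (v : Pt) (d e : Dir) : Pt := (2 : ℤ) • v + vec d + vec e

/-- The vertex figure at the vertex `v` of a set `P` of squares: the graph on the six lattice edges
at `v` in which two edges are joined when they span a square of `P`. -/
def link (P : Set Pt) (v : Pt) : SimpleGraph Dir where
  Adj d e := d.1 ≠ e.1 ∧ square v d e ∈ P
  symm := ⟨fun d e h => ⟨h.1.symm, by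
    have := h.2
    simp only [square] at this ⊢
    rwa [add_right_comm]⟩⟩
  loopless := ⟨fun _ h => h.1 rfl⟩

/-- Cubic polyhedra: sets `P` of squares of the cubic lattice that form a surface without boundary
which contains every edge of the lattice: every lattice edge lies in exactly two squares of `P`, and
the squares of `P` at every vertex form a single cycle (the vertex figure is connected). -/
structure IsCubicPolyhedron (P : Set Pt) : Prop where
  isSquare : ∀ c ∈ P, ∃ n : Fin 3, ∀ i, Even (c i) ↔ i = n
  edge : ∀ (v : Pt) (d : Dir), ((link P v).neighborSet d).ncard = 2
  vertex : ∀ v : Pt, (link P v).Connected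

/-- Congruence under an isometry of `ℝ³` that preserves the cubic lattice (the isometry
`p ↦ (ε i * p (π i) + t i)ᵢ`, in doubled coordinates). -/
def Congruent (P P' : Set Pt) : Prop :=
  ∃ (π : Equiv.Perm (Fin 3)) (ε : Fin 3 → ℤˣ) (t : Pt),
    P' = (fun (c : Pt) (i : Fin 3) => (ε i : ℤ) * c (π i) + 2 * t i) '' P

/-! ### Reflections, and the polyhedra generated by them -/

/-- Reflection of directions that reverses the axis `i`. -/
def mirror (i : Fin 3) (d : Dir) : Dir := if d.1 = i then (d.1, -d.2) else d

/-- The configuration of `P` at the vertex `v + eᵢ` is the mirror image of the configuration at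
`v` in the plane halfway between these vertices. -/
def Mirrored (P : Set Pt) (i : Fin 3) (v : Pt) : Prop :=
  ∀ d e : Dir, (link P v).Adj d e ↔ (link P (v + Pi.single i 1)).Adj (mirror i d) (mirror i e)

/-- The set of squares with given vertex configurations (`L v d e` means that the square at `v`
spanned by the directions `d` and `e` is present). -/
def ofConfig (L : Pt → Dir → Dir → Prop) : Set Pt :=
  {c | ∃ (v : Pt) (d e : Dir), L v d e ∧ c = square v d e}

/-- Repeated reflection of the origin cell in the planes at half-integer coordinates takes the
origin to `v` and, on directions, reverses the axis `i` exactly when `v i` is odd. -/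
def fold (v : Pt) (d : Dir) : Dir := (d.1, (v d.1).negOnePow * d.2)

/-- A monkey-saddle vertex configuration: the hexagon
`-z, +x, -y, +z, -x, +y` in the octahedron. -/
def saddleConfig : Set (Dir × Dir) :=
  {((2, -1), (0, 1)), ((0, 1), (1, -1)), ((1, -1), (2, 1)),
   ((2, 1), (0, -1)), ((0, -1), (1, 1)), ((1, 1), (2, -1))}

/-- The polyhedron `P₀`, generated by repeated reflection of one monkey-saddle vertex. -/
def P0 : Set Pt := ofConfig fun v d e => (fold v d, fold v e) ∈ saddleConfig

/-- The vertical column `C_σ` of screw vertices at `(0, 0, k)`, where `σ k = 1` stands for a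
right-handed and `σ k = -1` for a left-handed screw.  The flange that goes up from height `k` lies in
the `xz`-plane for even `k` and in the `yz`-plane for odd `k`.  A horizontal square joins a direction
`d` in the upper flange to a direction `e` in the lower flange when the quarter turn from `e` to `d`
is counterclockwise (right-handed screw) or clockwise (left-handed screw) as seen from above. -/
def columnConfig (σ : ℤ → ℤˣ) (k : ℤ) (d e : Dir) : Prop :=
  let up : Fin 3 := if Even k then 0 else 1
  let down : Fin 3 := if Even k then 1 else 0
  (d = (2, 1) ∧ e.1 = up) ∨ (d = (2, -1) ∧ e.1 = down) ∨
    (d.1 = up ∧ e.1 = down ∧ vec e 0 * vec d 1 - vec e 1 * vec d 0 = σ k)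

/-- The polyhedron `P_σ`, generated from the column `C_σ` by repeated reflection in the vertical
planes `x = i + 1/2` and `y = j + 1/2`. -/
def Psigma (σ : ℤ → ℤˣ) : Set Pt :=
  ofConfig fun v d e => columnConfig σ (v 2) (fold ![v 0, v 1, 0] d) (fold ![v 0, v 1, 0] e)

/-- The three kinds of horizontal layers of a polyhedron `P_τ`: a sheet of monkey-saddles (`0`), or
an untwisted slab with axis `x` or with axis `y`. -/
inductive Layer : Type
  | sheet
  | xSlab
  | ySlab

/-- The vertex configuration at the origin that generates, by reflection in vertical planes, a
layer of the given kind.  All three have the same squares below the layer.  For the slabs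
these are the screws with axis `x`, respectively `y`. -/
def Layer.config : Layer → Set (Dir × Dir)
  | .sheet => saddleConfig
  | .xSlab =>
    {((2, -1), (0, 1)), ((0, 1), (2, 1)), ((2, 1), (1, -1)),
     ((1, -1), (0, -1)), ((0, -1), (1, 1)), ((1, 1), (2, -1))}
  | .ySlab =>
    {((2, -1), (1, 1)), ((1, 1), (2, 1)), ((2, 1), (0, -1)),
     ((0, -1), (1, -1)), ((1, -1), (0, 1)), ((0, 1), (2, -1))}

/-- The horizontal translation by which the squares above a layer differ from those below it (up to
even translations): one unit along each horizontal direction other than the axis of the slab. -/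
def Layer.shift : Layer → Pt
  | .sheet => ![1, 1, 0]
  | .xSlab => ![0, 1, 0]
  | .ySlab => ![1, 0, 0]

/-- The horizontal translation that makes the layer at height `n` fit to its neighbours:
the sum of the shifts of the layers between the heights `0` and `n`. -/
noncomputable def layerShift (τ : ℤ → Layer) (n : ℤ) : Pt :=
  ∑ m ∈ Finset.Ico 0 n, (τ m).shift - ∑ m ∈ Finset.Ico n 0, (τ m).shift

/-- The polyhedron `P_τ`: the layer in the plane `z = n` is a sheet of monkey-saddles or an
untwisted slab with axis `x` or `y`, as prescribed by `τ n`. -/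
noncomputable def Ptau (τ : ℤ → Layer) : Set Pt :=
  ofConfig fun v d e =>
    let w : Pt := v - layerShift τ (v 2)
    (fold ![w 0, w 1, 0] d, fold ![w 0, w 1, 0] e) ∈ (τ (v 2)).config

/-! ### Pushing towers -/

/-- `f` is a normal face of `P` with normal direction `a`: none of the four squares adjacent to it in
its plane is in `P`. -/
def IsNormalFace (P : Set Pt) (a : Fin 3) (f : Pt) : Prop :=
  f ∈ P ∧ (∀ i, Even (f i) ↔ i = a) ∧ ∀ d : Dir, d.1 ≠ a → f + (2 : ℤ) • vec d ∉ P

/-- The square `f` is one of the central squares of a tower of `P` with axis `a`: `f` is a normal face,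
and the configuration in the `2 × 2 × ℤ` box along `a` around `f` is generated by
reflection in planes perpendicular to `a`.  The vertices `v` of that box are those whose coordinates
other than the one along `a` agree with the coordinates of a corner of `f`. -/
def IsTower (P : Set Pt) (a : Fin 3) (f : Pt) : Prop :=
  IsNormalFace P a f ∧ ∀ v : Pt, (∀ i, i ≠ a → |2 * v i - f i| = 1) → Mirrored P a v

/-- The squares that are parallel to the axis `a` and lie over an edge of one of the squares in `T`
(which have normal `a`): the sides of the towers given by the squares in `T`. -/
def towerSides (a : Fin 3) (T : Set Pt) : Set Pt :=
  {g | ∃ f ∈ T, ∃ d : Dir, d.1 ≠ a ∧ ∃ k : ℤ, g = f + vec d + Pi.single a (2 * k + 1)}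

/-- `P'` is obtained from `P` by pushing some set (finite, infinite or empty) of the towers of
`P` with axis `a`: of the sides of these towers, those that are present are removed and those that are
absent are filled in. -/
def PushTowers (a : Fin 3) (P P' : Set Pt) : Prop :=
  ∃ T : Set Pt, (∀ f ∈ T, IsTower P a f) ∧ P' = symmDiff P (towerSides a T)

/-- Pushed polyhedra: those obtained from `P₀` by pushing towers in the `z`-, then in the `y`-, then in
the `x`-direction, or from some `P_τ` by pushing towers in the `y`- and then in the `x`-direction. -/
def IsPushed (Q : Set Pt) : Prop :=
  (∃ Q₁ Q₂ : Set Pt, PushTowers 2 P0 Q₁ ∧ PushTowers 1 Q₁ Q₂ ∧ PushTowers 0 Q₂ Q) ∨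
    ∃ (τ : ℤ → Layer) (Q₁ : Set Pt), PushTowers 1 (Ptau τ) Q₁ ∧ PushTowers 0 Q₁ Q

/-! ### Slabs -/

/-- The edge that leaves `v` in the direction `d` is a flange of `P`: two coplanar squares of `P`
meet there. -/
def IsFlange (P : Set Pt) (v : Pt) (d : Dir) : Prop :=
  ∃ e : Dir, (link P v).Adj d e ∧ (link P v).Adj d (e.1, -e.2)

/-- `v` is a screw vertex of `P` with axis `a`: it has two flanges, in opposite directions
along `a`. -/
def IsScrew (P : Set Pt) (v : Pt) (a : Fin 3) : Prop :=
  IsFlange P v (a, 1) ∧ IsFlange P v (a, -1)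

/-- The vertices of `P` in the plane where the coordinate along `n` is `k` form a slab `S_σ` with
normal `n`, axis `a` and bi-axis `b`: they lie in columns of screws along `a`, each the
mirror image of the next one along `b`. -/
def IsSlab (P : Set Pt) (n a b : Fin 3) (k : ℤ) : Prop :=
  n ≠ a ∧ n ≠ b ∧ a ≠ b ∧ ∀ v : Pt, v n = k → IsScrew P v a ∧ Mirrored P b v

/-- `P` is obtained from `Q` by inserting slabs with normal `n` (no slabs, finitely many or infinitely
many), that is, `Q` is obtained by removing slabs from `P`.  `S` is the set of heights of
the inserted slabs, and the layer of `P` at a height `k` outside `S` is taken into `Q` by the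
translation `t k`.  Removing one slab deletes it and translates what lies above by one unit down along
the normal and by one unit along the bi-axis of the slab; so `t` changes by this vector
across every slab and is constant otherwise.  If all layers of `P` above (or
below) some height belong to inserted slabs, then these replace a half-space of `Q`, which is thrown
away.  At least one layer is not an inserted slab. -/
def InsertSlabs (n : Fin 3) (Q P : Set Pt) : Prop :=
  ∃ (S : Set ℤ) (t : ℤ → Pt), S ≠ Set.univ ∧
    (∀ k ∉ S, t (k + 1) = t k) ∧
    (∀ k ∈ S, ∃ a b : Fin 3, IsSlab P n a b k ∧ t (k + 1) = t k - Pi.single n 1 + Pi.single b 1) ∧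
    ∀ v : Pt, v n ∉ S → link Q (v + t (v n)) = link P v

end CubicPolyhedra

namespace CubicPolyhedra

/-! ### Squares by normal direction -/

/-! The proof turns the geometry into parity bookkeeping. Each square gets a bit (present or
absent), to which the checkerboard of its lattice plane is added; this gives reduced coordinates
`dA`, `dB`, `dC` in `{0, 1}` that vanish identically for `P0`. A vertex figure is a Hamiltonian
cycle of the octahedron, and the list of these cycles (`hamiltonian_table`) shows that a flange on
one side of a vertex forces a flange on the opposite side. Hence the screws fill whole lattice
lines, in families `X`, `Y`, `Z`, and lines of different directions never meet. In reduced
coordinates (`Rules`): a coordinate jumps exactly across the lines in its plane, two coordinates are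
tied by a parity relation along each line, and `A + B + C` is even at each saddle.

Suppose that all three families are nonempty. A lattice plane contains lines of at most one
direction. Among the three statements "every line that the planes permit is present" (`FullX`,
`FullY`, `FullZ`) two have the same truth value; after permuting axes, parity arguments on single
cubes show that `A` is constant wherever `X`-lines may run (`uniformX`), and then `B` and `C` are
constant on the complementary regions (`boundary_values`). A translation makes these constants zero.
What remains nonzero is located at the sides of towers (`eq_towers`), and towers of different
directions do not interfere, so `P` arises from `P0` by pushing (`Ruled.isPushed`).

Suppose that a family is empty, say `Z`. Then `A` does not depend on `j` and `B` does not depend on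
`i` (`Flat`), and the structure is layered. A layer filled with parallel screw lines is a slab; any
other layer is `Straight` in one direction. If all layers are filled with lines of the same
direction, `P` is some `P_σ` (`Ruled.congruent_Psigma`). Otherwise some layer is `Kept`
(`Flat.trichotomy`), and all layers that are not kept are slabs to be removed. Removal does not
change the suitably translated coordinates between the layers (`state_of_full`), and the kept
layers, stacked together, are read as a `P_τ`, with `τ` taken from one reference line in each
direction; the deviations from this reference are pushed towers (`Flat.exists_pushed`). -/

/-- The square with normal `x` and centre `(i, j + 1/2, k + 1/2)` belongs to `P`. -/
def mX (P : Set Pt) (i j k : ℤ) : Prop := ![2 * i, 2 * j + 1, 2 * k + 1] ∈ P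

/-- The square with normal `y` and centre `(i + 1/2, j, k + 1/2)` belongs to `P`. -/
def mY (P : Set Pt) (i j k : ℤ) : Prop := ![2 * i + 1, 2 * j, 2 * k + 1] ∈ P

/-- The square with normal `z` and centre `(i + 1/2, j + 1/2, k)` belongs to `P`. -/
def mZ (P : Set Pt) (i j k : ℤ) : Prop := ![2 * i + 1, 2 * j + 1, 2 * k] ∈ P

/-- The offset `0` or `-1` of the cell that lies in the direction of the sign `s`. -/
def off (s : ℤˣ) : ℤ := if s = 1 then 0 else -1

@[simp] theorem off_one : off 1 = 0 := rfl
@[simp] theorem off_neg_one : off (-1) = -1 := rfl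

theorem two_mul_off (s : ℤˣ) : 2 * off s + 1 = (s : ℤ) := by
  rcases Int.units_eq_one_or s with rfl | rfl <;> rfl

theorem square_yz (v : Pt) (s u : ℤˣ) :
    square v (1, s) (2, u) = ![2 * v 0, 2 * (v 1 + off s) + 1, 2 * (v 2 + off u) + 1] := by
  have h1 := two_mul_off s
  have h2 := two_mul_off u
  funext i
  fin_cases i <;> simp [square, vec] <;> linarith

theorem square_xz (v : Pt) (s u : ℤˣ) :
    square v (0, s) (2, u) = ![2 * (v 0 + off s) + 1, 2 * v 1, 2 * (v 2 + off u) + 1] := by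
  have h1 := two_mul_off s
  have h2 := two_mul_off u
  funext i
  fin_cases i <;> simp [square, vec] <;> linarith

theorem square_xy (v : Pt) (s u : ℤˣ) :
    square v (0, s) (1, u) = ![2 * (v 0 + off s) + 1, 2 * (v 1 + off u) + 1, 2 * v 2] := by
  have h1 := two_mul_off s
  have h2 := two_mul_off u
  funext i
  fin_cases i <;> simp [square, vec] <;> linarith

theorem square_comm (v : Pt) (d e : Dir) : square v d e = square v e d := by
  simp only [square, add_right_comm]

theorem adj_yz (P : Set Pt) (v : Pt) (s u : ℤˣ) :
    (link P v).Adj (1, s) (2, u) ↔ mX P (v 0) (v 1 + off s) (v 2 + off u) := by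
  simp [link, square_yz, mX]

theorem adj_xz (P : Set Pt) (v : Pt) (s u : ℤˣ) :
    (link P v).Adj (0, s) (2, u) ↔ mY P (v 0 + off s) (v 1) (v 2 + off u) := by
  simp [link, square_xz, mY]

theorem adj_xy (P : Set Pt) (v : Pt) (s u : ℤˣ) :
    (link P v).Adj (0, s) (1, u) ↔ mZ P (v 0 + off s) (v 1 + off u) (v 2) := by
  simp [link, square_xy, mZ]

theorem adj_zy (P : Set Pt) (v : Pt) (s u : ℤˣ) :
    (link P v).Adj (2, u) (1, s) ↔ mX P (v 0) (v 1 + off s) (v 2 + off u) := by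
  rw [SimpleGraph.adj_comm, adj_yz]

theorem adj_zx (P : Set Pt) (v : Pt) (s u : ℤˣ) :
    (link P v).Adj (2, u) (0, s) ↔ mY P (v 0 + off s) (v 1) (v 2 + off u) := by
  rw [SimpleGraph.adj_comm, adj_xz]

theorem adj_yx (P : Set Pt) (v : Pt) (s u : ℤˣ) :
    (link P v).Adj (1, u) (0, s) ↔ mZ P (v 0 + off s) (v 1 + off u) (v 2) := by
  rw [SimpleGraph.adj_comm, adj_xy]

theorem not_adj_same (P : Set Pt) (v : Pt) (a : Fin 3) (s u : ℤˣ) :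
    ¬ (link P v).Adj (a, s) (a, u) := fun h => h.1 rfl

/-! ### The vertex figure as a table of twelve bits -/

/-- A truth value as a number. -/
noncomputable def bit (p : Prop) : ℤ := by
  classical exact if p then 1 else 0

theorem bit_cases (p : Prop) : (p ∧ bit p = 1) ∨ (¬ p ∧ bit p = 0) := by
  by_cases h : p <;> simp [bit, h]

theorem bit_range (p : Prop) : 0 ≤ bit p ∧ bit p < 2 := by
  rcases bit_cases p with h | h <;> omega

theorem bit_inj {p q : Prop} : bit p = bit q ↔ (p ↔ q) := by
  by_cases h : p <;> by_cases h' : q <;> simp [bit, h, h']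

theorem ncard_dir (R : Dir → Prop) :
    (({e | R e} : Set Dir).ncard : ℤ) = bit (R (0, 1)) + bit (R (0, -1)) + bit (R (1, 1))
      + bit (R (1, -1)) + bit (R (2, 1)) + bit (R (2, -1)) := by
  classical
  have h : ({e | R e} : Set Dir) = ((Finset.univ.filter R : Finset Dir) : Set Dir) := by
    ext; simp
  rw [h, Set.ncard_coe_finset, Finset.card_filter, Fintype.sum_prod_type, Fin.sum_univ_three]
  simp only [UnitsInt.univ, Finset.sum_pair (show (1 : ℤˣ) ≠ -1 by decide)]
  simp only [bit]
  push_cast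
  ring

theorem link_degree {P : Set Pt} (hP : IsCubicPolyhedron P) (v : Pt) (d : Dir) :
    bit ((link P v).Adj d (0, 1)) + bit ((link P v).Adj d (0, -1)) + bit ((link P v).Adj d (1, 1))
      + bit ((link P v).Adj d (1, -1)) + bit ((link P v).Adj d (2, 1))
      + bit ((link P v).Adj d (2, -1)) = 2 := by
  rw [← ncard_dir (fun e => (link P v).Adj d e)]
  exact_mod_cast hP.edge v d

/-- A triangle of the octahedron is joined to its complement in a connected vertex figure. -/
theorem link_cut {P : Set Pt} (hP : IsCubicPolyhedron P) (v : Pt) (s : Fin 3 → ℤˣ) :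
    ∃ a b : Fin 3, a ≠ b ∧ (link P v).Adj (a, s a) (b, -s b) := by
  have hc := hP.vertex v
  by_contra hno
  push Not at hno
  have key : ∀ d e : Dir, (link P v).Reachable d e → d.2 = s d.1 → e.2 = s e.1 := by
    rintro d e ⟨w⟩
    induction w with
    | nil => exact id
    | @cons d f e hadj w ih =>
      intro hd
      apply ih
      by_contra hf
      have hf' : f.2 = - s f.1 := by
        rcases Int.units_eq_one_or f.2 with h1 | h1 <;>
        rcases Int.units_eq_one_or (s f.1) with h2 | h2 <;> simp_all
      refine hno d.1 f.1 hadj.1 ?_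
      rw [← hd, ← hf']
      exact hadj
  have := key (0, s 0) (0, - s 0) (hc.preconnected _ _) rfl
  rcases Int.units_eq_one_or (s 0) with h2 | h2 <;> simp [h2] at this

end CubicPolyhedra

/-! ### Hamiltonian cycles of the octahedron and the rules they impose -/

namespace CubicPolyhedra

set_option synthInstance.maxHeartbeats 400000 in
set_option synthInstance.maxSize 2000 in
set_option maxRecDepth 100000 in
/-- The Hamiltonian cycles of the octahedron, by exhaustion: `a`, `b`, `c` are the bits of the
`yz`-, `xz`- and `xy`-squares in the quadrants `++`, `+-`, `-+`, `--`. -/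
theorem hamiltonian_table_bool :
    ∀ b1 b2 c1 c2 : Bool, b1.toNat + b2.toNat + c1.toNat + c2.toNat = 2 →
    ∀ c3 a1 a2 : Bool, a1.toNat + a2.toNat + c1.toNat + c3.toNat = 2 →
    ∀ a3 b3 : Bool, a1.toNat + a3.toNat + b1.toNat + b3.toNat = 2 →
    ∀ a4 c4 : Bool, a3.toNat + a4.toNat + c2.toNat + c4.toNat = 2 →
    ∀ b4 : Bool, b3.toNat + b4.toNat + c3.toNat + c4.toNat = 2 →
      a2.toNat + a4.toNat + b2.toNat + b4.toNat = 2 →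
      (c2 || c3 || b2 || b3 || a2 || a3) = true → (c2 || c3 || b1 || b4 || a1 || a4) = true →
      (c1 || c4 || b2 || b3 || a1 || a4) = true → (c1 || c4 || b1 || b4 || a2 || a3) = true →
      ((a1 = a3 ↔ b1 = b3) ∧ (a1 = a3 ↔ a2 = a4) ∧ (a1 = a3 ↔ b2 = b4)) ∧
      ((a1 = a2 ↔ c1 = c3) ∧ (a1 = a2 ↔ a3 = a4) ∧ (a1 = a2 ↔ c2 = c4)) ∧
      ((b1 = b2 ↔ c1 = c2) ∧ (b1 = b2 ↔ b3 = b4) ∧ (b1 = b2 ↔ c3 = c4)) ∧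
      (a1 = a3 → a1 ≠ b1) ∧ (a1 = a2 → a1 ≠ c1) ∧ (b1 = b2 → b1 ≠ c1) ∧
      ¬ (a1 = a3 ∧ a1 = a2) ∧ ¬ (a1 = a3 ∧ b1 = b2) ∧ ¬ (a1 = a2 ∧ b1 = b2) ∧
      (a1 ≠ a3 → a1 ≠ a2 → b1 ≠ b2 → (a1 ^^ b1 ^^ c1) = false) := by
  -- A 2-regular graph on the octahedron is a hexagon or a pair of opposite triangles; the four
  -- disjunctions exclude the four such pairs. Each degree condition stands right after the bits it
  -- involves, so that most assignments are discarded early.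
  decide

theorem exists_bool_of_bit {a : ℤ} (h : 0 ≤ a ∧ a < 2) : ∃ x : Bool, a = (x.toNat : ℤ) := by
  obtain h | h : a = 0 ∨ a = 1 := by omega
  · exact ⟨false, h⟩
  · exact ⟨true, h⟩

theorem toNat_int_inj {x y : Bool} : ((x.toNat : ℤ) = (y.toNat : ℤ)) ↔ x = y := by
  cases x <;> cases y <;> simp

/-- `hamiltonian_table_bool` for integers in `{0, 1}`. -/
theorem hamiltonian_table {a1 a2 a3 a4 b1 b2 b3 b4 c1 c2 c3 c4 : ℤ}
    (ha1 : 0 ≤ a1 ∧ a1 < 2) (ha2 : 0 ≤ a2 ∧ a2 < 2) (ha3 : 0 ≤ a3 ∧ a3 < 2)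
    (ha4 : 0 ≤ a4 ∧ a4 < 2) (hb1 : 0 ≤ b1 ∧ b1 < 2) (hb2 : 0 ≤ b2 ∧ b2 < 2)
    (hb3 : 0 ≤ b3 ∧ b3 < 2) (hb4 : 0 ≤ b4 ∧ b4 < 2) (hc1 : 0 ≤ c1 ∧ c1 < 2)
    (hc2 : 0 ≤ c2 ∧ c2 < 2) (hc3 : 0 ≤ c3 ∧ c3 < 2) (hc4 : 0 ≤ c4 ∧ c4 < 2)
    (d1 : b1 + b2 + c1 + c2 = 2) (d2 : a1 + a2 + c1 + c3 = 2) (d3 : a1 + a3 + b1 + b3 = 2)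
    (d4 : a3 + a4 + c2 + c4 = 2) (d5 : b3 + b4 + c3 + c4 = 2) (d6 : a2 + a4 + b2 + b4 = 2)
    (e1 : 0 < c2 + c3 + b2 + b3 + a2 + a3) (e2 : 0 < c2 + c3 + b1 + b4 + a1 + a4)
    (e3 : 0 < c1 + c4 + b2 + b3 + a1 + a4) (e4 : 0 < c1 + c4 + b1 + b4 + a2 + a3) :
    ((a1 = a3 ↔ b1 = b3) ∧ (a1 = a3 ↔ a2 = a4) ∧ (a1 = a3 ↔ b2 = b4)) ∧
      ((a1 = a2 ↔ c1 = c3) ∧ (a1 = a2 ↔ a3 = a4) ∧ (a1 = a2 ↔ c2 = c4)) ∧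
      ((b1 = b2 ↔ c1 = c2) ∧ (b1 = b2 ↔ b3 = b4) ∧ (b1 = b2 ↔ c3 = c4)) ∧
      (a1 = a3 → a1 ≠ b1) ∧ (a1 = a2 → a1 ≠ c1) ∧ (b1 = b2 → b1 ≠ c1) ∧
      ¬ (a1 = a3 ∧ a1 = a2) ∧ ¬ (a1 = a3 ∧ b1 = b2) ∧ ¬ (a1 = a2 ∧ b1 = b2) ∧
      (a1 ≠ a3 → a1 ≠ a2 → b1 ≠ b2 → (a1 + b1 + c1) % 2 = 0) := by
  obtain ⟨a1, rfl⟩ := exists_bool_of_bit ha1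
  obtain ⟨a2, rfl⟩ := exists_bool_of_bit ha2
  obtain ⟨a3, rfl⟩ := exists_bool_of_bit ha3
  obtain ⟨a4, rfl⟩ := exists_bool_of_bit ha4
  obtain ⟨b1, rfl⟩ := exists_bool_of_bit hb1
  obtain ⟨b2, rfl⟩ := exists_bool_of_bit hb2
  obtain ⟨b3, rfl⟩ := exists_bool_of_bit hb3
  obtain ⟨b4, rfl⟩ := exists_bool_of_bit hb4
  obtain ⟨c1, rfl⟩ := exists_bool_of_bit hc1
  obtain ⟨c2, rfl⟩ := exists_bool_of_bit hc2
  obtain ⟨c3, rfl⟩ := exists_bool_of_bit hc3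
  obtain ⟨c4, rfl⟩ := exists_bool_of_bit hc4
  have or6 : ∀ x1 x2 x3 x4 x5 x6 : Bool, (0 : ℤ) < x1.toNat + x2.toNat + x3.toNat + x4.toNat
      + x5.toNat + x6.toNat → (x1 || x2 || x3 || x4 || x5 || x6) = true := by decide
  have hx : ∀ x y z : Bool, (x ^^ y ^^ z) = false →
      ((x.toNat : ℤ) + y.toNat + z.toNat) % 2 = 0 := by decide
  simp only [ne_eq, toNat_int_inj]
  obtain ⟨h1, h2, h3, h4, h5, h6, h7, h8, h9, h10⟩ :=
    hamiltonian_table_bool b1 b2 c1 c2 (by exact_mod_cast d1) c3 a1 a2 (by exact_mod_cast d2) a3 b3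
      (by exact_mod_cast d3) a4 c4 (by exact_mod_cast d4) b4 (by exact_mod_cast d5)
      (by exact_mod_cast d6) (or6 _ _ _ _ _ _ e1) (or6 _ _ _ _ _ _ e2) (or6 _ _ _ _ _ _ e3)
      (or6 _ _ _ _ _ _ e4)
  exact ⟨h1, h2, h3, h4, h5, h6, h7, h8, h9, fun p q r => hx _ _ _ (h10 p q r)⟩

/-! ### Reduced coordinates of a polyhedron -/

/-- The squares with normal `x`, as bits, reduced by the checkerboard pattern. -/
noncomputable def dA (P : Set Pt) (i j k : ℤ) : ℤ := (bit (mX P i j k) + j + k) % 2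

/-- The squares with normal `y`, as bits, reduced by the checkerboard pattern. -/
noncomputable def dB (P : Set Pt) (i j k : ℤ) : ℤ := (bit (mY P i j k) + i + k) % 2

/-- The squares with normal `z`, as bits, reduced by the checkerboard pattern. -/
noncomputable def dC (P : Set Pt) (i j k : ℤ) : ℤ := (bit (mZ P i j k) + i + j) % 2

/-- The rules for the reduced coordinates `A`, `B`, `C` of the squares of a cubic polyhedron with
normals `x`, `y`, `z` and the lines `X`, `Y`, `Z` that carry columns of screws: coordinates in a
lattice plane change exactly across the lines in it. -/
structure Rules (A B C : ℤ → ℤ → ℤ → ℤ) (X Y Z : ℤ → ℤ → Prop) : Prop where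
  rangeA : ∀ i j k, 0 ≤ A i j k ∧ A i j k < 2
  rangeB : ∀ i j k, 0 ≤ B i j k ∧ B i j k < 2
  rangeC : ∀ i j k, 0 ≤ C i j k ∧ C i j k < 2
  ZA : ∀ i j k, Z i j ↔ A i (j - 1) k ≠ A i j k
  ZB : ∀ i j k, Z i j ↔ B (i - 1) j k ≠ B i j k
  YA : ∀ i j k, Y i k ↔ A i j (k - 1) ≠ A i j k
  YC : ∀ i j k, Y i k ↔ C (i - 1) j k ≠ C i j k
  XB : ∀ i j k, X j k ↔ B i j (k - 1) ≠ B i j k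
  XC : ∀ i j k, X j k ↔ C i (j - 1) k ≠ C i j k
  not_XY : ∀ {i j k}, X j k → ¬ Y i k
  not_XZ : ∀ {i j k}, X j k → ¬ Z i j
  not_YZ : ∀ {i j k}, Y i k → ¬ Z i j
  lineX : ∀ i {j k}, X j k → (B i j k + C i j k + 1 + j + k) % 2 = 0
  lineY : ∀ {i} j {k}, Y i k → (A i j k + C i j k + 1 + i + k) % 2 = 0
  lineZ : ∀ {i j} k, Z i j → (A i j k + B i j k + 1 + i + j) % 2 = 0
  vertex : ∀ {i j k}, ¬ X j k → ¬ Y i k → ¬ Z i j → (A i j k + B i j k + C i j k) % 2 = 0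

/-- This is `hamiltonian_table` at one vertex, in reduced coordinates. At a flange the two squares
in each of the two planes through the edge are both present or both absent; adjacent squares of a
plane have opposite checkerboard colours, so equal bits mean different reduced coordinates. The
second clause of each block relates opposite edges of the vertex, which is what lets screws continue
along a line. -/
theorem local_rules {P : Set Pt} (hP : IsCubicPolyhedron P) (i j k : ℤ) :
    ((dA P i (j - 1) k ≠ dA P i j k ↔ dB P (i - 1) j k ≠ dB P i j k) ∧
      (dA P i (j - 1) k ≠ dA P i j k ↔ dA P i (j - 1) (k - 1) ≠ dA P i j (k - 1))) ∧
    ((dA P i j (k - 1) ≠ dA P i j k ↔ dC P (i - 1) j k ≠ dC P i j k) ∧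
      (dA P i j (k - 1) ≠ dA P i j k ↔ dA P i (j - 1) (k - 1) ≠ dA P i (j - 1) k)) ∧
    ((dB P i j (k - 1) ≠ dB P i j k ↔ dC P i (j - 1) k ≠ dC P i j k) ∧
      (dB P i j (k - 1) ≠ dB P i j k ↔ dB P (i - 1) j (k - 1) ≠ dB P (i - 1) j k)) ∧
    (dA P i (j - 1) k ≠ dA P i j k → (dA P i j k + dB P i j k + 1 + i + j) % 2 = 0) ∧
    (dA P i j (k - 1) ≠ dA P i j k → (dA P i j k + dC P i j k + 1 + i + k) % 2 = 0) ∧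
    (dB P i j (k - 1) ≠ dB P i j k → (dB P i j k + dC P i j k + 1 + j + k) % 2 = 0) ∧
    ¬ (dA P i (j - 1) k ≠ dA P i j k ∧ dA P i j (k - 1) ≠ dA P i j k) ∧
    ¬ (dA P i (j - 1) k ≠ dA P i j k ∧ dB P i j (k - 1) ≠ dB P i j k) ∧
    ¬ (dA P i j (k - 1) ≠ dA P i j k ∧ dB P i j (k - 1) ≠ dB P i j k) ∧
    (dA P i (j - 1) k = dA P i j k → dA P i j (k - 1) = dA P i j k →
      dB P i j (k - 1) = dB P i j k → (dA P i j k + dB P i j k + dC P i j k) % 2 = 0) := by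
  have deg := link_degree hP ![i, j, k]
  have cut : ∀ s : Fin 3 → ℤˣ, ∃ a b : Fin 3, a ≠ b ∧
      bit ((link P ![i, j, k]).Adj (a, s a) (b, -s b)) = 1 := by
    intro s
    obtain ⟨a, b, hab, h⟩ := link_cut hP ![i, j, k] s
    exact ⟨a, b, hab, by simp [bit, h]⟩
  have z : ∀ (a : Fin 3) (s u : ℤˣ), bit ((link P ![i, j, k]).Adj (a, s) (a, u)) = 0 := by
    intro a s u
    rcases bit_cases ((link P ![i, j, k]).Adj (a, s) (a, u)) with h | h
    · exact absurd h.1 (not_adj_same _ _ _ _ _)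
    · exact h.2
  have d1 := deg (0, 1)
  have d2 := deg (0, -1)
  have d3 := deg (1, 1)
  have d4 := deg (1, -1)
  have d5 := deg (2, 1)
  have d6 := deg (2, -1)
  have e1 := cut ![1, 1, 1]
  have e2 := cut ![1, 1, -1]
  have e3 := cut ![1, -1, 1]
  have e4 := cut ![1, -1, -1]
  simp only [adj_yz, adj_xz, adj_xy, adj_zy, adj_zx, adj_yx, z, off_one, off_neg_one,
    Matrix.cons_val_zero, Matrix.cons_val_one, Matrix.cons_val, Fin.exists_fin_succ, Fin.succ_zero_eq_one,
    Fin.succ_one_eq_two, IsEmpty.exists_iff, or_false, neg_neg, ne_eq, not_true_eq_false, false_and,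
    false_or, Fin.isValue, add_zero, zero_add, ← sub_eq_add_neg, Fin.reduceEq, not_false_iff,
    true_and] at d1 d2 d3 d4 d5 d6 e1 e2 e3 e4
  have A1 := bit_range (mX P i j k)
  have A2 := bit_range (mX P i j (k - 1))
  have A3 := bit_range (mX P i (j - 1) k)
  have A4 := bit_range (mX P i (j - 1) (k - 1))
  have B1 := bit_range (mY P i j k)
  have B2 := bit_range (mY P i j (k - 1))
  have B3 := bit_range (mY P (i - 1) j k)
  have B4 := bit_range (mY P (i - 1) j (k - 1))
  have C1 := bit_range (mZ P i j k)
  have C2 := bit_range (mZ P i (j - 1) k)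
  have C3 := bit_range (mZ P (i - 1) j k)
  have C4 := bit_range (mZ P (i - 1) (j - 1) k)
  obtain ⟨⟨h1, h2, h3⟩, ⟨h4, h5, h6⟩, ⟨h7, h8, h9⟩, h10, h11, h12, h13, h14, h15, h16⟩ :=
    hamiltonian_table A1 A2 A3 A4 B1 B2 B3 B4 C1 C2 C3 C4 (by linarith) (by linarith)
      (by linarith) (by linarith) (by linarith) (by linarith) (by clear e2 e3 e4; omega)
      (by clear e1 e3 e4; omega) (by clear e1 e2 e4; omega) (by clear e1 e2 e3; omega)
  clear d1 d2 d3 d4 d5 d6 e1 e2 e3 e4 deg cut z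
  have jump : ∀ {x y m n : ℤ}, 0 ≤ x ∧ x < 2 → 0 ≤ y ∧ y < 2 → (m - n) % 2 = 1 →
      ((y + n) % 2 ≠ (x + m) % 2 ↔ x = y) := by omega
  have vA : ∀ i j k, dA P i j k = (bit (mX P i j k) + (j + k)) % 2 := by intros; simp [dA, add_assoc]
  have vB : ∀ i j k, dB P i j k = (bit (mY P i j k) + (i + k)) % 2 := by intros; simp [dB, add_assoc]
  have vC : ∀ i j k, dC P i j k = (bit (mZ P i j k) + (i + j)) % 2 := by intros; simp [dC, add_assoc]
  have j1 : dA P i (j - 1) k ≠ dA P i j k ↔ bit (mX P i j k) = bit (mX P i (j - 1) k) := by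
    rw [vA, vA]; exact jump A1 A3 (by omega)
  have j2 : dB P (i - 1) j k ≠ dB P i j k ↔ bit (mY P i j k) = bit (mY P (i - 1) j k) := by
    rw [vB, vB]; exact jump B1 B3 (by omega)
  have j3 : dA P i (j - 1) (k - 1) ≠ dA P i j (k - 1) ↔
      bit (mX P i j (k - 1)) = bit (mX P i (j - 1) (k - 1)) := by
    rw [vA, vA]; exact jump A2 A4 (by omega)
  have j4 : dA P i j (k - 1) ≠ dA P i j k ↔ bit (mX P i j k) = bit (mX P i j (k - 1)) := by
    rw [vA, vA]; exact jump A1 A2 (by omega)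
  have j5 : dC P (i - 1) j k ≠ dC P i j k ↔ bit (mZ P i j k) = bit (mZ P (i - 1) j k) := by
    rw [vC, vC]; exact jump C1 C3 (by omega)
  have j6 : dA P i (j - 1) (k - 1) ≠ dA P i (j - 1) k ↔
      bit (mX P i (j - 1) k) = bit (mX P i (j - 1) (k - 1)) := by
    rw [vA, vA]; exact jump A3 A4 (by omega)
  have j7 : dB P i j (k - 1) ≠ dB P i j k ↔ bit (mY P i j k) = bit (mY P i j (k - 1)) := by
    rw [vB, vB]; exact jump B1 B2 (by omega)
  have j8 : dC P i (j - 1) k ≠ dC P i j k ↔ bit (mZ P i j k) = bit (mZ P i (j - 1) k) := by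
    rw [vC, vC]; exact jump C1 C2 (by omega)
  have j9 : dB P (i - 1) j (k - 1) ≠ dB P (i - 1) j k ↔
      bit (mY P (i - 1) j k) = bit (mY P (i - 1) j (k - 1)) := by
    rw [vB, vB]; exact jump B3 B4 (by omega)
  refine ⟨⟨by rw [j1, j2, h1], by rw [j1, j3, h2]⟩, ⟨by rw [j4, j5, h4], by rw [j4, j6, h5]⟩,
    ⟨by rw [j7, j8, h7], by rw [j7, j9, h8]⟩, ?_, ?_, ?_, by rwa [j1, j4], by rwa [j1, j7],
    by rwa [j4, j7], ?_⟩
  · intro h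
    have := h10 (j1.1 h)
    clear * - A1 B1 this vA vB
    rw [vA, vB]
    omega
  · intro h
    have := h11 (j4.1 h)
    clear * - A1 C1 this vA vC
    rw [vA, vC]
    omega
  · intro h
    have := h12 (j7.1 h)
    clear * - B1 C1 this vB vC
    rw [vB, vC]
    omega
  · intro g1 g2 g3
    have := h16 (fun h => j1.2 h g1) (fun h => j4.2 h g2) (fun h => j7.2 h g3)
    clear * - A1 B1 C1 this vA vB vC
    rw [vA, vB, vC]
    omega

/-- A property that passes between neighbours holds for all integers or for none. -/
theorem iff_of_step {p : ℤ → Prop} (h : ∀ n, p (n - 1) ↔ p n) (m n : ℤ) : p m ↔ p n := by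
  have key : ∀ n, p n ↔ p 0 := by
    intro n
    induction n using Int.induction_on with
    | zero => rfl
    | succ n ih => rw [← ih, ← h (n + 1), add_sub_cancel_right]
    | pred n ih => rw [← ih, ← h (-n)]
  rw [key m, key n]

/-- The reduced coordinates of a cubic polyhedron obey the rules. -/
theorem IsCubicPolyhedron.rules {P : Set Pt} (hP : IsCubicPolyhedron P) :
    ∃ X Y Z, Rules (dA P) (dB P) (dC P) X Y Z := by
  have L := local_rules hP
  have rA : ∀ i j k, 0 ≤ dA P i j k ∧ dA P i j k < 2 := by intros; unfold dA; omega
  have rB : ∀ i j k, 0 ≤ dB P i j k ∧ dB P i j k < 2 := by intros; unfold dB; omega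
  have rC : ∀ i j k, 0 ≤ dC P i j k ∧ dC P i j k < 2 := by intros; unfold dC; omega
  -- The jump across a line is the same at all heights along it, so the line can be defined by the
  -- jump at position `0`.
  have hZ : ∀ i j k, (dA P i (j - 1) 0 ≠ dA P i j 0) ↔ dA P i (j - 1) k ≠ dA P i j k := fun i j k =>
    iff_of_step (p := fun k => dA P i (j - 1) k ≠ dA P i j k) (fun k => (L i j k).1.2.symm) 0 k
  have hY : ∀ i j k, (dA P i 0 (k - 1) ≠ dA P i 0 k) ↔ dA P i j (k - 1) ≠ dA P i j k := fun i j k =>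
    iff_of_step (p := fun j => dA P i j (k - 1) ≠ dA P i j k) (fun j => (L i j k).2.1.2.symm) 0 j
  have hX : ∀ i j k, (dB P 0 j (k - 1) ≠ dB P 0 j k) ↔ dB P i j (k - 1) ≠ dB P i j k := fun i j k =>
    iff_of_step (p := fun i => dB P i j (k - 1) ≠ dB P i j k) (fun i => (L i j k).2.2.1.2.symm) 0 i
  refine ⟨fun j k => dB P 0 j (k - 1) ≠ dB P 0 j k, fun i k => dA P i 0 (k - 1) ≠ dA P i 0 k,
    fun i j => dA P i (j - 1) 0 ≠ dA P i j 0, rA, rB, rC, hZ, ?_, hY, ?_, hX, ?_, ?_, ?_, ?_, ?_, ?_,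
    ?_, ?_⟩
  · intro i j k
    rw [hZ i j k, (L i j k).1.1]
  · intro i j k
    rw [hY i j k, (L i j k).2.1.1]
  · intro i j k
    rw [hX i j k, (L i j k).2.2.1.1]
  · intro i j k h1 h2
    rw [hX i j k] at h1
    rw [hY i j k] at h2
    exact (L i j k).2.2.2.2.2.2.2.2.1 ⟨h2, h1⟩
  · intro i j k h1 h2
    rw [hX i j k] at h1
    rw [hZ i j k] at h2
    exact (L i j k).2.2.2.2.2.2.2.1 ⟨h2, h1⟩
  · intro i j k h1 h2
    rw [hY i j k] at h1
    rw [hZ i j k] at h2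
    exact (L i j k).2.2.2.2.2.2.1 ⟨h2, h1⟩
  · intro i j k h
    exact (L i j k).2.2.2.2.2.1 ((hX i j k).1 h)
  · intro i j k h
    exact (L i j k).2.2.2.2.1 ((hY i j k).1 h)
  · intro i j k h
    exact (L i j k).2.2.2.1 ((hZ i j k).1 h)
  · intro i j k h1 h2 h3
    rw [hX i j k, not_not] at h1
    rw [hY i j k, not_not] at h2
    rw [hZ i j k, not_not] at h3
    exact (L i j k).2.2.2.2.2.2.2.2.2 h3 h2 h1

end CubicPolyhedra

/-! ### Sets of squares in reduced coordinates and their congruences -/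

namespace CubicPolyhedra

/-- All elements of `P` are squares of the cubic lattice. -/
def OnlySquares (P : Set Pt) : Prop := ∀ c ∈ P, ∃ n : Fin 3, ∀ i, Even (c i) ↔ i = n

theorem square_cases {c : Pt} (h : ∃ n : Fin 3, ∀ i, Even (c i) ↔ i = n) :
    (∃ i j k, c = ![2 * i, 2 * j + 1, 2 * k + 1]) ∨ (∃ i j k, c = ![2 * i + 1, 2 * j, 2 * k + 1]) ∨
      ∃ i j k, c = ![2 * i + 1, 2 * j + 1, 2 * k] := by
  obtain ⟨n, h⟩ := h
  have h0 := h 0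
  have h1 := h 1
  have h2 := h 2
  have ext3 : ∀ x y z : ℤ, c 0 = x → c 1 = y → c 2 = z → c = ![x, y, z] := by
    rintro x y z rfl rfl rfl
    funext i
    fin_cases i <;> rfl
  fin_cases n <;> simp [Int.even_iff] at h0 h1 h2
  · exact .inl ⟨c 0 / 2, c 1 / 2, c 2 / 2, ext3 _ _ _ (by omega) (by omega) (by omega)⟩
  · exact .inr (.inl ⟨c 0 / 2, c 1 / 2, c 2 / 2, ext3 _ _ _ (by omega) (by omega) (by omega)⟩)
  · exact .inr (.inr ⟨c 0 / 2, c 1 / 2, c 2 / 2, ext3 _ _ _ (by omega) (by omega) (by omega)⟩)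

theorem isSquare_x (i j k : ℤ) :
    ∃ n : Fin 3, ∀ l, Even ((![2 * i, 2 * j + 1, 2 * k + 1] : Pt) l) ↔ l = n :=
  ⟨0, fun l => by fin_cases l <;> simp⟩

theorem isSquare_y (i j k : ℤ) :
    ∃ n : Fin 3, ∀ l, Even ((![2 * i + 1, 2 * j, 2 * k + 1] : Pt) l) ↔ l = n :=
  ⟨1, fun l => by fin_cases l <;> simp⟩

theorem isSquare_z (i j k : ℤ) :
    ∃ n : Fin 3, ∀ l, Even ((![2 * i + 1, 2 * j + 1, 2 * k] : Pt) l) ↔ l = n :=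
  ⟨2, fun l => by fin_cases l <;> simp⟩

theorem mX_iff (P : Set Pt) (i j k : ℤ) : mX P i j k ↔ (dA P i j k + j + k) % 2 = 1 := by
  unfold dA
  rcases bit_cases (mX P i j k) with h | h
  · exact ⟨fun _ => by omega, fun _ => h.1⟩
  · exact ⟨fun h' => absurd h' h.1, fun _ => by omega⟩

theorem mY_iff (P : Set Pt) (i j k : ℤ) : mY P i j k ↔ (dB P i j k + i + k) % 2 = 1 := by
  unfold dB
  rcases bit_cases (mY P i j k) with h | h
  · exact ⟨fun _ => by omega, fun _ => h.1⟩
  · exact ⟨fun h' => absurd h' h.1, fun _ => by omega⟩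

theorem mZ_iff (P : Set Pt) (i j k : ℤ) : mZ P i j k ↔ (dC P i j k + i + j) % 2 = 1 := by
  unfold dC
  rcases bit_cases (mZ P i j k) with h | h
  · exact ⟨fun _ => by omega, fun _ => h.1⟩
  · exact ⟨fun h' => absurd h' h.1, fun _ => by omega⟩

/-- A set of squares is determined by its reduced coordinates. -/
theorem OnlySquares.ext {P Q : Set Pt} (hP : OnlySquares P) (hQ : OnlySquares Q)
    (hA : ∀ i j k, dA P i j k = dA Q i j k) (hB : ∀ i j k, dB P i j k = dB Q i j k)
    (hC : ∀ i j k, dC P i j k = dC Q i j k) : P = Q := by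
  have key : ∀ c, (∃ n : Fin 3, ∀ i, Even (c i) ↔ i = n) → (c ∈ P ↔ c ∈ Q) := by
    intro c hc
    rcases square_cases hc with ⟨i, j, k, rfl⟩ | ⟨i, j, k, rfl⟩ | ⟨i, j, k, rfl⟩
    · change mX P i j k ↔ mX Q i j k
      rw [mX_iff, mX_iff, hA]
    · change mY P i j k ↔ mY Q i j k
      rw [mY_iff, mY_iff, hB]
    · change mZ P i j k ↔ mZ Q i j k
      rw [mZ_iff, mZ_iff, hC]
  ext c
  exact ⟨fun h => (key c (hP c h)).1 h, fun h => (key c (hQ c h)).2 h⟩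

/-! ### Congruences -/

theorem Congruent.trans {P Q R : Set Pt} (h : Congruent P Q) (h' : Congruent Q R) :
    Congruent P R := by
  obtain ⟨π, ε, t, rfl⟩ := h
  obtain ⟨π', ε', t', rfl⟩ := h'
  refine ⟨π'.trans π, fun i => ε' i * ε (π' i), fun i => ε' i * t (π' i) + t' i, ?_⟩
  rw [Set.image_image]
  refine congrArg (· '' P) ?_
  funext c i
  simp only [Units.val_mul, Equiv.trans_apply]
  ring

/-- The image of `P` under the permutation `π` of the coordinates. -/
def permute (π : Equiv.Perm (Fin 3)) (P : Set Pt) : Set Pt := {c | (fun i => c (π.symm i)) ∈ P}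

/-- The translate of `P` by the lattice vector `u`. -/
def translate (u : Pt) (P : Set Pt) : Set Pt := {c | (fun i => c i - 2 * u i) ∈ P}

theorem congruent_permute (π : Equiv.Perm (Fin 3)) (P : Set Pt) : Congruent P (permute π P) := by
  refine ⟨π, 1, 0, ?_⟩
  ext c
  simp only [permute, Set.mem_ofPred_eq, Pi.one_apply, Units.val_one, one_mul, Pi.zero_apply,
    mul_zero, add_zero, Set.mem_image]
  constructor
  · intro h
    exact ⟨_, h, by simp⟩
  · rintro ⟨d, hd, rfl⟩
    simpa using hd

theorem congruent_translate (u : Pt) (P : Set Pt) : Congruent P (translate u P) := by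
  refine ⟨1, 1, u, ?_⟩
  ext c
  simp only [translate, Set.mem_ofPred_eq, Pi.one_apply, Units.val_one, one_mul, Set.mem_image,
    Equiv.Perm.one_apply]
  constructor
  · intro h
    exact ⟨_, h, by simp⟩
  · rintro ⟨d, hd, rfl⟩
    simpa using hd

theorem OnlySquares.permute {P : Set Pt} (hP : OnlySquares P) (π : Equiv.Perm (Fin 3)) :
    OnlySquares (permute π P) := by
  intro c hc
  obtain ⟨n, hn⟩ := hP _ hc
  refine ⟨π.symm n, fun i => ?_⟩
  have := hn (π i)
  simp only [Equiv.symm_apply_apply] at this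
  rw [this, Equiv.eq_symm_apply]

theorem OnlySquares.translate {P : Set Pt} (hP : OnlySquares P) (u : Pt) :
    OnlySquares (translate u P) := by
  intro c hc
  obtain ⟨n, hn⟩ := hP _ hc
  refine ⟨n, fun i => ?_⟩
  rw [← hn i, Int.even_sub]
  simp

/-- A set of squares whose reduced coordinates obey the rules. -/
structure Ruled (P : Set Pt) (X Y Z : ℤ → ℤ → Prop) : Prop where
  squares : OnlySquares P
  rules : Rules (dA P) (dB P) (dC P) X Y Z

/-- Together with `swap_yz` this generates all permutations of the axes, so that later arguments
need to be made for one axis only. -/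
theorem Rules.swap_xy {A B C X Y Z} (h : Rules A B C X Y Z) :
    Rules (fun i j k => B j i k) (fun i j k => A j i k) (fun i j k => C j i k) Y X
      (fun i j => Z j i) where
  rangeA _ _ _ := h.rangeB _ _ _
  rangeB _ _ _ := h.rangeA _ _ _
  rangeC _ _ _ := h.rangeC _ _ _
  ZA _ _ _ := h.ZB _ _ _
  ZB _ _ _ := h.ZA _ _ _
  YA _ _ _ := h.XB _ _ _
  YC _ _ _ := h.XC _ _ _
  XB _ _ _ := h.YA _ _ _
  XC _ _ _ := h.YC _ _ _
  not_XY h1 h2 := h.not_XY h2 h1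
  not_XZ h1 h2 := h.not_YZ h1 h2
  not_YZ h1 h2 := h.not_XZ h1 h2
  lineX _ _ _ h1 := h.lineY _ h1
  lineY _ _ h1 := h.lineX _ h1
  lineZ k h1 := by have := h.lineZ k h1; omega
  vertex h1 h2 h3 := by have := h.vertex h2 h1 h3; omega

theorem Rules.swap_yz {A B C X Y Z} (h : Rules A B C X Y Z) :
    Rules (fun i j k => A i k j) (fun i j k => C i k j) (fun i j k => B i k j) (fun j k => X k j)
      Z Y where
  rangeA _ _ _ := h.rangeA _ _ _
  rangeB _ _ _ := h.rangeC _ _ _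
  rangeC _ _ _ := h.rangeB _ _ _
  ZA _ _ _ := h.YA _ _ _
  ZB _ _ _ := h.YC _ _ _
  YA _ _ _ := h.ZA _ _ _
  YC _ _ _ := h.ZB _ _ _
  XB _ _ _ := h.XC _ _ _
  XC _ _ _ := h.XB _ _ _
  not_XY h1 h2 := h.not_XZ h1 h2
  not_XZ h1 h2 := h.not_XY h1 h2
  not_YZ h1 h2 := h.not_YZ h2 h1
  lineX i _ _ h1 := by have := h.lineX i h1; omega
  lineY _ _ h1 := h.lineZ _ h1
  lineZ _ h1 := h.lineY _ h1
  vertex h1 h2 h3 := by have := h.vertex h1 h3 h2; omega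

/-- A translation shifts the checkerboards as well, which adds a constant to each coordinate. This
is the freedom used later to make constants vanish. -/
theorem Rules.translate {A B C X Y Z} (h : Rules A B C X Y Z) (a b c : ℤ) :
    Rules (fun i j k => (A (i - a) (j - b) (k - c) + b + c) % 2)
      (fun i j k => (B (i - a) (j - b) (k - c) + a + c) % 2)
      (fun i j k => (C (i - a) (j - b) (k - c) + a + b) % 2)
      (fun j k => X (j - b) (k - c)) (fun i k => Y (i - a) (k - c))
      (fun i j => Z (i - a) (j - b)) where
  rangeA _ _ _ := by omega
  rangeB _ _ _ := by omega
  rangeC _ _ _ := by omega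
  ZA i j k := by
    have h1 := h.rangeA (i - a) (j - b) (k - c)
    have h2 := h.rangeA (i - a) (j - 1 - b) (k - c)
    rw [h.ZA _ _ (k - c), show j - b - 1 = j - 1 - b by ring]
    omega
  ZB i j k := by
    have h1 := h.rangeB (i - a) (j - b) (k - c)
    have h2 := h.rangeB (i - 1 - a) (j - b) (k - c)
    rw [h.ZB _ _ (k - c), show i - a - 1 = i - 1 - a by ring]
    omega
  YA i j k := by
    have h1 := h.rangeA (i - a) (j - b) (k - c)
    have h2 := h.rangeA (i - a) (j - b) (k - 1 - c)
    rw [h.YA _ (j - b) _, show k - c - 1 = k - 1 - c by ring]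
    omega
  YC i j k := by
    have h1 := h.rangeC (i - a) (j - b) (k - c)
    have h2 := h.rangeC (i - 1 - a) (j - b) (k - c)
    rw [h.YC _ (j - b) _, show i - a - 1 = i - 1 - a by ring]
    omega
  XB i j k := by
    have h1 := h.rangeB (i - a) (j - b) (k - c)
    have h2 := h.rangeB (i - a) (j - b) (k - 1 - c)
    rw [h.XB (i - a) _ _, show k - c - 1 = k - 1 - c by ring]
    omega
  XC i j k := by
    have h1 := h.rangeC (i - a) (j - b) (k - c)
    have h2 := h.rangeC (i - a) (j - 1 - b) (k - c)
    rw [h.XC (i - a) _ _, show j - b - 1 = j - 1 - b by ring]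
    omega
  not_XY h1 h2 := h.not_XY h1 h2
  not_XZ h1 h2 := h.not_XZ h1 h2
  not_YZ h1 h2 := h.not_YZ h1 h2
  lineX i _ _ h1 := by have := h.lineX (i - a) h1; omega
  lineY j _ h1 := by have := h.lineY (j - b) h1; omega
  lineZ k h1 := by have := h.lineZ (k - c) h1; omega
  vertex h1 h2 h3 := by have := h.vertex h1 h2 h3; omega

theorem Ruled.swap_xy {P X Y Z} (h : Ruled P X Y Z) :
    Ruled (permute (Equiv.swap 0 1) P) Y X (fun i j => Z j i) := by
  refine ⟨h.squares.permute _, ?_⟩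
  have e : ∀ c : Pt, (fun i => c ((Equiv.swap (0 : Fin 3) 1).symm i)) = ![c 1, c 0, c 2] := by
    intro c; funext i; fin_cases i <;> rfl
  have eA : dA (permute (Equiv.swap 0 1) P) = fun i j k => dB P j i k := by
    funext i j k
    simp only [dA, dB, mX, mY, permute, Set.mem_ofPred_eq, e]
    rfl
  have eB : dB (permute (Equiv.swap 0 1) P) = fun i j k => dA P j i k := by
    funext i j k
    simp only [dA, dB, mX, mY, permute, Set.mem_ofPred_eq, e]
    rfl
  have eC : dC (permute (Equiv.swap 0 1) P) = fun i j k => dC P j i k := by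
    funext i j k
    simp only [dC, mZ, permute, Set.mem_ofPred_eq, e, add_right_comm _ i j]
    rfl
  rw [eA, eB, eC]
  exact h.rules.swap_xy

theorem Ruled.swap_yz {P X Y Z} (h : Ruled P X Y Z) :
    Ruled (permute (Equiv.swap 1 2) P) (fun j k => X k j) Z Y := by
  refine ⟨h.squares.permute _, ?_⟩
  have e : ∀ c : Pt, (fun i => c ((Equiv.swap (1 : Fin 3) 2).symm i)) = ![c 0, c 2, c 1] := by
    intro c; funext i; fin_cases i <;> rfl
  have eA : dA (permute (Equiv.swap 1 2) P) = fun i j k => dA P i k j := by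
    funext i j k
    simp only [dA, mX, permute, Set.mem_ofPred_eq, e, add_right_comm _ j k]
    rfl
  have eB : dB (permute (Equiv.swap 1 2) P) = fun i j k => dC P i k j := by
    funext i j k
    simp only [dB, dC, mY, mZ, permute, Set.mem_ofPred_eq, e]
    rfl
  have eC : dC (permute (Equiv.swap 1 2) P) = fun i j k => dB P i k j := by
    funext i j k
    simp only [dB, dC, mY, mZ, permute, Set.mem_ofPred_eq, e]
    rfl
  rw [eA, eB, eC]
  exact h.rules.swap_yz

theorem reduced_translate (P : Set Pt) (a b c i j k : ℤ) :
    dA (translate ![a, b, c] P) i j k = (dA P (i - a) (j - b) (k - c) + b + c) % 2 ∧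
    dB (translate ![a, b, c] P) i j k = (dB P (i - a) (j - b) (k - c) + a + c) % 2 ∧
    dC (translate ![a, b, c] P) i j k = (dC P (i - a) (j - b) (k - c) + a + b) % 2 := by
  have e : ∀ x : Pt, (fun l => x l - 2 * (![a, b, c] : Pt) l)
      = ![x 0 - 2 * a, x 1 - 2 * b, x 2 - 2 * c] := by
    intro x; funext l; fin_cases l <;> rfl
  simp only [dA, dB, dC, mX, mY, mZ, translate, Set.mem_ofPred_eq, e, Matrix.cons_val_zero,
    Matrix.cons_val_one, Matrix.cons_val]
  have e1 : ∀ x y : ℤ, 2 * x - 2 * y = 2 * (x - y) := by intros; ring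
  have e2 : ∀ x y : ℤ, 2 * x + 1 - 2 * y = 2 * (x - y) + 1 := by intros; ring
  simp only [e1, e2]
  refine ⟨?_, ?_, ?_⟩ <;> omega

theorem Ruled.translate {P X Y Z} (h : Ruled P X Y Z) (a b c : ℤ) :
    Ruled (translate ![a, b, c] P) (fun j k => X (j - b) (k - c)) (fun i k => Y (i - a) (k - c))
      (fun i j => Z (i - a) (j - b)) := by
  refine ⟨h.squares.translate _, ?_⟩
  have eA : dA (CubicPolyhedra.translate ![a, b, c] P) = _ :=
    funext fun i => funext fun j => funext fun k => (reduced_translate P a b c i j k).1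
  have eB : dB (CubicPolyhedra.translate ![a, b, c] P) = _ :=
    funext fun i => funext fun j => funext fun k => (reduced_translate P a b c i j k).2.1
  have eC : dC (CubicPolyhedra.translate ![a, b, c] P) = _ :=
    funext fun i => funext fun j => funext fun k => (reduced_translate P a b c i j k).2.2
  rw [eA, eB, eC]
  exact h.rules.translate a b c

end CubicPolyhedra

/-! ### Planes that contain lines, and parity relations on unit cubes -/

namespace CubicPolyhedra

/-- Some line with first coordinate `a` belongs to `R`. -/
def Fst (R : ℤ → ℤ → Prop) (a : ℤ) : Prop := ∃ b, R a b

/-- Some line with second coordinate `b` belongs to `R`. -/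
def Snd (R : ℤ → ℤ → Prop) (b : ℤ) : Prop := ∃ a, R a b

theorem const_of_step {α : Type*} {f : ℤ → α} (h : ∀ n, f (n - 1) = f n) (m n : ℤ) : f m = f n := by
  have key : ∀ n, f n = f 0 := by
    intro n
    induction n using Int.induction_on with
    | zero => rfl
    | succ n ih => rw [← ih, ← h (n + 1), add_sub_cancel_right]
    | pred n ih => rw [← ih, ← h (-n)]
  rw [key m, key n]

/-- At an end of the run of integers with the property `p` that contains `a`, there is a unit
interval `[c, c + 1]` with one end `m` in the run and the other end `n` outside. -/
theorem exists_boundary {p : ℤ → Prop} {a b : ℤ} (ha : p a) (hb : ¬ p b) :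
    ∃ c m n, (c = m ∨ c = m - 1) ∧ (c = n ∨ c = n - 1) ∧ p m ∧ ¬ p n ∧
      ∀ f : ℤ → ℤ, (∀ l, p l → f (l - 1) = f l) → f c = f a := by
  have up : ∀ (l : ℕ) (a : ℤ), p a → ¬ p (a + l) → ∃ c m n, (c = m ∨ c = m - 1) ∧
      (c = n ∨ c = n - 1) ∧ p m ∧ ¬ p n ∧
      ∀ f : ℤ → ℤ, (∀ l, p l → f (l - 1) = f l) → f c = f a := by
    intro l
    induction l with
    | zero => intro a h1 h2; exact absurd h1 (by simpa using h2)
    | succ l ih =>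
      intro a h1 h2
      by_cases h3 : p (a + 1)
      · obtain ⟨c, m, n, hm, hn, hpm, hpn, hf⟩ :=
          ih (a + 1) h3 (by convert h2 using 1; push_cast; ring_nf)
        refine ⟨c, m, n, hm, hn, hpm, hpn, fun f h => ?_⟩
        rw [hf f h, ← h (a + 1) h3, add_sub_cancel_right]
      · exact ⟨a, a, a + 1, .inl rfl, .inr (by ring), h1, h3, fun f _ => rfl⟩
  have down : ∀ (l : ℕ) (a : ℤ), p a → ¬ p (a - l) → ∃ c m n, (c = m ∨ c = m - 1) ∧
      (c = n ∨ c = n - 1) ∧ p m ∧ ¬ p n ∧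
      ∀ f : ℤ → ℤ, (∀ l, p l → f (l - 1) = f l) → f c = f a := by
    intro l
    induction l with
    | zero => intro a h1 h2; exact absurd h1 (by simpa using h2)
    | succ l ih =>
      intro a h1 h2
      by_cases h3 : p (a - 1)
      · obtain ⟨c, m, n, hm, hn, hpm, hpn, hf⟩ :=
          ih (a - 1) h3 (by convert h2 using 1; push_cast; ring_nf)
        exact ⟨c, m, n, hm, hn, hpm, hpn, fun f h => by rw [hf f h, h a h1]⟩
      · exact ⟨a - 1, a, a - 1, .inr rfl, .inl rfl, h1, h3, fun f h => h a h1⟩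
  rcases le_total a b with h | h
  · refine up (b - a).toNat a ha ?_
    rwa [Int.toNat_of_nonneg (by omega), add_sub_cancel]
  · refine down (a - b).toNat a ha ?_
    rwa [Int.toNat_of_nonneg (by omega), sub_sub_cancel]

namespace Rules

variable {A B C : ℤ → ℤ → ℤ → ℤ} {X Y Z : ℤ → ℤ → Prop}


theorem A_of_not_Z (h : Rules A B C X Y Z) {i j} (hz : ¬ Z i j) (k : ℤ) :
    A i (j - 1) k = A i j k := by
  by_contra h'
  exact hz ((h.ZA i j k).2 h')

theorem B_of_not_Z (h : Rules A B C X Y Z) {i j} (hz : ¬ Z i j) (k : ℤ) :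
    B (i - 1) j k = B i j k := by
  by_contra h'
  exact hz ((h.ZB i j k).2 h')

theorem A_of_not_Y (h : Rules A B C X Y Z) {i k} (hy : ¬ Y i k) (j : ℤ) :
    A i j (k - 1) = A i j k := by
  by_contra h'
  exact hy ((h.YA i j k).2 h')

theorem C_of_not_Y (h : Rules A B C X Y Z) {i k} (hy : ¬ Y i k) (j : ℤ) :
    C (i - 1) j k = C i j k := by
  by_contra h'
  exact hy ((h.YC i j k).2 h')

theorem B_of_not_X (h : Rules A B C X Y Z) {j k} (hx : ¬ X j k) (i : ℤ) :
    B i j (k - 1) = B i j k := by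
  by_contra h'
  exact hx ((h.XB i j k).2 h')

theorem C_of_not_X (h : Rules A B C X Y Z) {j k} (hx : ¬ X j k) (i : ℤ) :
    C i (j - 1) k = C i j k := by
  by_contra h'
  exact hx ((h.XC i j k).2 h')

theorem A_const_j (h : Rules A B C X Y Z) {i} (hi : ¬ Fst Z i) (j j' k : ℤ) :
    A i j k = A i j' k :=
  const_of_step (f := fun j => A i j k) (fun j => h.A_of_not_Z (fun hz => hi ⟨j, hz⟩) k) j j'

theorem A_const_k (h : Rules A B C X Y Z) {i} (hi : ¬ Fst Y i) (j k k' : ℤ) :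
    A i j k = A i j k' :=
  const_of_step (f := fun k => A i j k) (fun k => h.A_of_not_Y (fun hy => hi ⟨k, hy⟩) j) k k'

theorem B_const_i (h : Rules A B C X Y Z) {j} (hj : ¬ Snd Z j) (i i' k : ℤ) :
    B i j k = B i' j k :=
  const_of_step (f := fun i => B i j k) (fun i => h.B_of_not_Z (fun hz => hj ⟨i, hz⟩) k) i i'

theorem B_const_k (h : Rules A B C X Y Z) {j} (hj : ¬ Fst X j) (i k k' : ℤ) :
    B i j k = B i j k' :=
  const_of_step (f := fun k => B i j k) (fun k => h.B_of_not_X (fun hx => hj ⟨k, hx⟩) i) k k'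

theorem C_const_i (h : Rules A B C X Y Z) {k} (hk : ¬ Snd Y k) (i i' j : ℤ) :
    C i j k = C i' j k :=
  const_of_step (f := fun i => C i j k) (fun i => h.C_of_not_Y (fun hy => hk ⟨i, hy⟩) j) i i'

theorem C_const_j (h : Rules A B C X Y Z) {k} (hk : ¬ Snd X k) (i j j' : ℤ) :
    C i j k = C i j' k :=
  const_of_step (f := fun j => C i j k) (fun j => h.C_of_not_X (fun hx => hk ⟨j, hx⟩) i) j j'

/-- Lines along `y` and `z` in the same plane `x = i` would meet in a vertex. So each lattice plane
carries lines of at most one direction, the basic dichotomy of the three-axis case. -/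
theorem not_Fst_Y (h : Rules A B C X Y Z) {i} : Fst Z i → ¬ Fst Y i :=
  fun ⟨_, hz⟩ ⟨_, hy⟩ => h.not_YZ hy hz

theorem not_Fst_Z (h : Rules A B C X Y Z) {i} : Fst Y i → ¬ Fst Z i :=
  fun h1 h2 => h.not_Fst_Y h2 h1

theorem not_Fst_X (h : Rules A B C X Y Z) {j} : Snd Z j → ¬ Fst X j :=
  fun ⟨_, hz⟩ ⟨_, hx⟩ => h.not_XZ hx hz

theorem not_Snd_Z (h : Rules A B C X Y Z) {j} : Fst X j → ¬ Snd Z j :=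
  fun h1 h2 => h.not_Fst_X h2 h1

theorem not_Snd_X (h : Rules A B C X Y Z) {k} : Snd Y k → ¬ Snd X k :=
  fun ⟨_, hy⟩ ⟨_, hx⟩ => h.not_XY hx hy

theorem not_Snd_Y (h : Rules A B C X Y Z) {k} : Snd X k → ¬ Snd Y k :=
  fun h1 h2 => h.not_Snd_X h2 h1

/-! The rules at an edge or a corner of a unit cube. The cube has the coordinates of its centre,
rounded down, as index. -/

theorem A_near (h : Rules A B C X Y Z) {i j k jc kc} (hz : ¬ Z i j) (hy : ¬ Y i k)
    (hj : jc = j ∨ jc = j - 1) (hk : kc = k ∨ kc = k - 1) : A i jc kc = A i j k := by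
  rcases hj with rfl | rfl <;> rcases hk with rfl | rfl <;>
    simp only [h.A_of_not_Z hz, h.A_of_not_Y hy]

/-- When no line passes through the vertex, each coordinate has the same value on the four squares
of its plane there, so the saddle relation holds for the three faces of every cube at this vertex.
-/
theorem cube_vertex (h : Rules A B C X Y Z) {i j k ic jc kc} (hx : ¬ X j k) (hy : ¬ Y i k)
    (hz : ¬ Z i j) (hi : ic = i ∨ ic = i - 1) (hj : jc = j ∨ jc = j - 1)
    (hk : kc = k ∨ kc = k - 1) : (A i jc kc + B ic j kc + C ic jc k) % 2 = 0 := by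
  have hB : B ic j kc = B i j k := by
    rcases hi with rfl | rfl <;> rcases hk with rfl | rfl <;>
      simp only [h.B_of_not_Z hz, h.B_of_not_X hx]
  have hC : C ic jc k = C i j k := by
    rcases hi with rfl | rfl <;> rcases hj with rfl | rfl <;>
      simp only [h.C_of_not_Y hy, h.C_of_not_X hx]
  rw [h.A_near hz hy hj hk, hB, hC]
  exact h.vertex hx hy hz

/-- The coordinates jump across the line, but so does the parity of `jc + kc`; hence the relation
has the same form in all four cubes around the line. -/
theorem cube_X (h : Rules A B C X Y Z) {j k jc kc} (hx : X j k) (ic : ℤ)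
    (hj : jc = j ∨ jc = j - 1) (hk : kc = k ∨ kc = k - 1) :
    (B ic j kc + C ic jc k + 1 + jc + kc) % 2 = 0 := by
  have h0 := h.lineX ic hx
  have h1 := (h.XB ic j k).1 hx
  have h2 := (h.XC ic j k).1 hx
  have r1 := h.rangeB ic j k
  have r2 := h.rangeB ic j (k - 1)
  have r3 := h.rangeC ic j k
  have r4 := h.rangeC ic (j - 1) k
  rcases hj with rfl | rfl <;> rcases hk with rfl | rfl <;> omega

theorem cube_Y (h : Rules A B C X Y Z) {i k ic kc} (hy : Y i k) (jc : ℤ)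
    (hi : ic = i ∨ ic = i - 1) (hk : kc = k ∨ kc = k - 1) :
    (A i jc kc + C ic jc k + 1 + ic + kc) % 2 = 0 :=
  h.swap_xy.cube_X hy jc hi hk

theorem cube_Z (h : Rules A B C X Y Z) {i j ic jc} (hz : Z i j) (kc : ℤ)
    (hi : ic = i ∨ ic = i - 1) (hj : jc = j ∨ jc = j - 1) :
    (A i jc kc + B ic j kc + 1 + ic + jc) % 2 = 0 :=
  h.swap_yz.cube_Y hz kc hi hj

/-! ### Polyhedra with screws along all three axes -/

/-- There are as many lines `X` as the planes with lines `Y` and `Z` permit. -/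
def FullX (X Y Z : ℤ → ℤ → Prop) : Prop := ∀ j k, ¬ Snd Z j → ¬ Snd Y k → X j k

/-- There are as many lines `Y` as the planes with lines `X` and `Z` permit. -/
def FullY (X Y Z : ℤ → ℤ → Prop) : Prop := ∀ i k, ¬ Fst Z i → ¬ Snd X k → Y i k

/-- There are as many lines `Z` as the planes with lines `X` and `Y` permit. -/
def FullZ (X Y Z : ℤ → ℤ → Prop) : Prop := ∀ i j, ¬ Fst Y i → ¬ Fst X j → Z i j

/-- The coordinate `A` is constant where the columns along `x` may run. -/
def UniformX (A : ℤ → ℤ → ℤ → ℤ) (Y Z : ℤ → ℤ → Prop) : Prop :=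
  ∃ a, ∀ i j k, ¬ Snd Z j → ¬ Snd Y k → A i j k = a

/-- The failure of `FullY` provides a place `(i₀, k₀)` where a line along `y` is permitted but
absent. All vertices over it in planes without lines `Z` are saddles with constant `A` and `C`, so
`B` is the same in all these planes; `B` does not depend on `i` there, and the saddle relation at
`(i, j, k₀)` carries the independence back to `A`. -/
theorem A_indep_j (h : Rules A B C X Y Z) (hY : ¬ FullY X Y Z) {i j j' k : ℤ}
    (hj : ¬ Snd Z j) (hj' : ¬ Snd Z j') : A i j k = A i j' k := by
  simp only [FullY, not_forall] at hY
  obtain ⟨i₀, k₀, hi₀, hk₀, hn⟩ := hY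
  have hz : ∀ {i j}, ¬ Snd Z j → ¬ Z i j := fun hj h' => hj ⟨_, h'⟩
  have hx : ∀ j, ¬ X j k₀ := fun j h' => hk₀ ⟨_, h'⟩
  by_cases hi : Fst Z i
  · have hy : ¬ Y i k₀ := fun h' => h.not_Fst_Y hi ⟨_, h'⟩
    have e1 := h.vertex (hx j) hn (hz hj)
    have e2 := h.vertex (hx j') hn (hz hj')
    have e3 := h.vertex (hx j) hy (hz hj)
    have e4 := h.vertex (hx j') hy (hz hj')
    rw [h.A_const_j hi₀ j j', h.C_const_j hk₀ i₀ j j', h.B_const_i hj i₀ i] at e1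
    rw [h.B_const_i hj' i₀ i] at e2
    rw [h.C_const_j hk₀ i j j'] at e3
    have r1 := h.rangeA i j k₀
    have r2 := h.rangeA i j' k₀
    rw [h.A_const_k (h.not_Fst_Y hi) j k k₀, h.A_const_k (h.not_Fst_Y hi) j' k k₀]
    omega
  · exact h.A_const_j hi j j' k

theorem A_indep_k (h : Rules A B C X Y Z) (hZ : ¬ FullZ X Y Z) {i j k k' : ℤ}
    (hk : ¬ Snd Y k) (hk' : ¬ Snd Y k') : A i j k = A i j k' :=
  h.swap_yz.A_indep_j (X := fun j k => X k j) (Y := Z) (Z := Y) hZ hk hk'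

/-- The failures of `FullY` and `FullZ` move `A` to the place `(j₀, k₀)` where a line `X` is
permitted but missing. Along that row all vertices are saddles, and `B` and `C` are constant, hence
so is `A`. -/
theorem uniformX_of_not_full (h : Rules A B C X Y Z) (hX : ¬ FullX X Y Z) (hY : ¬ FullY X Y Z)
    (hZ : ¬ FullZ X Y Z) : UniformX A Y Z := by
  simp only [FullX, not_forall] at hX
  obtain ⟨j₀, k₀, hj₀, hk₀, hn⟩ := hX
  refine ⟨A 0 j₀ k₀, fun i j k hj hk => ?_⟩
  rw [h.A_indep_j hY hj hj₀, h.A_indep_k hZ hk hk₀]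
  have hy : ∀ i, ¬ Y i k₀ := fun i h' => hk₀ ⟨_, h'⟩
  have hz : ∀ i, ¬ Z i j₀ := fun i h' => hj₀ ⟨_, h'⟩
  have e1 := h.vertex hn (hy i) (hz i)
  have e2 := h.vertex hn (hy 0) (hz 0)
  rw [h.B_const_i hj₀ i 0, h.C_const_i hk₀ i 0] at e1
  have r1 := h.rangeA i j₀ k₀
  have r2 := h.rangeA 0 j₀ k₀
  omega

/-- `A` depends on `i` at most, so a single row suffices. It is chosen on the boundary of the
permitted region, next to a plane with lines `Z` and a plane with lines `Y`; by `FullX` it is a line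
of screws, and one cube beside it compares `A` at consecutive `i`. -/
theorem uniformX_of_fullX (h : Rules A B C X Y Z) (hX : FullX X Y Z) (hY : ¬ FullY X Y Z)
    (hZ : ¬ FullZ X Y Z) (nX : ∃ j k, X j k) (nY : ∃ i k, Y i k) (nZ : ∃ i j, Z i j) :
    UniformX A Y Z := by
  obtain ⟨j₁, k₁, h₁⟩ := nX
  obtain ⟨i₂, k₂, h₂⟩ := nY
  obtain ⟨i₃, j₃, h₃⟩ := nZ
  obtain ⟨jc, j, j', hj, hj', pj, pj', -⟩ := exists_boundary (p := fun j => ¬ Snd Z j)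
    (h.not_Snd_Z ⟨_, h₁⟩) (not_not.2 (⟨_, h₃⟩ : Snd Z j₃))
  obtain ⟨kc, k, k', hk, hk', pk, pk', -⟩ := exists_boundary (p := fun k => ¬ Snd Y k)
    (h.not_Snd_Y ⟨_, h₁⟩) (not_not.2 (⟨_, h₂⟩ : Snd Y k₂))
  rw [not_not] at pj' pk'
  have hx := hX j k pj pk
  have near : ∀ i : ℤ, A i jc kc = A i j k := fun i =>
    h.A_near (fun h' => pj ⟨_, h'⟩) (fun h' => pk ⟨_, h'⟩) hj hk
  have step : ∀ i, A (i - 1) j k = A i j k := by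
    intro i
    rw [← near, ← near]
    have e0 := h.cube_X hx (i - 1) hj hk
    have c1 : i - 1 = i - 1 ∨ i - 1 = i - 1 - 1 := .inl rfl
    have c2 : i - 1 = i ∨ i - 1 = i - 1 := .inr rfl
    have x1 : ¬ X j' k := fun h' => h.not_Fst_X pj' ⟨_, h'⟩
    have x2 : ¬ X j k' := fun h' => h.not_Snd_X pk' ⟨_, h'⟩
    have y1 : ∀ i, ¬ Y i k := fun i h' => pk ⟨_, h'⟩
    have z1 : ∀ i, ¬ Z i j := fun i h' => pj ⟨_, h'⟩
    have f1 : ∀ i', i - 1 = i' ∨ i - 1 = i' - 1 →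
        (Z i' j' ∧ (A i' jc kc + B (i - 1) j' kc + 1 + (i - 1) + jc) % 2 = 0) ∨
        (A i' jc kc + B (i - 1) j' kc + C (i - 1) jc k) % 2 = 0 := by
      intro i' hi'
      by_cases hz : Z i' j'
      · exact .inl ⟨hz, h.cube_Z hz kc hi' hj'⟩
      · exact .inr (h.cube_vertex x1 (y1 i') hz hi' hj' hk)
    have f2 : ∀ i', i - 1 = i' ∨ i - 1 = i' - 1 →
        (Y i' k' ∧ (A i' jc kc + C (i - 1) jc k' + 1 + (i - 1) + kc) % 2 = 0) ∨
        (A i' jc kc + B (i - 1) j kc + C (i - 1) jc k') % 2 = 0 := by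
      intro i' hi'
      by_cases hy : Y i' k'
      · exact .inl ⟨hy, h.cube_Y hy jc hi' hk'⟩
      · exact .inr (h.cube_vertex x2 hy (z1 i') hi' hj hk')
    have r1 := h.rangeA i jc kc
    have r2 := h.rangeA (i - 1) jc kc
    -- If `A` differed at the two ends, each of the lines `Z` at `j'` and `Y` at `k'` would occur at
    -- exactly one end, and at opposite ends as they cannot meet. The four relations then add up to
    -- the negation of `e0`.
    rcases f1 _ c1 with ⟨g1, g1'⟩ | g1 <;> rcases f1 _ c2 with ⟨g2, g2'⟩ | g2 <;>
      rcases f2 _ c1 with ⟨g3, g3'⟩ | g3 <;> rcases f2 _ c2 with ⟨g4, g4'⟩ | g4 <;>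
      first
      | exact absurd ‹Z (i - 1) j'› (h.not_YZ ‹Y (i - 1) k'›)
      | exact absurd ‹Z i j'› (h.not_YZ ‹Y i k'›)
      | omega
  refine ⟨A 0 j k, fun i j₀ k₀ hj₀ hk₀ => ?_⟩
  rw [h.A_indep_j hY hj₀ pj, h.A_indep_k hZ hk₀ pk]
  exact const_of_step (f := fun i => A i j k) step i 0

/-- Here lines `X` are shown to be absent at the corners of the permitted region; the saddle
relation then makes `A` constant along these rows. Every permitted row can be moved to such a corner
within its run of planes. -/
theorem uniformX_of_fullYZ (h : Rules A B C X Y Z) (hY : FullY X Y Z) (hZ : FullZ X Y Z)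
    (nX : ∃ j k, X j k) (nY : ∃ i k, Y i k) (nZ : ∃ i j, Z i j) : UniformX A Y Z := by
  obtain ⟨j₁, k₁, h₁⟩ := nX
  obtain ⟨i₂, k₂, h₂⟩ := nY
  obtain ⟨i₃, j₃, h₃⟩ := nZ
  have hi₂ : ¬ Fst Z i₂ := h.not_Fst_Z ⟨_, h₂⟩
  have hi₃ : ¬ Fst Y i₃ := h.not_Fst_Y ⟨_, h₃⟩
  obtain ⟨ic, iy, iz, ci, ci', pi, pi', -⟩ := exists_boundary (p := fun i => ¬ Fst Z i)
    hi₂ (not_not.2 (⟨_, h₃⟩ : Fst Z i₃))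
  rw [not_not] at pi'
  have key : ∀ j₀ k₀, ¬ Snd Z j₀ → ¬ Snd Y k₀ → ∃ j k, ¬ Snd Z j ∧ ¬ Snd Y k ∧
      (∀ i, A i j₀ k = A i j k ∧ A i j₀ k₀ = A i j₀ k) ∧ ∀ i i', A i j k = A i' j k := by
    intro j₀ k₀ hj₀ hk₀
    obtain ⟨jc, j, j', hj, hj', pj, pj', fj⟩ := exists_boundary (p := fun j => ¬ Snd Z j)
      hj₀ (not_not.2 (⟨_, h₃⟩ : Snd Z j₃))
    obtain ⟨kc, k, k', hk, hk', pk, pk', fk⟩ := exists_boundary (p := fun k => ¬ Snd Y k)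
      hk₀ (not_not.2 (⟨_, h₂⟩ : Snd Y k₂))
    rw [not_not] at pj' pk'
    have y1 : ∀ i, ¬ Y i k := fun i h' => pk ⟨_, h'⟩
    have z1 : ∀ i, ¬ Z i j := fun i h' => pj ⟨_, h'⟩
    have x1 : ¬ X j' k := fun h' => h.not_Fst_X pj' ⟨_, h'⟩
    have x2 : ¬ X j k' := fun h' => h.not_Snd_X pk' ⟨_, h'⟩
    -- By fullness, the cube at this corner has screw lines along `y` and `z` on two skew edges. A
    -- line `X` on the third skew edge and the saddles at the two vertices off these edges give five
    -- relations in which each of the six faces occurs twice, while the constants sum to an odd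
    -- number.
    have hx : ¬ X j k := by
      intro hx
      have e0 := h.cube_X hx ic hj hk
      have e1 := h.cube_Y (hY iy k' pi (h.not_Snd_X pk')) jc ci hk'
      have e2 := h.cube_Z (hZ iz j' (h.not_Fst_Y pi') (h.not_Fst_X pj')) kc ci' hj'
      have e3 := h.cube_vertex x1 (y1 iy) (fun h' => pi ⟨_, h'⟩) ci hj' hk
      have e4 := h.cube_vertex x2 (fun h' => h.not_Fst_Y pi' ⟨_, h'⟩) (z1 iz) ci' hj hk'
      omega
    have nj : ∀ i k, A i jc k = A i j k := by
      intro i k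
      rcases hj with rfl | rfl
      · rfl
      · exact h.A_of_not_Z (z1 i) k
    have nk : ∀ i j, A i j kc = A i j k := by
      intro i j
      rcases hk with rfl | rfl
      · rfl
      · exact h.A_of_not_Y (y1 i) j
    refine ⟨j, k, pj, pk, fun i => ⟨?_, ?_⟩, fun i i' => ?_⟩
    · rw [← nj]
      exact (fj (fun j => A i j k) fun j hj => h.A_of_not_Z (fun h' => hj ⟨_, h'⟩) k).symm
    · rw [← nk]
      exact (fk (fun k => A i j₀ k) fun k hk => h.A_of_not_Y (fun h' => hk ⟨_, h'⟩) j₀).symm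
    · have e1 := h.vertex hx (y1 i) (z1 i)
      have e2 := h.vertex hx (y1 i') (z1 i')
      rw [h.B_const_i pj i i', h.C_const_i pk i i'] at e1
      have r1 := h.rangeA i j k
      have r2 := h.rangeA i' j k
      omega
  have indep : ∀ i i' j k, ¬ Snd Z j → ¬ Snd Y k → A i j k = A i' j k := by
    intro i i' j k hj hk
    obtain ⟨j', k', -, -, h1, h2⟩ := key j k hj hk
    rw [(h1 i).2, (h1 i).1, (h1 i').2, (h1 i').1, h2 i i']
  have q₁ : ¬ Snd Z j₁ := h.not_Snd_Z ⟨_, h₁⟩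
  have q₂ : ¬ Snd Y k₁ := h.not_Snd_Y ⟨_, h₁⟩
  -- `A` may be moved in the direction `i` within permitted rows. In the plane `i₂`, free of lines
  -- `Z`, it can be moved along `j`, and in the plane `i₃`, free of lines `Y`, along `k`.
  refine ⟨A 0 j₁ k₁, fun i j k hj hk => ?_⟩
  rw [indep i i₂ j k hj hk, h.A_const_j hi₂ j j₁ k, indep i₂ i₃ j₁ k q₁ hk,
    h.A_const_k hi₃ j₁ k k₁, indep i₃ 0 j₁ k₁ q₁ q₂]

theorem uniformX (h : Rules A B C X Y Z) (hYZ : FullY X Y Z ↔ FullZ X Y Z)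
    (nX : ∃ j k, X j k) (nY : ∃ i k, Y i k) (nZ : ∃ i j, Z i j) : UniformX A Y Z := by
  by_cases hY : FullY X Y Z
  · exact h.uniformX_of_fullYZ hY (hYZ.1 hY) nX nY nZ
  · have hZ := fun h' => hY (hYZ.2 h')
    by_cases hX : FullX X Y Z
    · exact h.uniformX_of_fullX hX hY hZ nX nY nZ
    · exact h.uniformX_of_not_full hX hY hZ

end Rules
end CubicPolyhedra

/-! ### Constancy of the other coordinates outside the range of the columns -/

namespace CubicPolyhedra
namespace Rules
variable {A B C : ℤ → ℤ → ℤ → ℤ} {X Y Z : ℤ → ℤ → Prop}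

/-- Where the columns along `x` cannot run, the coordinates are constant too. -/
theorem boundary_values (h : Rules A B C X Y Z) (nX : ∃ j k, X j k) (nY : ∃ i k, Y i k)
    (nZ : ∃ i j, Z i j) {a : ℤ} (hU : ∀ i j k, ¬ Snd Z j → ¬ Snd Y k → A i j k = a) :
    ∃ b c, (a + b + c) % 2 = 0 ∧ (∀ i j k, ¬ Snd Z j → Snd Y k → B i j k = b) ∧
      ∀ i j k, Snd Z j → ¬ Snd Y k → C i j k = c := by
  obtain ⟨j₁, k₁, h₁⟩ := nX
  obtain ⟨i₂, k₂, h₂⟩ := nY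
  obtain ⟨i₃, j₃, h₃⟩ := nZ
  have q₁ : ¬ Snd Z j₁ := h.not_Snd_Z ⟨_, h₁⟩
  have q₂ : ¬ Snd Y k₁ := h.not_Snd_Y ⟨_, h₁⟩
  have hi₂ : ¬ Fst Z i₂ := h.not_Fst_Z ⟨_, h₂⟩
  have hi₃ : ¬ Fst Y i₃ := h.not_Fst_Y ⟨_, h₃⟩
  -- One parity relation for independent choices of all indices gives everything: fixing one of `B`
  -- and `C` shows that the other one is constant.
  have key : ∀ i i' j₀ j k k₀, ¬ Snd Z j₀ → Snd Y k → Snd Z j → ¬ Snd Y k₀ →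
      (a + B i j₀ k + C i' j k₀) % 2 = 0 := by
    intro i₀ i₀' j₀ j₀' k₀' k₀ hj₀ hk₀' hj₀' hk₀
    obtain ⟨jc, j', j, hj', hj, pj', pj, fj⟩ := exists_boundary (p := fun j => Snd Z j) hj₀' hj₀
    obtain ⟨kc, k', k, hk', hk, pk', pk, fk⟩ := exists_boundary (p := fun k => Snd Y k) hk₀' hk₀
    have x1 : ∀ k, ¬ X j' k := fun k h' => h.not_Fst_X pj' ⟨_, h'⟩
    have x2 : ∀ j, ¬ X j k' := fun j h' => h.not_Snd_X pk' ⟨_, h'⟩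
    have y1 : ∀ i, ¬ Y i k := fun i h' => pk ⟨_, h'⟩
    have z1 : ∀ i, ¬ Z i j := fun i h' => pj ⟨_, h'⟩
    have hA : ∀ i, A i jc kc = a := fun i => (h.A_near (z1 i) (y1 i) hj hk).trans (hU i j k pj pk)
    -- The plane `x = i₃` is free of lines `Y`, and the plane `z = k₀'` is free of lines `X`. At
    -- their saddles in planes without lines `Z` both `A` and `C` are constant, so `B` is too; the
    -- boundary function `fk` moves it from `kc` to `k₀'`.
    have hB : ∀ i, B i j kc = B i₀ j₀ k₀' := by
      intro i
      have e1 := fk (fun k => B i₃ j k) fun l hl => h.B_of_not_X (fun h' => h.not_Snd_X hl ⟨_, h'⟩) i₃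
      have e2 : ∀ j, ¬ Snd Z j → (a + B i₃ j k₀' + C i₃ j k₀') % 2 = 0 := by
        intro j hj
        have := h.vertex (i := i₃) (j := j) (k := k₀') (fun h' => h.not_Snd_X hk₀' ⟨_, h'⟩)
          (fun h' => hi₃ ⟨_, h'⟩) (fun h' => hj ⟨_, h'⟩)
        rwa [h.A_const_k hi₃ j k₀' k₁, hU i₃ j k₁ hj q₂] at this
      have e3 := e2 j pj
      have e4 := e2 j₀ hj₀
      rw [h.C_const_j (h.not_Snd_X hk₀') i₃ j j₀] at e3
      have r1 := h.rangeB i₃ j k₀'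
      have r2 := h.rangeB i₃ j₀ k₀'
      rw [h.B_const_i pj i i₃, h.B_const_i hj₀ i₀ i₃]
      omega
    have hC : ∀ i, C i jc k = C i₀' j₀' k₀ := by
      intro i
      have e1 := fj (fun j => C i₂ j k) fun l hl => h.C_of_not_X (fun h' => h.not_Fst_X hl ⟨_, h'⟩) i₂
      have e2 : ∀ k, ¬ Snd Y k → (a + B i₂ j₀' k + C i₂ j₀' k) % 2 = 0 := by
        intro k hk
        have := h.vertex (i := i₂) (j := j₀') (k := k) (fun h' => h.not_Fst_X hj₀' ⟨_, h'⟩)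
          (fun h' => hk ⟨_, h'⟩) (fun h' => hi₂ ⟨_, h'⟩)
        rwa [h.A_const_j hi₂ j₀' j₁ k, hU i₂ j₁ k q₁ hk] at this
      have e3 := e2 k pk
      have e4 := e2 k₀ hk₀
      rw [h.B_const_k (h.not_Fst_X hj₀') i₂ k k₀] at e3
      have r1 := h.rangeC i₂ j₀' k
      have r2 := h.rangeC i₂ j₀' k₀
      rw [h.C_const_i pk i i₂, h.C_const_i hk₀ i₀' i₂]
      omega
    -- A violation can only occur if the corner row `(j, k)` is a line `X`. This forces the opposite
    -- edges of the cubes along the row to be screw lines throughout, which the planes `i₂` and `i₃`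
    -- forbid.
    by_contra hne
    have hx : X j k := by
      by_contra hx
      have := h.cube_vertex hx (y1 0) (z1 0) (.inl rfl) hj hk
      rw [hA, hB, hC] at this
      exact hne this
    have e0 := h.cube_X hx 0 hj hk
    rw [hB, hC] at e0
    have v1 : ∀ {i ic}, ic = i ∨ ic = i - 1 → ¬ Z i j' →
        (a + B ic j' kc + C i₀' j₀' k₀) % 2 = 0 := by
      intro i ic hi hz
      have := h.cube_vertex (x1 k) (y1 i) hz hi hj' hk
      rwa [hA, hC] at this
    have v2 : ∀ {i ic}, ic = i ∨ ic = i - 1 → ¬ Y i k' →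
        (a + B i₀ j₀ k₀' + C ic jc k') % 2 = 0 := by
      intro i ic hi hy
      have := h.cube_vertex (x2 j) hy (z1 i) hi hj hk'
      rwa [hA, hB] at this
    -- With neither line, the saddle at `(i, j', k')` and the relations `v1`, `v2` add up to the
    -- relation assumed to fail.
    have v3 : ∀ i, Z i j' ∨ Y i k' := by
      intro i
      by_contra hn
      rw [not_or] at hn
      have e1 := h.cube_vertex (x1 k') hn.2 hn.1 (.inl rfl) hj' hk'
      have e2 := v1 (.inl rfl) hn.1
      have e3 := v2 (.inl rfl) hn.2
      rw [hA] at e1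
      omega
    -- The two line relations, `v1` and `v2` sum to a relation contradicting `e0`. So the kind of
    -- line cannot change between consecutive values of `i`.
    have clash : ∀ {i₁ i₂ ic}, ic = i₁ ∨ ic = i₁ - 1 → ic = i₂ ∨ ic = i₂ - 1 → Z i₁ j' →
        Y i₂ k' → False := by
      intro i₁ i₂ ic h1 h2 hz hy
      have e1 := h.cube_Z hz kc h1 hj'
      have e2 := h.cube_Y hy jc h2 hk'
      have e3 := v1 h2 (h.not_YZ hy)
      have e4 := v2 h1 (fun hy => h.not_YZ hy hz)
      rw [hA] at e1 e2
      omega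
    have step : ∀ i, Z (i - 1) j' ↔ Z i j' := by
      intro i
      constructor
      · exact fun hz => (v3 i).resolve_right fun hy => clash (.inl rfl) (.inr rfl) hz hy
      · exact fun hz => (v3 (i - 1)).resolve_right fun hy => clash (.inr rfl) (.inl rfl) hz hy
    have hz₃ : Z i₃ j' := (v3 i₃).resolve_right fun hy => hi₃ ⟨_, hy⟩
    exact hi₂ ⟨j', (iff_of_step (p := fun i => Z i j') step i₃ i₂).1 hz₃⟩
  have k₂' : Snd Y k₂ := ⟨_, h₂⟩
  have j₃' : Snd Z j₃ := ⟨_, h₃⟩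
  have k0 := key 0 0 j₁ j₃ k₂ k₁ q₁ k₂' j₃' q₂
  refine ⟨B 0 j₁ k₂, C 0 j₃ k₁, k0, fun i j k hj hk => ?_, fun i j k hj hk => ?_⟩
  · have := key i 0 j j₃ k k₁ hj hk j₃' q₂
    have r1 := h.rangeB i j k
    have r2 := h.rangeB 0 j₁ k₂
    omega
  · have := key 0 i j₁ j k₂ k q₁ k₂' hj hk
    have r1 := h.rangeC i j k
    have r2 := h.rangeC 0 j₃ k₁
    omega

end Rules
end CubicPolyhedra

namespace CubicPolyhedra

/-! ### Mirror images and towers in terms of squares -/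

/-- The squares parallel to the axis that lie between the two vertices are fixed by the reflection;
of these parallel squares only the outer ones, at `v 0 - 1` and `v 0 + 1`, have to be compared. -/
theorem mirrored_x {P : Set Pt} {v : Pt}
    (h1 : ∀ s u, mX P (v 0) (v 1 + off s) (v 2 + off u) ↔ mX P (v 0 + 1) (v 1 + off s) (v 2 + off u))
    (h2 : ∀ u, mY P (v 0 - 1) (v 1) (v 2 + off u) ↔ mY P (v 0 + 1) (v 1) (v 2 + off u))
    (h3 : ∀ u, mZ P (v 0 - 1) (v 1 + off u) (v 2) ↔ mZ P (v 0 + 1) (v 1 + off u) (v 2)) :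
    Mirrored P 0 v := by
  have c0 : (v + Pi.single 0 1 : Pt) 0 = v 0 + 1 := by simp
  have c1 : (v + Pi.single 0 1 : Pt) 1 = v 1 := by simp
  have c2 : (v + Pi.single 0 1 : Pt) 2 = v 2 := by simp
  rintro ⟨a, s⟩ ⟨b, u⟩
  fin_cases a <;> fin_cases b <;>
    simp only [mirror, Fin.zero_eta, Fin.mk_one, Fin.reduceFinMk, Fin.reduceEq, if_true, if_false,
      adj_xy, adj_xz, adj_yz, adj_yx, adj_zx, adj_zy, c0, c1, c2, not_adj_same, h1]
  · rcases Int.units_eq_one_or s with rfl | rfl <;> simp [h3, ← sub_eq_add_neg]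
  · rcases Int.units_eq_one_or s with rfl | rfl <;> simp [h2, ← sub_eq_add_neg]
  · rcases Int.units_eq_one_or u with rfl | rfl <;> simp [h3, ← sub_eq_add_neg]
  · rcases Int.units_eq_one_or u with rfl | rfl <;> simp [h2, ← sub_eq_add_neg]

theorem mirrored_y {P : Set Pt} {v : Pt}
    (h1 : ∀ s u, mY P (v 0 + off s) (v 1) (v 2 + off u) ↔ mY P (v 0 + off s) (v 1 + 1) (v 2 + off u))
    (h2 : ∀ u, mX P (v 0) (v 1 - 1) (v 2 + off u) ↔ mX P (v 0) (v 1 + 1) (v 2 + off u))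
    (h3 : ∀ u, mZ P (v 0 + off u) (v 1 - 1) (v 2) ↔ mZ P (v 0 + off u) (v 1 + 1) (v 2)) :
    Mirrored P 1 v := by
  have c0 : (v + Pi.single 1 1 : Pt) 0 = v 0 := by simp
  have c1 : (v + Pi.single 1 1 : Pt) 1 = v 1 + 1 := by simp
  have c2 : (v + Pi.single 1 1 : Pt) 2 = v 2 := by simp
  rintro ⟨a, s⟩ ⟨b, u⟩
  fin_cases a <;> fin_cases b <;>
    simp only [mirror, Fin.zero_eta, Fin.mk_one, Fin.reduceFinMk, Fin.reduceEq, if_true, if_false,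
      adj_xy, adj_xz, adj_yz, adj_yx, adj_zx, adj_zy, c0, c1, c2, not_adj_same, h1]
  · rcases Int.units_eq_one_or u with rfl | rfl <;> simp [h3, ← sub_eq_add_neg]
  · rcases Int.units_eq_one_or s with rfl | rfl <;> simp [h3, ← sub_eq_add_neg]
  · rcases Int.units_eq_one_or s with rfl | rfl <;> simp [h2, ← sub_eq_add_neg]
  · rcases Int.units_eq_one_or u with rfl | rfl <;> simp [h2, ← sub_eq_add_neg]

theorem mirrored_z {P : Set Pt} {v : Pt}
    (h1 : ∀ s u, mZ P (v 0 + off s) (v 1 + off u) (v 2) ↔ mZ P (v 0 + off s) (v 1 + off u) (v 2 + 1))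
    (h2 : ∀ u, mX P (v 0) (v 1 + off u) (v 2 - 1) ↔ mX P (v 0) (v 1 + off u) (v 2 + 1))
    (h3 : ∀ u, mY P (v 0 + off u) (v 1) (v 2 - 1) ↔ mY P (v 0 + off u) (v 1) (v 2 + 1)) :
    Mirrored P 2 v := by
  have c0 : (v + Pi.single 2 1 : Pt) 0 = v 0 := by simp
  have c1 : (v + Pi.single 2 1 : Pt) 1 = v 1 := by simp
  have c2 : (v + Pi.single 2 1 : Pt) 2 = v 2 + 1 := by simp
  rintro ⟨a, s⟩ ⟨b, u⟩
  fin_cases a <;> fin_cases b <;>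
    simp only [mirror, Fin.zero_eta, Fin.mk_one, Fin.reduceFinMk, Fin.reduceEq, if_true, if_false,
      adj_xy, adj_xz, adj_yz, adj_yx, adj_zx, adj_zy, c0, c1, c2, not_adj_same, h1]
  · rcases Int.units_eq_one_or u with rfl | rfl <;> simp [h3, ← sub_eq_add_neg]
  · rcases Int.units_eq_one_or u with rfl | rfl <;> simp [h2, ← sub_eq_add_neg]
  · rcases Int.units_eq_one_or s with rfl | rfl <;> simp [h3, ← sub_eq_add_neg]
  · rcases Int.units_eq_one_or s with rfl | rfl <;> simp [h2, ← sub_eq_add_neg]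

theorem off_range (s : ℤˣ) : -1 ≤ off s ∧ off s ≤ 0 := by
  rcases Int.units_eq_one_or s with rfl | rfl <;> simp

theorem two_le_abs {x y : ℤ} (h : |2 * x - (2 * y + 1)| = 1) : x = y ∨ x = y + 1 := by
  rcases abs_eq (by norm_num : (0 : ℤ) ≤ 1) |>.1 h with h | h <;> omega

/-- A criterion for towers along `x`: the reduced coordinates near the box are constant along it,
and the coordinate `A` is constant there. -/
theorem isTower_x {P : Set Pt} {i j k a : ℤ} (hn : (a + j + k) % 2 = 1)
    (hA : ∀ i j' k', j - 1 ≤ j' → j' ≤ j + 1 → k - 1 ≤ k' → k' ≤ k + 1 → dA P i j' k' = a)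
    (hB : ∀ i i' j' k', j ≤ j' → j' ≤ j + 1 → k - 1 ≤ k' → k' ≤ k + 1 →
      dB P i j' k' = dB P i' j' k')
    (hC : ∀ i i' j' k', j - 1 ≤ j' → j' ≤ j + 1 → k ≤ k' → k' ≤ k + 1 →
      dC P i j' k' = dC P i' j' k') :
    IsTower P 0 ![2 * i, 2 * j + 1, 2 * k + 1] := by
  refine ⟨⟨?_, ?_, ?_⟩, ?_⟩
  · change mX P i j k
    rw [mX_iff, hA _ _ _ (by omega) (by omega) (by omega) (by omega)]
    exact hn
  · intro l
    fin_cases l <;> simp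
  · rintro ⟨b, s⟩ hb
    have key : ∀ j' k', j - 1 ≤ j' → j' ≤ j + 1 → k - 1 ≤ k' → k' ≤ k + 1 →
        (j' + k' - j - k) % 2 = 1 → ![2 * i, 2 * j' + 1, 2 * k' + 1] ∉ P := by
      intro j' k' h1 h2 h3 h4 h5
      change ¬ mX P i j' k'
      rw [mX_iff, hA _ _ _ h1 h2 h3 h4]
      omega
    fin_cases b
    · exact absurd rfl hb
    · rcases Int.units_eq_one_or s with rfl | rfl
      · convert key (j + 1) k (by omega) (by omega) (by omega) (by omega) (by omega) using 2
        funext l; fin_cases l <;> simp [vec] <;> ring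
      · convert key (j - 1) k (by omega) (by omega) (by omega) (by omega) (by omega) using 2
        funext l; fin_cases l <;> simp [vec] <;> ring
    · rcases Int.units_eq_one_or s with rfl | rfl
      · convert key j (k + 1) (by omega) (by omega) (by omega) (by omega) (by omega) using 2
        funext l; fin_cases l <;> simp [vec] <;> ring
      · convert key j (k - 1) (by omega) (by omega) (by omega) (by omega) (by omega) using 2
        funext l; fin_cases l <;> simp [vec] <;> ring
  · intro v hv
    have v1 := two_le_abs (hv 1 (by decide))
    have v2 := two_le_abs (hv 2 (by decide))
    refine mirrored_x (fun s u => ?_) (fun u => ?_) (fun u => ?_)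
    · have := off_range s
      have := off_range u
      rw [mX_iff, mX_iff, hA _ _ _ (by omega) (by omega) (by omega) (by omega),
        hA _ _ _ (by omega) (by omega) (by omega) (by omega)]
    · have := off_range u
      rw [mY_iff, mY_iff, hB _ (v 0 - 1) _ _ (by omega) (by omega) (by omega) (by omega),
        hB (v 0 + 1) (v 0 - 1) _ _ (by omega) (by omega) (by omega) (by omega)]
      omega
    · have := off_range u
      rw [mZ_iff, mZ_iff, hC _ (v 0 - 1) _ _ (by omega) (by omega) (by omega) (by omega),
        hC (v 0 + 1) (v 0 - 1) _ _ (by omega) (by omega) (by omega) (by omega)]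
      omega

/-- A criterion for towers along `y`. -/
theorem isTower_y {P : Set Pt} {i j k b : ℤ} (hn : (b + i + k) % 2 = 1)
    (hB : ∀ i' j k', i - 1 ≤ i' → i' ≤ i + 1 → k - 1 ≤ k' → k' ≤ k + 1 → dB P i' j k' = b)
    (hA : ∀ i' j j' k', i ≤ i' → i' ≤ i + 1 → k - 1 ≤ k' → k' ≤ k + 1 →
      dA P i' j k' = dA P i' j' k')
    (hC : ∀ i' j j' k', i - 1 ≤ i' → i' ≤ i + 1 → k ≤ k' → k' ≤ k + 1 →
      dC P i' j k' = dC P i' j' k') :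
    IsTower P 1 ![2 * i + 1, 2 * j, 2 * k + 1] := by
  refine ⟨⟨?_, ?_, ?_⟩, ?_⟩
  · change mY P i j k
    rw [mY_iff, hB _ _ _ (by omega) (by omega) (by omega) (by omega)]
    exact hn
  · intro l
    fin_cases l <;> simp
  · rintro ⟨b, s⟩ hb
    have key : ∀ i' k', i - 1 ≤ i' → i' ≤ i + 1 → k - 1 ≤ k' → k' ≤ k + 1 →
        (i' + k' - i - k) % 2 = 1 → ![2 * i' + 1, 2 * j, 2 * k' + 1] ∉ P := by
      intro i' k' h1 h2 h3 h4 h5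
      change ¬ mY P i' j k'
      rw [mY_iff, hB _ _ _ h1 h2 h3 h4]
      omega
    fin_cases b
    · rcases Int.units_eq_one_or s with rfl | rfl
      · convert key (i + 1) k (by omega) (by omega) (by omega) (by omega) (by omega) using 2
        funext l; fin_cases l <;> simp [vec] <;> ring
      · convert key (i - 1) k (by omega) (by omega) (by omega) (by omega) (by omega) using 2
        funext l; fin_cases l <;> simp [vec] <;> ring
    · exact absurd rfl hb
    · rcases Int.units_eq_one_or s with rfl | rfl
      · convert key i (k + 1) (by omega) (by omega) (by omega) (by omega) (by omega) using 2
        funext l; fin_cases l <;> simp [vec] <;> ring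
      · convert key i (k - 1) (by omega) (by omega) (by omega) (by omega) (by omega) using 2
        funext l; fin_cases l <;> simp [vec] <;> ring
  · intro v hv
    have v0 := two_le_abs (hv 0 (by decide))
    have v2 := two_le_abs (hv 2 (by decide))
    refine mirrored_y (fun s u => ?_) (fun u => ?_) (fun u => ?_)
    · have := off_range s
      have := off_range u
      rw [mY_iff, mY_iff, hB _ _ _ (by omega) (by omega) (by omega) (by omega),
        hB _ _ _ (by omega) (by omega) (by omega) (by omega)]
    · have := off_range u
      rw [mX_iff, mX_iff, hA _ _ (v 1 - 1) _ (by omega) (by omega) (by omega) (by omega),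
        hA _ (v 1 + 1) (v 1 - 1) _ (by omega) (by omega) (by omega) (by omega)]
      omega
    · have := off_range u
      rw [mZ_iff, mZ_iff, hC _ _ (v 1 - 1) _ (by omega) (by omega) (by omega) (by omega),
        hC _ (v 1 + 1) (v 1 - 1) _ (by omega) (by omega) (by omega) (by omega)]
      omega

/-- A criterion for towers along `z`. -/
theorem isTower_z {P : Set Pt} {i j k c : ℤ} (hn : (c + i + j) % 2 = 1)
    (hC : ∀ i' j' k, i - 1 ≤ i' → i' ≤ i + 1 → j - 1 ≤ j' → j' ≤ j + 1 → dC P i' j' k = c)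
    (hA : ∀ i' j' k k', i ≤ i' → i' ≤ i + 1 → j - 1 ≤ j' → j' ≤ j + 1 →
      dA P i' j' k = dA P i' j' k')
    (hB : ∀ i' j' k k', i - 1 ≤ i' → i' ≤ i + 1 → j ≤ j' → j' ≤ j + 1 →
      dB P i' j' k = dB P i' j' k') :
    IsTower P 2 ![2 * i + 1, 2 * j + 1, 2 * k] := by
  refine ⟨⟨?_, ?_, ?_⟩, ?_⟩
  · change mZ P i j k
    rw [mZ_iff, hC _ _ _ (by omega) (by omega) (by omega) (by omega)]
    exact hn
  · intro l
    fin_cases l <;> simp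
  · rintro ⟨b, s⟩ hb
    have key : ∀ i' j', i - 1 ≤ i' → i' ≤ i + 1 → j - 1 ≤ j' → j' ≤ j + 1 →
        (i' + j' - i - j) % 2 = 1 → ![2 * i' + 1, 2 * j' + 1, 2 * k] ∉ P := by
      intro i' j' h1 h2 h3 h4 h5
      change ¬ mZ P i' j' k
      rw [mZ_iff, hC _ _ _ h1 h2 h3 h4]
      omega
    fin_cases b
    · rcases Int.units_eq_one_or s with rfl | rfl
      · convert key (i + 1) j (by omega) (by omega) (by omega) (by omega) (by omega) using 2
        funext l; fin_cases l <;> simp [vec] <;> ring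
      · convert key (i - 1) j (by omega) (by omega) (by omega) (by omega) (by omega) using 2
        funext l; fin_cases l <;> simp [vec] <;> ring
    · rcases Int.units_eq_one_or s with rfl | rfl
      · convert key i (j + 1) (by omega) (by omega) (by omega) (by omega) (by omega) using 2
        funext l; fin_cases l <;> simp [vec] <;> ring
      · convert key i (j - 1) (by omega) (by omega) (by omega) (by omega) (by omega) using 2
        funext l; fin_cases l <;> simp [vec] <;> ring
    · exact absurd rfl hb
  · intro v hv
    have v0 := two_le_abs (hv 0 (by decide))
    have v1 := two_le_abs (hv 1 (by decide))
    refine mirrored_z (fun s u => ?_) (fun u => ?_) (fun u => ?_)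
    · have := off_range s
      have := off_range u
      rw [mZ_iff, mZ_iff, hC _ _ _ (by omega) (by omega) (by omega) (by omega),
        hC _ _ _ (by omega) (by omega) (by omega) (by omega)]
    · have := off_range u
      rw [mX_iff, mX_iff, hA _ _ _ (v 2 - 1) (by omega) (by omega) (by omega) (by omega),
        hA _ _ (v 2 + 1) (v 2 - 1) (by omega) (by omega) (by omega) (by omega)]
      omega
    · have := off_range u
      rw [mY_iff, mY_iff, hB _ _ _ (v 2 - 1) (by omega) (by omega) (by omega) (by omega),
        hB _ _ (v 2 + 1) (v 2 - 1) (by omega) (by omega) (by omega) (by omega)]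
      omega

/-! ### Sets of towers and their sides -/

/-- All squares with normal `x` in the cells that satisfy `c`. -/
def cellsX (c : ℤ → ℤ → Prop) : Set Pt := {f | ∃ i j k, c j k ∧ f = ![2 * i, 2 * j + 1, 2 * k + 1]}

/-- All squares with normal `y` in the cells that satisfy `c`. -/
def cellsY (c : ℤ → ℤ → Prop) : Set Pt := {f | ∃ i j k, c i k ∧ f = ![2 * i + 1, 2 * j, 2 * k + 1]}

/-- All squares with normal `z` in the cells that satisfy `c`. -/
def cellsZ (c : ℤ → ℤ → Prop) : Set Pt := {f | ∃ i j k, c i j ∧ f = ![2 * i + 1, 2 * j + 1, 2 * k]}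

theorem mem_sides_cellsX {c : ℤ → ℤ → Prop} {g : Pt} : g ∈ towerSides 0 (cellsX c) ↔
    ∃ p q m, c p q ∧ ((g 0 = 2 * m + 1 ∧ (g 1 = 2 * p + 2 ∨ g 1 = 2 * p) ∧ g 2 = 2 * q + 1) ∨
      (g 0 = 2 * m + 1 ∧ g 1 = 2 * p + 1 ∧ (g 2 = 2 * q + 2 ∨ g 2 = 2 * q))) := by
  constructor
  · rintro ⟨f, ⟨i, j, k, hc, rfl⟩, ⟨b, s⟩, hb, m, rfl⟩
    refine ⟨_, _, i + m, hc, ?_⟩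
    fin_cases b <;> rcases Int.units_eq_one_or s with rfl | rfl <;>
      first
      | exact absurd rfl hb
      | simp only [Pi.add_apply, vec, Pi.single_apply, Matrix.cons_val_zero, Matrix.cons_val_one,
          Matrix.cons_val, Fin.zero_eta, Fin.mk_one, Fin.reduceFinMk, Fin.reduceEq, if_true, if_false,
          Units.val_one, Units.val_neg]
        omega
  · rintro ⟨p, q, m, hc, ⟨h0, h1 | h1, h2⟩ | ⟨h0, h1, h2 | h2⟩⟩
    · refine ⟨_, ⟨0, p, q, hc, rfl⟩, (1, 1), by simp, m, ?_⟩
      funext l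
      fin_cases l <;>
        simp only [Pi.add_apply, vec, Pi.single_apply, Matrix.cons_val_zero, Matrix.cons_val_one,
          Matrix.cons_val, Fin.zero_eta, Fin.mk_one, Fin.reduceFinMk, Fin.reduceEq, if_true, if_false,
          Units.val_one, Units.val_neg] <;> omega
    · refine ⟨_, ⟨0, p, q, hc, rfl⟩, (1, -1), by simp, m, ?_⟩
      funext l
      fin_cases l <;>
        simp only [Pi.add_apply, vec, Pi.single_apply, Matrix.cons_val_zero, Matrix.cons_val_one,
          Matrix.cons_val, Fin.zero_eta, Fin.mk_one, Fin.reduceFinMk, Fin.reduceEq, if_true, if_false,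
          Units.val_one, Units.val_neg] <;> omega
    · refine ⟨_, ⟨0, p, q, hc, rfl⟩, (2, 1), by simp, m, ?_⟩
      funext l
      fin_cases l <;>
        simp only [Pi.add_apply, vec, Pi.single_apply, Matrix.cons_val_zero, Matrix.cons_val_one,
          Matrix.cons_val, Fin.zero_eta, Fin.mk_one, Fin.reduceFinMk, Fin.reduceEq, if_true, if_false,
          Units.val_one, Units.val_neg] <;> omega
    · refine ⟨_, ⟨0, p, q, hc, rfl⟩, (2, -1), by simp, m, ?_⟩
      funext l
      fin_cases l <;>
        simp only [Pi.add_apply, vec, Pi.single_apply, Matrix.cons_val_zero, Matrix.cons_val_one,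
          Matrix.cons_val, Fin.zero_eta, Fin.mk_one, Fin.reduceFinMk, Fin.reduceEq, if_true, if_false,
          Units.val_one, Units.val_neg] <;> omega

theorem mem_sides_cellsY {c : ℤ → ℤ → Prop} {g : Pt} : g ∈ towerSides 1 (cellsY c) ↔
    ∃ p q m, c p q ∧ ((g 1 = 2 * m + 1 ∧ (g 0 = 2 * p + 2 ∨ g 0 = 2 * p) ∧ g 2 = 2 * q + 1) ∨
      (g 1 = 2 * m + 1 ∧ g 0 = 2 * p + 1 ∧ (g 2 = 2 * q + 2 ∨ g 2 = 2 * q))) := by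
  constructor
  · rintro ⟨f, ⟨i, j, k, hc, rfl⟩, ⟨b, s⟩, hb, m, rfl⟩
    refine ⟨_, _, j + m, hc, ?_⟩
    fin_cases b <;> rcases Int.units_eq_one_or s with rfl | rfl <;>
      first
      | exact absurd rfl hb
      | simp only [Pi.add_apply, vec, Pi.single_apply, Matrix.cons_val_zero, Matrix.cons_val_one,
          Matrix.cons_val, Fin.zero_eta, Fin.mk_one, Fin.reduceFinMk, Fin.reduceEq, if_true, if_false,
          Units.val_one, Units.val_neg]
        omega
  · rintro ⟨p, q, m, hc, ⟨h0, h1 | h1, h2⟩ | ⟨h0, h1, h2 | h2⟩⟩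
    · refine ⟨_, ⟨p, 0, q, hc, rfl⟩, (0, 1), by simp, m, ?_⟩
      funext l
      fin_cases l <;>
        simp only [Pi.add_apply, vec, Pi.single_apply, Matrix.cons_val_zero, Matrix.cons_val_one,
          Matrix.cons_val, Fin.zero_eta, Fin.mk_one, Fin.reduceFinMk, Fin.reduceEq, if_true, if_false,
          Units.val_one, Units.val_neg] <;> omega
    · refine ⟨_, ⟨p, 0, q, hc, rfl⟩, (0, -1), by simp, m, ?_⟩
      funext l
      fin_cases l <;>
        simp only [Pi.add_apply, vec, Pi.single_apply, Matrix.cons_val_zero, Matrix.cons_val_one,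
          Matrix.cons_val, Fin.zero_eta, Fin.mk_one, Fin.reduceFinMk, Fin.reduceEq, if_true, if_false,
          Units.val_one, Units.val_neg] <;> omega
    · refine ⟨_, ⟨p, 0, q, hc, rfl⟩, (2, 1), by simp, m, ?_⟩
      funext l
      fin_cases l <;>
        simp only [Pi.add_apply, vec, Pi.single_apply, Matrix.cons_val_zero, Matrix.cons_val_one,
          Matrix.cons_val, Fin.zero_eta, Fin.mk_one, Fin.reduceFinMk, Fin.reduceEq, if_true, if_false,
          Units.val_one, Units.val_neg] <;> omega
    · refine ⟨_, ⟨p, 0, q, hc, rfl⟩, (2, -1), by simp, m, ?_⟩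
      funext l
      fin_cases l <;>
        simp only [Pi.add_apply, vec, Pi.single_apply, Matrix.cons_val_zero, Matrix.cons_val_one,
          Matrix.cons_val, Fin.zero_eta, Fin.mk_one, Fin.reduceFinMk, Fin.reduceEq, if_true, if_false,
          Units.val_one, Units.val_neg] <;> omega

theorem mem_sides_cellsZ {c : ℤ → ℤ → Prop} {g : Pt} : g ∈ towerSides 2 (cellsZ c) ↔
    ∃ p q m, c p q ∧ ((g 2 = 2 * m + 1 ∧ (g 0 = 2 * p + 2 ∨ g 0 = 2 * p) ∧ g 1 = 2 * q + 1) ∨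
      (g 2 = 2 * m + 1 ∧ g 0 = 2 * p + 1 ∧ (g 1 = 2 * q + 2 ∨ g 1 = 2 * q))) := by
  constructor
  · rintro ⟨f, ⟨i, j, k, hc, rfl⟩, ⟨b, s⟩, hb, m, rfl⟩
    refine ⟨_, _, k + m, hc, ?_⟩
    fin_cases b <;> rcases Int.units_eq_one_or s with rfl | rfl <;>
      first
      | exact absurd rfl hb
      | simp only [Pi.add_apply, vec, Pi.single_apply, Matrix.cons_val_zero, Matrix.cons_val_one,
          Matrix.cons_val, Fin.zero_eta, Fin.mk_one, Fin.reduceFinMk, Fin.reduceEq, if_true, if_false,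
          Units.val_one, Units.val_neg]
        omega
  · rintro ⟨p, q, m, hc, ⟨h0, h1 | h1, h2⟩ | ⟨h0, h1, h2 | h2⟩⟩
    · refine ⟨_, ⟨p, q, 0, hc, rfl⟩, (0, 1), by simp, m, ?_⟩
      funext l
      fin_cases l <;>
        simp only [Pi.add_apply, vec, Pi.single_apply, Matrix.cons_val_zero, Matrix.cons_val_one,
          Matrix.cons_val, Fin.zero_eta, Fin.mk_one, Fin.reduceFinMk, Fin.reduceEq, if_true, if_false,
          Units.val_one, Units.val_neg] <;> omega
    · refine ⟨_, ⟨p, q, 0, hc, rfl⟩, (0, -1), by simp, m, ?_⟩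
      funext l
      fin_cases l <;>
        simp only [Pi.add_apply, vec, Pi.single_apply, Matrix.cons_val_zero, Matrix.cons_val_one,
          Matrix.cons_val, Fin.zero_eta, Fin.mk_one, Fin.reduceFinMk, Fin.reduceEq, if_true, if_false,
          Units.val_one, Units.val_neg] <;> omega
    · refine ⟨_, ⟨p, q, 0, hc, rfl⟩, (1, 1), by simp, m, ?_⟩
      funext l
      fin_cases l <;>
        simp only [Pi.add_apply, vec, Pi.single_apply, Matrix.cons_val_zero, Matrix.cons_val_one,
          Matrix.cons_val, Fin.zero_eta, Fin.mk_one, Fin.reduceFinMk, Fin.reduceEq, if_true, if_false,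
          Units.val_one, Units.val_neg] <;> omega
    · refine ⟨_, ⟨p, q, 0, hc, rfl⟩, (1, -1), by simp, m, ?_⟩
      funext l
      fin_cases l <;>
        simp only [Pi.add_apply, vec, Pi.single_apply, Matrix.cons_val_zero, Matrix.cons_val_one,
          Matrix.cons_val, Fin.zero_eta, Fin.mk_one, Fin.reduceFinMk, Fin.reduceEq, if_true, if_false,
          Units.val_one, Units.val_neg] <;> omega


/-! ### The effect of pushing on the reduced coordinates -/

theorem bit_symmDiff (P S : Set Pt) (g : Pt) :
    (bit (g ∈ symmDiff P S) - bit (g ∈ P) - bit (g ∈ S)) % 2 = 0 := by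
  by_cases h1 : g ∈ P <;> by_cases h2 : g ∈ S <;> simp [bit, Set.mem_symmDiff, h1, h2]

theorem reduced_symmDiff (P S : Set Pt) (i j k : ℤ) :
    dA (symmDiff P S) i j k = (dA P i j k + bit (mX S i j k)) % 2 ∧
    dB (symmDiff P S) i j k = (dB P i j k + bit (mY S i j k)) % 2 ∧
    dC (symmDiff P S) i j k = (dC P i j k + bit (mZ S i j k)) % 2 := by
  have h1 := bit_symmDiff P S ![2 * i, 2 * j + 1, 2 * k + 1]
  have h2 := bit_symmDiff P S ![2 * i + 1, 2 * j, 2 * k + 1]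
  have h3 := bit_symmDiff P S ![2 * i + 1, 2 * j + 1, 2 * k]
  unfold dA dB dC mX mY mZ
  refine ⟨?_, ?_, ?_⟩ <;> omega

/-- A square can be a side of either of two adjacent cells. The sides form a union, hence a
disjunction and not a sum modulo 2; in the sets of towers used below at most one of two adjacent
cells is present. -/
theorem sides_cellsX (c : ℤ → ℤ → Prop) (i j k : ℤ) :
    ¬ mX (towerSides 0 (cellsX c)) i j k ∧
    (mY (towerSides 0 (cellsX c)) i j k ↔ c j k ∨ c (j - 1) k) ∧
    (mZ (towerSides 0 (cellsX c)) i j k ↔ c j k ∨ c j (k - 1)) := by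
  unfold mX mY mZ
  simp only [mem_sides_cellsX, Matrix.cons_val_zero, Matrix.cons_val_one, Matrix.cons_val]
  refine ⟨?_, ⟨?_, ?_⟩, ⟨?_, ?_⟩⟩
  · rintro ⟨p, q, m, -, h⟩
    omega
  · rintro ⟨p, q, m, hc, h⟩
    obtain ⟨rfl | rfl, rfl⟩ : (p = j ∨ p = j - 1) ∧ q = k := by omega
    exacts [.inl hc, .inr hc]
  · rintro (hc | hc)
    exacts [⟨_, _, i, hc, by omega⟩, ⟨_, _, i, hc, by omega⟩]
  · rintro ⟨p, q, m, hc, h⟩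
    obtain ⟨rfl, rfl | rfl⟩ : p = j ∧ (q = k ∨ q = k - 1) := by omega
    exacts [.inl hc, .inr hc]
  · rintro (hc | hc)
    exacts [⟨_, _, i, hc, by omega⟩, ⟨_, _, i, hc, by omega⟩]

theorem sides_cellsY (c : ℤ → ℤ → Prop) (i j k : ℤ) :
    (mX (towerSides 1 (cellsY c)) i j k ↔ c i k ∨ c (i - 1) k) ∧
    ¬ mY (towerSides 1 (cellsY c)) i j k ∧
    (mZ (towerSides 1 (cellsY c)) i j k ↔ c i k ∨ c i (k - 1)) := by
  unfold mX mY mZ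
  simp only [mem_sides_cellsY, Matrix.cons_val_zero, Matrix.cons_val_one, Matrix.cons_val]
  refine ⟨⟨?_, ?_⟩, ?_, ⟨?_, ?_⟩⟩
  · rintro ⟨p, q, m, hc, h⟩
    obtain ⟨rfl | rfl, rfl⟩ : (p = i ∨ p = i - 1) ∧ q = k := by omega
    exacts [.inl hc, .inr hc]
  · rintro (hc | hc)
    exacts [⟨_, _, j, hc, by omega⟩, ⟨_, _, j, hc, by omega⟩]
  · rintro ⟨p, q, m, -, h⟩
    omega
  · rintro ⟨p, q, m, hc, h⟩
    obtain ⟨rfl, rfl | rfl⟩ : p = i ∧ (q = k ∨ q = k - 1) := by omega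
    exacts [.inl hc, .inr hc]
  · rintro (hc | hc)
    exacts [⟨_, _, j, hc, by omega⟩, ⟨_, _, j, hc, by omega⟩]

theorem sides_cellsZ (c : ℤ → ℤ → Prop) (i j k : ℤ) :
    (mX (towerSides 2 (cellsZ c)) i j k ↔ c i j ∨ c (i - 1) j) ∧
    (mY (towerSides 2 (cellsZ c)) i j k ↔ c i j ∨ c i (j - 1)) ∧
    ¬ mZ (towerSides 2 (cellsZ c)) i j k := by
  unfold mX mY mZ
  simp only [mem_sides_cellsZ, Matrix.cons_val_zero, Matrix.cons_val_one, Matrix.cons_val]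
  refine ⟨⟨?_, ?_⟩, ⟨?_, ?_⟩, ?_⟩
  · rintro ⟨p, q, m, hc, h⟩
    obtain ⟨rfl | rfl, rfl⟩ : (p = i ∨ p = i - 1) ∧ q = j := by omega
    exacts [.inl hc, .inr hc]
  · rintro (hc | hc)
    exacts [⟨_, _, k, hc, by omega⟩, ⟨_, _, k, hc, by omega⟩]
  · rintro ⟨p, q, m, hc, h⟩
    obtain ⟨rfl, rfl | rfl⟩ : p = i ∧ (q = j ∨ q = j - 1) := by omega
    exacts [.inl hc, .inr hc]
  · rintro (hc | hc)
    exacts [⟨_, _, k, hc, by omega⟩, ⟨_, _, k, hc, by omega⟩]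
  · rintro ⟨p, q, m, -, h⟩
    omega

theorem reduced_range (P : Set Pt) (i j k : ℤ) : (0 ≤ dA P i j k ∧ dA P i j k < 2) ∧
    (0 ≤ dB P i j k ∧ dB P i j k < 2) ∧ 0 ≤ dC P i j k ∧ dC P i j k < 2 := by
  unfold dA dB dC
  omega

theorem bit_of_not {p : Prop} (h : ¬ p) : bit p = 0 := by simp [bit, h]

theorem bit_congr {p q : Prop} (h : p ↔ q) : bit p = bit q := bit_inj.2 h

/-- Pushing towers along `x`. -/
theorem reduced_pushX (P : Set Pt) (c : ℤ → ℤ → Prop) (i j k : ℤ) :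
    dA (symmDiff P (towerSides 0 (cellsX c))) i j k = dA P i j k ∧
    dB (symmDiff P (towerSides 0 (cellsX c))) i j k = (dB P i j k + bit (c j k ∨ c (j - 1) k)) % 2 ∧
    dC (symmDiff P (towerSides 0 (cellsX c))) i j k =
      (dC P i j k + bit (c j k ∨ c j (k - 1))) % 2 := by
  obtain ⟨h1, h2, h3⟩ := reduced_symmDiff P (towerSides 0 (cellsX c)) i j k
  obtain ⟨g1, g2, g3⟩ := sides_cellsX c i j k
  rw [h1, h2, h3, bit_of_not g1, bit_congr g2, bit_congr g3]
  have := reduced_range P i j k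
  exact ⟨by omega, rfl, rfl⟩

/-- Pushing towers along `y`. -/
theorem reduced_pushY (P : Set Pt) (c : ℤ → ℤ → Prop) (i j k : ℤ) :
    dA (symmDiff P (towerSides 1 (cellsY c))) i j k = (dA P i j k + bit (c i k ∨ c (i - 1) k)) % 2 ∧
    dB (symmDiff P (towerSides 1 (cellsY c))) i j k = dB P i j k ∧
    dC (symmDiff P (towerSides 1 (cellsY c))) i j k =
      (dC P i j k + bit (c i k ∨ c i (k - 1))) % 2 := by
  obtain ⟨h1, h2, h3⟩ := reduced_symmDiff P (towerSides 1 (cellsY c)) i j k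
  obtain ⟨g1, g2, g3⟩ := sides_cellsY c i j k
  rw [h1, h2, h3, bit_congr g1, bit_of_not g2, bit_congr g3]
  have := reduced_range P i j k
  exact ⟨rfl, by omega, rfl⟩

/-- Pushing towers along `z`. -/
theorem reduced_pushZ (P : Set Pt) (c : ℤ → ℤ → Prop) (i j k : ℤ) :
    dA (symmDiff P (towerSides 2 (cellsZ c))) i j k = (dA P i j k + bit (c i j ∨ c (i - 1) j)) % 2 ∧
    dB (symmDiff P (towerSides 2 (cellsZ c))) i j k = (dB P i j k + bit (c i j ∨ c i (j - 1))) % 2 ∧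
    dC (symmDiff P (towerSides 2 (cellsZ c))) i j k = dC P i j k := by
  obtain ⟨h1, h2, h3⟩ := reduced_symmDiff P (towerSides 2 (cellsZ c)) i j k
  obtain ⟨g1, g2, g3⟩ := sides_cellsZ c i j k
  rw [h1, h2, h3, bit_congr g1, bit_congr g2, bit_of_not g3]
  have := reduced_range P i j k
  exact ⟨rfl, rfl, by omega⟩

theorem OnlySquares.symmDiff {P S : Set Pt} (hP : OnlySquares P) (hS : OnlySquares S) :
    OnlySquares (symmDiff P S) := by
  rintro c (⟨h, -⟩ | ⟨h, -⟩)
  exacts [hP c h, hS c h]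

theorem onlySquares_sidesX (c : ℤ → ℤ → Prop) : OnlySquares (towerSides 0 (cellsX c)) := by
  intro g hg
  obtain ⟨p, q, m, -, h⟩ := mem_sides_cellsX.1 hg
  have e : ∀ n : Fin 3, (Even (g 0) ↔ 0 = n) → (Even (g 1) ↔ 1 = n) → (Even (g 2) ↔ 2 = n) →
      ∀ i, Even (g i) ↔ i = n := by
    intro n h0 h1 h2 i
    fin_cases i <;> assumption
  rcases h with h | h
  · exact ⟨1, e 1 (by simp [Int.even_iff]; omega) (by simp [Int.even_iff]; omega)
      (by simp [Int.even_iff]; omega)⟩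
  · exact ⟨2, e 2 (by simp [Int.even_iff]; omega) (by simp [Int.even_iff]; omega)
      (by simp [Int.even_iff]; omega)⟩

theorem onlySquares_sidesY (c : ℤ → ℤ → Prop) : OnlySquares (towerSides 1 (cellsY c)) := by
  intro g hg
  obtain ⟨p, q, m, -, h⟩ := mem_sides_cellsY.1 hg
  have e : ∀ n : Fin 3, (Even (g 0) ↔ 0 = n) → (Even (g 1) ↔ 1 = n) → (Even (g 2) ↔ 2 = n) →
      ∀ i, Even (g i) ↔ i = n := by
    intro n h0 h1 h2 i
    fin_cases i <;> assumption
  rcases h with h | h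
  · exact ⟨0, e 0 (by simp [Int.even_iff]; omega) (by simp [Int.even_iff]; omega)
      (by simp [Int.even_iff]; omega)⟩
  · exact ⟨2, e 2 (by simp [Int.even_iff]; omega) (by simp [Int.even_iff]; omega)
      (by simp [Int.even_iff]; omega)⟩

theorem onlySquares_sidesZ (c : ℤ → ℤ → Prop) : OnlySquares (towerSides 2 (cellsZ c)) := by
  intro g hg
  obtain ⟨p, q, m, -, h⟩ := mem_sides_cellsZ.1 hg
  have e : ∀ n : Fin 3, (Even (g 0) ↔ 0 = n) → (Even (g 1) ↔ 1 = n) → (Even (g 2) ↔ 2 = n) →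
      ∀ i, Even (g i) ↔ i = n := by
    intro n h0 h1 h2 i
    fin_cases i <;> assumption
  rcases h with h | h
  · exact ⟨0, e 0 (by simp [Int.even_iff]; omega) (by simp [Int.even_iff]; omega)
      (by simp [Int.even_iff]; omega)⟩
  · exact ⟨1, e 1 (by simp [Int.even_iff]; omega) (by simp [Int.even_iff]; omega)
      (by simp [Int.even_iff]; omega)⟩

end CubicPolyhedra

namespace CubicPolyhedra

/-! ### Polyhedra given by vertex configurations -/

/-- A square may be contributed by any of its four corners. The hypotheses make all corners agree
with the prescribed coordinates, so presence can be tested at the corner where both directions are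
positive. -/
theorem ofConfig_squares {L : Pt → Dir → Dir → Prop} {A B C : ℤ → ℤ → ℤ → ℤ}
    (hL : ∀ v d e, L v d e → d.1 ≠ e.1)
    (hA : ∀ (v : Pt) (s u : ℤˣ), (L v (1, s) (2, u) ∨ L v (2, u) (1, s)) ↔
      (A (v 0) (v 1 + off s) (v 2 + off u) + (v 1 + off s) + (v 2 + off u)) % 2 = 1)
    (hB : ∀ (v : Pt) (s u : ℤˣ), (L v (0, s) (2, u) ∨ L v (2, u) (0, s)) ↔
      (B (v 0 + off s) (v 1) (v 2 + off u) + (v 0 + off s) + (v 2 + off u)) % 2 = 1)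
    (hC : ∀ (v : Pt) (s u : ℤˣ), (L v (0, s) (1, u) ∨ L v (1, u) (0, s)) ↔
      (C (v 0 + off s) (v 1 + off u) (v 2) + (v 0 + off s) + (v 1 + off u)) % 2 = 1) :
    OnlySquares (ofConfig L) ∧ ∀ i j k, (mX (ofConfig L) i j k ↔ (A i j k + j + k) % 2 = 1) ∧
      (mY (ofConfig L) i j k ↔ (B i j k + i + k) % 2 = 1) ∧
      (mZ (ofConfig L) i j k ↔ (C i j k + i + j) % 2 = 1) := by
  have cases : ∀ c ∈ ofConfig L,
      (∃ (v : Pt) (s u : ℤˣ), (L v (1, s) (2, u) ∨ L v (2, u) (1, s)) ∧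
        c = ![2 * v 0, 2 * (v 1 + off s) + 1, 2 * (v 2 + off u) + 1]) ∨
      (∃ (v : Pt) (s u : ℤˣ), (L v (0, s) (2, u) ∨ L v (2, u) (0, s)) ∧
        c = ![2 * (v 0 + off s) + 1, 2 * v 1, 2 * (v 2 + off u) + 1]) ∨
      (∃ (v : Pt) (s u : ℤˣ), (L v (0, s) (1, u) ∨ L v (1, u) (0, s)) ∧
        c = ![2 * (v 0 + off s) + 1, 2 * (v 1 + off u) + 1, 2 * v 2]) := by
    rintro c ⟨v, ⟨a, s⟩, ⟨b, u⟩, h, rfl⟩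
    have hne := hL _ _ _ h
    fin_cases a <;> fin_cases b <;> first | exact absurd rfl hne | skip
    · exact .inr (.inr ⟨v, s, u, .inl h, square_xy v s u⟩)
    · exact .inr (.inl ⟨v, s, u, .inl h, square_xz v s u⟩)
    · exact .inr (.inr ⟨v, u, s, .inr h, (square_comm _ _ _).trans (square_xy v u s)⟩)
    · exact .inl ⟨v, s, u, .inl h, square_yz v s u⟩
    · exact .inr (.inl ⟨v, u, s, .inr h, (square_comm _ _ _).trans (square_xz v u s)⟩)
    · exact .inl ⟨v, u, s, .inr h, (square_comm _ _ _).trans (square_yz v u s)⟩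
  refine ⟨?_, fun i j k => ⟨⟨fun h => ?_, fun h => ?_⟩, ⟨fun h => ?_, fun h => ?_⟩,
    ⟨fun h => ?_, fun h => ?_⟩⟩⟩
  · intro c hc
    rcases cases c hc with ⟨v, s, u, -, rfl⟩ | ⟨v, s, u, -, rfl⟩ | ⟨v, s, u, -, rfl⟩
    exacts [isSquare_x _ _ _, isSquare_y _ _ _, isSquare_z _ _ _]
  · rcases cases _ h with ⟨v, s, u, h', e⟩ | ⟨v, s, u, -, e⟩ | ⟨v, s, u, -, e⟩
    · have e0 := congrFun e 0
      have e1 := congrFun e 1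
      have e2 := congrFun e 2
      simp only [Matrix.cons_val_zero, Matrix.cons_val_one, Matrix.cons_val] at e0 e1 e2
      obtain rfl : i = v 0 := by omega
      obtain rfl : j = v 1 + off s := by omega
      obtain rfl : k = v 2 + off u := by omega
      exact (hA v s u).1 h'
    · have e0 := congrFun e 0
      simp only [Matrix.cons_val_zero] at e0
      omega
    · have e0 := congrFun e 0
      simp only [Matrix.cons_val_zero] at e0
      omega
  · have := (hA ![i, j, k] 1 1).2 (by simpa using h)
    rcases this with h | h
    · exact ⟨_, _, _, h, by rw [square_yz]; simp⟩
    · exact ⟨_, _, _, h, by rw [square_comm, square_yz]; simp⟩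
  · rcases cases _ h with ⟨v, s, u, -, e⟩ | ⟨v, s, u, h', e⟩ | ⟨v, s, u, -, e⟩
    · have e0 := congrFun e 0
      simp only [Matrix.cons_val_zero] at e0
      omega
    · have e0 := congrFun e 0
      have e1 := congrFun e 1
      have e2 := congrFun e 2
      simp only [Matrix.cons_val_zero, Matrix.cons_val_one, Matrix.cons_val] at e0 e1 e2
      obtain rfl : i = v 0 + off s := by omega
      obtain rfl : j = v 1 := by omega
      obtain rfl : k = v 2 + off u := by omega
      exact (hB v s u).1 h'
    · have e2 := congrFun e 2
      simp only [Matrix.cons_val] at e2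
      omega
  · have := (hB ![i, j, k] 1 1).2 (by simpa using h)
    rcases this with h | h
    · exact ⟨_, _, _, h, by rw [square_xz]; simp⟩
    · exact ⟨_, _, _, h, by rw [square_comm, square_xz]; simp⟩
  · rcases cases _ h with ⟨v, s, u, -, e⟩ | ⟨v, s, u, -, e⟩ | ⟨v, s, u, h', e⟩
    · have e0 := congrFun e 0
      simp only [Matrix.cons_val_zero] at e0
      omega
    · have e2 := congrFun e 2
      simp only [Matrix.cons_val] at e2
      omega
    · have e0 := congrFun e 0
      have e1 := congrFun e 1
      have e2 := congrFun e 2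
      simp only [Matrix.cons_val_zero, Matrix.cons_val_one, Matrix.cons_val] at e0 e1 e2
      obtain rfl : i = v 0 + off s := by omega
      obtain rfl : j = v 1 + off u := by omega
      obtain rfl : k = v 2 := by omega
      exact (hC v s u).1 h'
  · have := (hC ![i, j, k] 1 1).2 (by simpa using h)
    rcases this with h | h
    · exact ⟨_, _, _, h, by rw [square_xy]; simp⟩
    · exact ⟨_, _, _, h, by rw [square_comm, square_xy]; simp⟩

/-- The reduced coordinates of a polyhedron given by vertex configurations. -/
theorem reduced_ofConfig {L : Pt → Dir → Dir → Prop} {A B C : ℤ → ℤ → ℤ → ℤ}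
    (hL : ∀ v d e, L v d e → d.1 ≠ e.1)
    (hA : ∀ (v : Pt) (s u : ℤˣ), (L v (1, s) (2, u) ∨ L v (2, u) (1, s)) ↔
      (A (v 0) (v 1 + off s) (v 2 + off u) + (v 1 + off s) + (v 2 + off u)) % 2 = 1)
    (hB : ∀ (v : Pt) (s u : ℤˣ), (L v (0, s) (2, u) ∨ L v (2, u) (0, s)) ↔
      (B (v 0 + off s) (v 1) (v 2 + off u) + (v 0 + off s) + (v 2 + off u)) % 2 = 1)
    (hC : ∀ (v : Pt) (s u : ℤˣ), (L v (0, s) (1, u) ∨ L v (1, u) (0, s)) ↔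
      (C (v 0 + off s) (v 1 + off u) (v 2) + (v 0 + off s) + (v 1 + off u)) % 2 = 1) :
    OnlySquares (ofConfig L) ∧ ∀ i j k, dA (ofConfig L) i j k = A i j k % 2 ∧
      dB (ofConfig L) i j k = B i j k % 2 ∧ dC (ofConfig L) i j k = C i j k % 2 := by
  obtain ⟨h1, h2⟩ := ofConfig_squares hL hA hB hC
  refine ⟨h1, fun i j k => ?_⟩
  obtain ⟨g1, g2, g3⟩ := h2 i j k
  rw [mX_iff] at g1
  rw [mY_iff] at g2
  rw [mZ_iff] at g3
  have := reduced_range (ofConfig L) i j k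
  refine ⟨?_, ?_, ?_⟩
  · clear g2 g3
    omega
  · clear g1 g3
    omega
  · clear g1 g2
    omega

theorem negOnePow_mul (n : ℤ) (s : ℤˣ) :
    n.negOnePow * s = if (n + off s) % 2 = 0 then 1 else -1 := by
  rcases Int.even_or_odd n with h | h
  · rw [Int.negOnePow_even n h, one_mul]
    rw [Int.even_iff] at h
    rcases Int.units_eq_one_or s with rfl | rfl
    · rw [off_one, if_pos (by omega)]
    · rw [off_neg_one, if_neg (by omega)]
  · rw [Int.negOnePow_odd n h]
    rw [Int.odd_iff] at h
    rcases Int.units_eq_one_or s with rfl | rfl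
    · rw [off_one, if_neg (by omega)]
      rfl
    · rw [off_neg_one, if_pos (by omega)]
      rfl

theorem one_ne_neg_one_units : (1 : ℤˣ) ≠ -1 := by decide

theorem config_axes : ∀ (l : Layer) (d e : Dir), (d, e) ∈ l.config → d.1 ≠ e.1 := by
  rintro l d e h
  cases l <;>
    simp only [Layer.config, saddleConfig, Set.mem_insert_iff, Set.mem_singleton_iff,
      Prod.mk.injEq] at h <;>
    rcases h with ⟨rfl, rfl⟩ | ⟨rfl, rfl⟩ | ⟨rfl, rfl⟩ | ⟨rfl, rfl⟩ | ⟨rfl, rfl⟩ | ⟨rfl, rfl⟩ <;>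
    decide

/-- The squares of a saddle. -/
theorem saddle_iff (a b : Fin 3) (hab : a < b) (x y : ℤˣ) :
    (((a, x), (b, y)) ∈ saddleConfig ∨ ((b, y), (a, x)) ∈ saddleConfig) ↔ x ≠ y := by
  rcases Int.units_eq_one_or x with rfl | rfl <;> rcases Int.units_eq_one_or y with rfl | rfl <;>
    fin_cases a <;> fin_cases b <;>
    simp [saddleConfig, one_ne_neg_one_units, one_ne_neg_one_units.symm] at hab ⊢

/-- The squares of the screws with axis `x` that generate slabs. -/
theorem xSlab_iff (x y : ℤˣ) :
    ((((1, x), (2, y)) ∈ Layer.xSlab.config ∨ ((2, y), (1, x)) ∈ Layer.xSlab.config) ↔ x ≠ y) ∧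
    ((((0, x), (2, y)) ∈ Layer.xSlab.config ∨ ((2, y), (0, x)) ∈ Layer.xSlab.config) ↔ x = 1) ∧
    ((((0, x), (1, y)) ∈ Layer.xSlab.config ∨ ((1, y), (0, x)) ∈ Layer.xSlab.config) ↔ x = -1) := by
  rcases Int.units_eq_one_or x with rfl | rfl <;> rcases Int.units_eq_one_or y with rfl | rfl <;>
    simp [Layer.config, one_ne_neg_one_units, one_ne_neg_one_units.symm]

/-- The squares of the screws with axis `y` that generate slabs. -/
theorem ySlab_iff (x y : ℤˣ) :
    ((((1, x), (2, y)) ∈ Layer.ySlab.config ∨ ((2, y), (1, x)) ∈ Layer.ySlab.config) ↔ x = 1) ∧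
    ((((0, x), (2, y)) ∈ Layer.ySlab.config ∨ ((2, y), (0, x)) ∈ Layer.ySlab.config) ↔ x ≠ y) ∧
    ((((0, x), (1, y)) ∈ Layer.ySlab.config ∨ ((1, y), (0, x)) ∈ Layer.ySlab.config) ↔ y = -1) := by
  rcases Int.units_eq_one_or x with rfl | rfl <;> rcases Int.units_eq_one_or y with rfl | rfl <;>
    simp [Layer.config, one_ne_neg_one_units, one_ne_neg_one_units.symm]

/-- All reduced coordinates of `P₀` vanish. -/
theorem reduced_P0 : OnlySquares P0 ∧ ∀ i j k, dA P0 i j k = 0 ∧ dB P0 i j k = 0 ∧ dC P0 i j k = 0 := by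
  have key : ∀ m n : ℤ, ((if m % 2 = 0 then (1 : ℤˣ) else -1) ≠ if n % 2 = 0 then 1 else -1) ↔
      (0 + m + n) % 2 = 1 := by
    intro m n
    have := one_ne_neg_one_units
    split_ifs <;> simp [this, this.symm] <;> omega
  refine reduced_ofConfig (A := 0) (B := 0) (C := 0) 
    (fun v d e h => config_axes .sheet (fold v d) (fold v e) h) ?_ ?_ ?_ <;>
  · intro v s u
    simp only [fold, negOnePow_mul]
    rw [saddle_iff _ _ (by decide)]
    exact key _ _

end CubicPolyhedra

namespace CubicPolyhedra

/-! ### The polyhedra `P_σ` and `P_τ` in reduced coordinates -/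

theorem columnConfig_axes {σ : ℤ → ℤˣ} {k : ℤ} {d e : Dir} (h : columnConfig σ k d e) :
    d.1 ≠ e.1 := by
  rcases Int.even_or_odd k with hk | hk
  · simp only [columnConfig, if_pos hk] at h
    rcases h with ⟨rfl, h⟩ | ⟨rfl, h⟩ | ⟨h, h', -⟩ <;> simp [h, *]
  · simp only [columnConfig, if_neg (Int.not_even_iff_odd.2 hk)] at h
    rcases h with ⟨rfl, h⟩ | ⟨rfl, h⟩ | ⟨h, h', -⟩ <;> simp [h, *]

theorem columnConfig_vertical {σ : ℤ → ℤˣ} {k : ℤ} {a : Fin 3} (ha : a ≠ 2) (s u : ℤˣ) :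
    (columnConfig σ k (a, s) (2, u) ∨ columnConfig σ k (2, u) (a, s)) ↔
      (a = if (k + off u) % 2 = 0 then 0 else 1) := by
  have h1 := one_ne_neg_one_units
  rcases Int.even_or_odd k with hk | hk
  · simp only [columnConfig, if_pos hk]
    rw [Int.even_iff] at hk
    rcases Int.units_eq_one_or u with rfl | rfl
    · rw [off_one, if_pos (by omega)]
      fin_cases a <;> simp [h1] at ha ⊢
    · rw [off_neg_one, if_neg (by omega)]
      fin_cases a <;> simp [h1.symm] at ha ⊢
  · simp only [columnConfig, if_neg (Int.not_even_iff_odd.2 hk)]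
    rw [Int.odd_iff] at hk
    rcases Int.units_eq_one_or u with rfl | rfl
    · rw [off_one, if_neg (by omega)]
      fin_cases a <;> simp [h1] at ha ⊢
    · rw [off_neg_one, if_pos (by omega)]
      fin_cases a <;> simp [h1.symm] at ha ⊢

theorem columnConfig_horizontal {σ : ℤ → ℤˣ} {k : ℤ} (m n : ℤ) :
    (columnConfig σ k (0, if m % 2 = 0 then 1 else -1) (1, if n % 2 = 0 then 1 else -1) ∨
      columnConfig σ k (1, if n % 2 = 0 then 1 else -1) (0, if m % 2 = 0 then 1 else -1)) ↔
      (m + n + k + if σ k = 1 then 0 else 1) % 2 = 1 := by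
  have h1 := one_ne_neg_one_units
  rcases Int.even_or_odd k with hk | hk
  · simp only [columnConfig, if_pos hk]
    rw [Int.even_iff] at hk
    rcases Int.units_eq_one_or (σ k) with h | h <;>
      simp only [h, h1.symm, reduceIte] <;> split_ifs <;> simp [vec, h1, h1.symm] <;> omega
  · simp only [columnConfig, if_neg (Int.not_even_iff_odd.2 hk)]
    rw [Int.odd_iff] at hk
    rcases Int.units_eq_one_or (σ k) with h | h <;>
      simp only [h, h1.symm, reduceIte] <;> split_ifs <;> simp [vec, h1, h1.symm] <;> omega

/-- The reduced coordinates of `P_σ`. -/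
theorem reduced_Psigma (σ : ℤ → ℤˣ) : OnlySquares (Psigma σ) ∧ ∀ i j k,
    dA (Psigma σ) i j k = j % 2 ∧ dB (Psigma σ) i j k = (1 + i) % 2 ∧
      dC (Psigma σ) i j k = (k + if σ k = 1 then 0 else 1) % 2 := by
  refine reduced_ofConfig (A := fun _ j _ => j) (B := fun i _ _ => 1 + i)
    (C := fun _ _ k => k + if σ k = 1 then 0 else 1)
    (fun v d e h => ((columnConfig_axes h : (fold _ d).1 ≠ (fold _ e).1) : d.1 ≠ e.1)) ?_ ?_ ?_
  · intro v s u
    simp only [fold, Matrix.cons_val, Int.negOnePow_zero, one_mul]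
    rw [columnConfig_vertical (by decide)]
    split_ifs <;> simp <;> omega
  · intro v s u
    simp only [fold, Matrix.cons_val, Int.negOnePow_zero, one_mul]
    rw [columnConfig_vertical (by decide)]
    split_ifs <;> simp <;> omega
  · intro v s u
    simp only [fold, negOnePow_mul, Matrix.cons_val_zero, Matrix.cons_val_one]
    rw [columnConfig_horizontal]
    split_ifs <;> omega

theorem sum_Ico_succ {M : Type*} [AddCommGroup M] (f : ℤ → M) (n : ℤ) :
    ∑ m ∈ Finset.Ico 0 (n + 1), f m - ∑ m ∈ Finset.Ico (n + 1) 0, f m =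
      ∑ m ∈ Finset.Ico 0 n, f m - ∑ m ∈ Finset.Ico n 0, f m + f n := by
  rcases le_or_gt 0 n with h | h
  · rw [Finset.Ico_eq_empty_of_le (a := n + 1) (by omega),
      Finset.Ico_eq_empty_of_le (a := n) (by omega), ← Finset.insert_Ico_right_eq_Ico_add_one h,
      Finset.sum_insert (by simp)]
    simp [add_comm]
  · rw [Finset.Ico_eq_empty_of_le (b := n + 1) (by omega),
      Finset.Ico_eq_empty_of_le (b := n) (by omega), ← Finset.insert_Ico_add_one_left_eq_Ico h,
      Finset.sum_insert (by simp)]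
    simp

/-- The reduced coordinates of `P_τ`, where `α` and `β` count the layers which
are slabs with axis `y` and `x`, respectively. -/
theorem reduced_Ptau (τ : ℤ → Layer) : ∃ α β : ℤ → ℤ, α 0 = 0 ∧ β 0 = 0 ∧
    (∀ n, α (n + 1) = α n + bit (τ n = .ySlab)) ∧ (∀ n, β (n + 1) = β n + bit (τ n = .xSlab)) ∧
    OnlySquares (Ptau τ) ∧ ∀ i j k, dA (Ptau τ) i j k = α (k + 1) % 2 ∧
      dB (Ptau τ) i j k = β (k + 1) % 2 ∧ dC (Ptau τ) i j k = (α k + β k +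
        bit (τ k = .xSlab) * (α k + j + k) + bit (τ k = .ySlab) * (β k + i + k)) % 2 := by
  have hsucc : ∀ n, layerShift τ (n + 1) = layerShift τ n + (τ n).shift :=
    sum_Ico_succ fun n => (τ n).shift
  have hzero : layerShift τ 0 = 0 := by simp [layerShift]
  have h00 : layerShift τ 0 0 = 0 := by rw [hzero]; rfl
  have h01 : layerShift τ 0 1 = 0 := by rw [hzero]; rfl
  have hs0 : ∀ n, layerShift τ (n + 1) 0 = layerShift τ n 0 + (τ n).shift 0 := fun n => by
    rw [hsucc]; rfl
  have hs1 : ∀ n, layerShift τ (n + 1) 1 = layerShift τ n 1 + (τ n).shift 1 := fun n => by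
    rw [hsucc]; rfl
  -- Each layer shifts by one along every horizontal direction except the axis of a slab. So `n`
  -- minus the shift along `y` counts the slabs with axis `y`, and likewise for `x`.
  refine ⟨fun n => n - layerShift τ n 1, fun n => n - layerShift τ n 0, by simp [h01], by simp [h00],
    fun n => ?_, fun n => ?_, reduced_ofConfig
    (A := fun _ _ k => (k + 1 - layerShift τ (k + 1) 1))
    (B := fun _ _ k => (k + 1 - layerShift τ (k + 1) 0))
    (C := fun i j k => (k - layerShift τ k 1) + (k - layerShift τ k 0) +
      bit (τ k = .xSlab) * (k - layerShift τ k 1 + j + k) +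
      bit (τ k = .ySlab) * (k - layerShift τ k 0 + i + k))
      (fun v d e h => (config_axes _ _ _ h : (fold _ d).1 ≠ (fold _ e).1)) ?_ ?_ ?_⟩
  · simp only [hs1]
    rcases τ n <;> simp [Layer.shift, bit] <;> ring
  · simp only [hs0]
    rcases τ n <;> simp [Layer.shift, bit] <;> ring
  all_goals
    intro v s u
    simp only [fold, Matrix.cons_val, negOnePow_mul, Matrix.cons_val_zero, Matrix.cons_val_one,
      Int.negOnePow_zero, one_mul, Pi.sub_apply]
  · have g := hs1 (v 2)
    have h1 := one_ne_neg_one_units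
    rcases Int.units_eq_one_or u with rfl | rfl
    · rw [off_one, add_zero, g]
      rcases τ (v 2)
      · rw [Layer.config, saddle_iff _ _ (by decide)]
        split_ifs <;> simp [Layer.shift, h1] <;> omega
      · rw [(xSlab_iff _ _).1]
        split_ifs <;> simp [Layer.shift, h1] <;> omega
      · rw [(ySlab_iff _ _).1]
        split_ifs <;> simp [Layer.shift, h1] <;> omega
    · rw [off_neg_one, neg_add_cancel_right]
      rcases τ (v 2)
      · rw [Layer.config, saddle_iff _ _ (by decide)]
        split_ifs <;> simp [Layer.shift, h1] <;> omega
      · rw [(xSlab_iff _ _).1]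
        split_ifs <;> simp [Layer.shift, h1] <;> omega
      · rw [(ySlab_iff _ _).1]
        split_ifs <;> simp [Layer.shift, h1] <;> omega
  · have g := hs0 (v 2)
    have h1 := one_ne_neg_one_units
    rcases Int.units_eq_one_or u with rfl | rfl
    · rw [off_one, add_zero, g]
      rcases τ (v 2)
      · rw [Layer.config, saddle_iff _ _ (by decide)]
        split_ifs <;> simp [Layer.shift, h1] <;> omega
      · rw [(xSlab_iff _ _).2.1]
        split_ifs <;> simp [Layer.shift, h1, h1.symm] <;> omega
      · rw [(ySlab_iff _ _).2.1]
        split_ifs <;> simp [Layer.shift, h1, h1.symm] <;> omega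
    · rw [off_neg_one, neg_add_cancel_right]
      rcases τ (v 2)
      · rw [Layer.config, saddle_iff _ _ (by decide)]
        split_ifs <;> simp [Layer.shift, h1] <;> omega
      · rw [(xSlab_iff _ _).2.1]
        split_ifs <;> simp [Layer.shift, h1, h1.symm] <;> omega
      · rw [(ySlab_iff _ _).2.1]
        split_ifs <;> simp [Layer.shift, h1, h1.symm] <;> omega
  · have h1 := one_ne_neg_one_units
    rcases τ (v 2)
    · rw [Layer.config, saddle_iff _ _ (by decide)]
      split_ifs <;> simp [bit, h1] <;> omega
    · rw [(xSlab_iff _ _).2.2]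
      split_ifs <;> simp [bit, h1] <;> omega
    · rw [(ySlab_iff _ _).2.2]
      split_ifs <;> simp [bit, h1] <;> omega

end CubicPolyhedra

namespace CubicPolyhedra

/-! ### Pushed polyhedra that come from `P₀` -/

/-- The cells of towers: they lie between the lines of `R`, and `a` is the state of their sides. -/
def towerCells (R : ℤ → ℤ → Prop) (a : ℤ → ℤ → ℤ) (i j : ℤ) : Prop :=
  (i + j) % 2 = 1 ∧ Fst R i ∧ Fst R (i + 1) ∧ Snd R j ∧ Snd R (j + 1) ∧ a i j = 1

theorem eq_bit {p : Prop} {x : ℤ} (hx : 0 ≤ x ∧ x < 2) (h : x = 1 ↔ p) : x = bit p := by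
  rcases bit_cases p with ⟨h1, h2⟩ | ⟨h1, h2⟩
  · rw [h2, h.2 h1]
  · have : x ≠ 1 := fun h' => h1 (h.1 h')
    omega

namespace Rules

variable {A B C : ℤ → ℤ → ℤ → ℤ} {X Y Z : ℤ → ℤ → Prop}

/-- In a cell of odd parity, two sides that meet in a possible line `Z` have the same state: this is
the line relation if the line is present, and otherwise the saddle relation, in which `C` vanishes.
Thus such a cell is pushed as a whole or not at all. -/
theorem line_link (h : Rules A B C X Y Z)
    (FC : ∀ i j k, ¬ (Fst Y i ∧ Snd Y k) → ¬ (Fst X j ∧ Snd X k) → C i j k = 0)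
    {i j ic jc : ℤ} (hi : Fst Z i) (hj : Snd Z j) (hic : ic = i ∨ ic = i - 1)
    (hjc : jc = j ∨ jc = j - 1) (hodd : (ic + jc) % 2 = 1) (k : ℤ) : A i jc k = B ic j k := by
  have ny := h.not_Fst_Y hi
  have nx := h.not_Fst_X hj
  have r1 := h.rangeA i jc k
  have r2 := h.rangeB ic j k
  by_cases hz : Z i j
  · have := h.cube_Z hz k hic hjc
    omega
  · have hy : ¬ Y i k := fun h' => ny ⟨_, h'⟩
    have hx : ¬ X j k := fun h' => nx ⟨_, h'⟩
    have h1 := h.cube_vertex hx hy hz hic hjc (.inl (rfl : k = k))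
    have h0 := FC i j k (fun h' => ny h'.1) (fun h' => nx h'.1)
    have h2 : C ic jc k = C i j k := by
      have : C ic jc k = C i jc k := by
        rcases hic with rfl | rfl
        · rfl
        · exact h.C_of_not_Y hy _
      rw [this]
      rcases hjc with rfl | rfl
      · rfl
      · exact h.C_of_not_X hx _
    omega

/-- The towers along `z` determine the coordinates `A` and `B` near the lines along `z`. -/
theorem eq_towers (h : Rules A B C X Y Z)
    (FA : ∀ i j k, ¬ (Fst Z i ∧ Snd Z j) → ¬ (Fst Y i ∧ Snd Y k) → A i j k = 0)
    (FB : ∀ i j k, ¬ (Fst Z i ∧ Snd Z j) → ¬ (Fst X j ∧ Snd X k) → B i j k = 0)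
    (FC : ∀ i j k, ¬ (Fst Y i ∧ Snd Y k) → ¬ (Fst X j ∧ Snd X k) → C i j k = 0) :
    (∀ i j k, ¬ Fst Y i → A i j k = bit (towerCells Z (fun i j => A i j 0) i j ∨
      towerCells Z (fun i j => A i j 0) (i - 1) j)) ∧
    ∀ i j k, ¬ Fst X j → B i j k = bit (towerCells Z (fun i j => A i j 0) i j ∨
      towerCells Z (fun i j => A i j 0) i (j - 1)) := by
  have zi : ∀ {i} j, ¬ Fst Z i → ¬ Z i j := fun {_} j hi h' => hi ⟨j, h'⟩
  have zj : ∀ i {j}, ¬ Snd Z j → ¬ Z i j := fun i _ hj h' => hj ⟨i, h'⟩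
  -- If one of the two planes bounding the square has no lines `Z`, then `A` is unchanged across it
  -- and vanishes by `FA`.
  have A0 : ∀ i j k, ¬ Fst Y i → ¬ (Fst Z i ∧ Snd Z j ∧ Snd Z (j + 1)) → A i j k = 0 := by
    intro i j k hy hn
    by_cases hz : Fst Z i ∧ Snd Z j
    · have e := h.A_of_not_Z (i := i) (j := j + 1) (zj i fun h' => hn ⟨hz.1, hz.2, h'⟩) k
      rw [add_sub_cancel_right] at e
      rw [e]
      exact FA _ _ _ (fun h' => hn ⟨hz.1, hz.2, h'.2⟩) (fun h' => hy h'.1)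
    · exact FA _ _ _ hz (fun h' => hy h'.1)
  have B0 : ∀ i j k, ¬ Fst X j → ¬ (Fst Z i ∧ Fst Z (i + 1) ∧ Snd Z j) → B i j k = 0 := by
    intro i j k hx hn
    by_cases hz : Fst Z i ∧ Snd Z j
    · have e := h.B_of_not_Z (i := i + 1) (j := j) (zi j fun h' => hn ⟨hz.1, h', hz.2⟩) k
      rw [add_sub_cancel_right] at e
      rw [e]
      exact FB _ _ _ (fun h' => hn ⟨hz.1, h'.1, hz.2⟩) (fun h' => hx h'.1)
    · exact FB _ _ _ hz (fun h' => hx h'.1)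
  refine ⟨fun i j k hy => eq_bit (h.rangeA _ _ _) ⟨fun h1 => ?_, fun h1 => ?_⟩,
    fun i j k hx => eq_bit (h.rangeB _ _ _) ⟨fun h1 => ?_, fun h1 => ?_⟩⟩
  · by_cases hn : Fst Z i ∧ Snd Z j ∧ Snd Z (j + 1)
    · obtain ⟨hi, hj, hj'⟩ := hn
      have nx := h.not_Fst_X hj
      -- Exactly one of the two cells that share this side has odd parity, as normal faces of `P0`
      -- require; `line_link` passes the state around its edges.
      rcases Int.emod_two_eq_zero_or_one (i + j) with ho | ho
      · have e := h.line_link FC hi hj (ic := i - 1) (.inr rfl) (.inl rfl) (by omega) k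
        have hi' : Fst Z (i - 1) := by
          by_contra hn
          have := B0 (i - 1) j k nx (fun h' => hn h'.1)
          omega
        have e' := h.line_link FC hi' hj (.inl rfl) (.inl rfl) (by omega) k
        refine .inr ⟨by omega, hi', by rwa [sub_add_cancel], hj, hj', ?_⟩
        have := h.A_const_k (h.not_Fst_Y hi') j 0 k
        change A _ _ 0 = 1
        omega
      · have e := h.line_link FC hi hj (.inl rfl) (.inl rfl) ho k
        have hi' : Fst Z (i + 1) := by
          by_contra hn
          have := B0 i j k nx (fun h' => hn h'.2.1)
          omega
        refine .inl ⟨ho, hi, hi', hj, hj', ?_⟩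
        rw [← h1]
        exact h.A_const_k hy j 0 k
    · have := A0 i j k hy hn
      omega
  · rcases h1 with ⟨-, -, -, -, -, h1⟩ | ⟨ho, hi', hi, hj, hj', h1⟩
    · rw [← h1]
      exact h.A_const_k hy j k 0
    · rw [sub_add_cancel] at hi
      change A _ _ 0 = 1 at h1
      rw [h.A_const_k (h.not_Fst_Y hi') j 0 k] at h1
      have e' := h.line_link FC hi' hj (.inl rfl) (.inl rfl) (by omega) k
      have e := h.line_link FC hi hj (ic := i - 1) (.inr rfl) (.inl rfl) (by omega) k
      omega
  · by_cases hn : Fst Z i ∧ Fst Z (i + 1) ∧ Snd Z j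
    · obtain ⟨hi, hi', hj⟩ := hn
      have ny := h.not_Fst_Y hi
      rcases Int.emod_two_eq_zero_or_one (i + j) with ho | ho
      · have e := h.line_link FC hi hj (jc := j - 1) (.inl rfl) (.inr rfl) (by omega) k
        have hj' : Snd Z (j - 1) := by
          by_contra hn
          have := A0 i (j - 1) k ny (fun h' => hn h'.2.1)
          omega
        refine .inr ⟨by omega, hi, hi', hj', by rwa [sub_add_cancel], ?_⟩
        change A _ _ 0 = 1
        rw [h.A_const_k ny _ 0 k]
        omega
      · have e := h.line_link FC hi hj (.inl rfl) (.inl rfl) ho k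
        have hj' : Snd Z (j + 1) := by
          by_contra hn
          have := A0 i j k ny (fun h' => hn h'.2.2)
          omega
        refine .inl ⟨ho, hi, hi', hj, hj', ?_⟩
        change A _ _ 0 = 1
        rw [h.A_const_k ny _ 0 k]
        omega
    · have := B0 i j k hx hn
      omega
  · rcases h1 with ⟨ho, hi, -, hj, -, h1⟩ | ⟨ho, hi, -, -, hj, h1⟩
    · change A _ _ 0 = 1 at h1
      rw [h.A_const_k (h.not_Fst_Y hi) _ 0 k] at h1
      have e := h.line_link FC hi hj (.inl rfl) (.inl rfl) ho k
      omega
    · rw [sub_add_cancel] at hj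
      change A _ _ 0 = 1 at h1
      rw [h.A_const_k (h.not_Fst_Y hi) _ 0 k] at h1
      have e := h.line_link FC hi hj (jc := j - 1) (.inl rfl) (.inr rfl) (by omega) k
      omega

/-- Away from the excepted places, `A` can be moved along directions in which it is constant into
the region of `U`; the line `X` supplies a row `(j₁, k₁)` there. -/
theorem A_eq_zero (h : Rules A B C X Y Z) (nX : ∃ j k, X j k)
    (U : ∀ i j k, ¬ Snd Z j → ¬ Snd Y k → A i j k = 0) (i j k : ℤ)
    (hz : ¬ (Fst Z i ∧ Snd Z j)) (hy : ¬ (Fst Y i ∧ Snd Y k)) : A i j k = 0 := by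
  obtain ⟨j₁, k₁, h₁⟩ := nX
  have hj₁ : ¬ Snd Z j₁ := h.not_Snd_Z ⟨_, h₁⟩
  have hk₁ : ¬ Snd Y k₁ := h.not_Snd_Y ⟨_, h₁⟩
  by_cases hi : Fst Z i
  · rw [h.A_const_k (h.not_Fst_Y hi) j k k₁]
    exact U _ _ _ (fun h' => hz ⟨hi, h'⟩) hk₁
  · rw [h.A_const_j hi j j₁ k]
    by_cases hi' : Fst Y i
    · exact U _ _ _ hj₁ (fun h' => hy ⟨hi', h'⟩)
    · rw [h.A_const_k hi' j₁ k k₁]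
      exact U _ _ _ hj₁ hk₁

/-- The hypotheses cover the planes only partly. In the remaining places a saddle relation, whose
terms `A` and `C` are known to vanish, gives `B = 0`. -/
theorem B_eq_zero (h : Rules A B C X Y Z) (nX : ∃ j k, X j k) (nY : ∃ i k, Y i k)
    (nZ : ∃ i j, Z i j) (U : ∀ i j k, ¬ Snd Z j → ¬ Snd Y k → A i j k = 0)
    (H1 : ∀ i j k, ¬ Snd Z j → Snd Y k → B i j k = 0)
    (H2 : ∀ i j k, Snd Z j → ¬ Snd Y k → C i j k = 0) (i j k : ℤ)
    (hz : ¬ (Fst Z i ∧ Snd Z j)) (hx : ¬ (Fst X j ∧ Snd X k)) : B i j k = 0 := by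
  have FA := h.A_eq_zero nX U
  obtain ⟨j₁, k₁, h₁⟩ := nX
  obtain ⟨i₂, k₂, h₂⟩ := nY
  obtain ⟨i₃, j₃, h₃⟩ := nZ
  have hk₁ : ¬ Snd Y k₁ := h.not_Snd_Y ⟨_, h₁⟩
  by_cases hj : Snd Z j
  · have nx := h.not_Fst_X hj
    rw [h.B_const_k nx i k k₁]
    have v := h.vertex (i := i) (j := j) (k := k₁) (fun h' => nx ⟨_, h'⟩) (fun h' => hk₁ ⟨_, h'⟩)
      (fun h' => hz ⟨⟨_, h'⟩, hj⟩)
    rw [FA _ _ _ hz (fun h' => hk₁ h'.2), H2 _ _ _ hj hk₁] at v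
    have := h.rangeB i j k₁
    omega
  · by_cases hj' : Fst X j
    · by_cases hk : Snd Y k
      · exact H1 _ _ _ hj hk
      · have hk' : ¬ Snd X k := fun h' => hx ⟨hj', h'⟩
        have v := h.vertex (i := i) (j := j) (k := k) (fun h' => hk' ⟨_, h'⟩)
          (fun h' => hk ⟨_, h'⟩) (fun h' => hj ⟨_, h'⟩)
        rw [U _ _ _ hj hk, h.C_const_j hk' i j j₃, H2 _ _ _ ⟨_, h₃⟩ hk] at v
        have := h.rangeB i j k
        omega
    · rw [h.B_const_k hj' i k k₂]
      exact H1 _ _ _ hj ⟨_, h₂⟩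

end Rules

theorem towerCells_fst {R : ℤ → ℤ → Prop} {a : ℤ → ℤ → ℤ} {i : ℤ} (hi : ¬ Fst R i) (j : ℤ) :
    bit (towerCells R a i j ∨ towerCells R a (i - 1) j) = 0 := by
  refine bit_of_not ?_
  rintro (⟨-, h, -⟩ | ⟨-, -, h, -⟩)
  · exact hi h
  · exact hi (by rwa [sub_add_cancel] at h)

theorem towerCells_snd {R : ℤ → ℤ → Prop} {a : ℤ → ℤ → ℤ} {j : ℤ} (hj : ¬ Snd R j) (i : ℤ) :
    bit (towerCells R a i j ∨ towerCells R a i (j - 1)) = 0 := by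
  refine bit_of_not ?_
  rintro (⟨-, -, -, h, -⟩ | ⟨-, -, -, -, h, -⟩)
  · exact hj h
  · exact hj (by rwa [sub_add_cancel] at h)

/-- Towers of different directions need pairs of consecutive planes of different kinds, so their
pairs are disjoint. This is why pushing one kind leaves the towers of another kind intact. -/
theorem not_pair {p q : ℤ → Prop} (hpq : ∀ {i}, p i → ¬ q i) {i i' : ℤ} (h0 : p i) (h1 : p (i + 1))
    (hi : i - 1 ≤ i') (hi' : i' ≤ i + 1) (h2 : q i') (h3 : q (i' + 1)) : False := by
  obtain rfl | rfl | rfl : i' = i - 1 ∨ i' = i ∨ i' = i + 1 := by omega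
  · exact hpq h0 (by rwa [sub_add_cancel] at h3)
  · exact hpq h0 h2
  · exact hpq h1 h2

/-- Polyhedra with lines of screws along all three axes are pushed polyhedra. -/
theorem Ruled.isPushed {P : Set Pt} {X Y Z : ℤ → ℤ → Prop} (h : Ruled P X Y Z)
    (nX : ∃ j k, X j k) (nY : ∃ i k, Y i k) (nZ : ∃ i j, Z i j)
    (U : ∀ i j k, ¬ Snd Z j → ¬ Snd Y k → dA P i j k = 0)
    (H1 : ∀ i j k, ¬ Snd Z j → Snd Y k → dB P i j k = 0)
    (H2 : ∀ i j k, Snd Z j → ¬ Snd Y k → dC P i j k = 0) : IsPushed P := by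
  obtain ⟨hs, h⟩ := h
  have FA := h.A_eq_zero nX U
  have FB := h.B_eq_zero nX nY nZ U H1 H2
  have FC : ∀ i j k, ¬ (Fst Y i ∧ Snd Y k) → ¬ (Fst X j ∧ Snd X k) → dC P i j k = 0 :=
    fun i j k h1 h2 => h.swap_yz.B_eq_zero (exists_comm.1 nX) nZ nY
      (fun i j k h1 h2 => U i k j h2 h1) (fun i j k h1 h2 => H2 i k j h2 h1)
      (fun i j k h1 h2 => H1 i k j h2 h1) i k j h1 (fun h' => h2 ⟨h'.2, h'.1⟩)
  obtain ⟨tz1, tz2⟩ := h.eq_towers FA FB FC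
  obtain ⟨ty1, ty2⟩ := h.swap_yz.eq_towers (fun i j k h1 h2 => FA i k j h2 h1)
    (fun i j k h1 h2 => FC i k j h1 fun h' => h2 ⟨h'.2, h'.1⟩)
    (fun i j k h1 h2 => FB i k j h1 fun h' => h2 ⟨h'.2, h'.1⟩)
  obtain ⟨tx1, tx2⟩ := h.swap_xy.swap_yz.eq_towers
    (fun i j k h1 h2 => FB k i j (fun h' => h2 ⟨h'.2, h'.1⟩) h1)
    (fun i j k h1 h2 => FC k i j (fun h' => h2 ⟨h'.2, h'.1⟩) h1)
    (fun i j k h1 h2 => FA k i j (fun h' => h1 ⟨h'.2, h'.1⟩) (fun h' => h2 ⟨h'.2, h'.1⟩))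
  -- The state of a tower is read off at coordinate `0` along its axis; any other place would do,
  -- since the relevant coordinate is constant there.
  set cz := towerCells Z (fun i j => dA P i j 0) with hcz
  set cy := towerCells Y (fun i k => dA P i 0 k) with hcy
  set cx := towerCells X (fun j k => dB P 0 j k) with hcx
  set Q₁ := symmDiff P0 (towerSides 2 (cellsZ cz)) with hQ₁
  set Q₂ := symmDiff Q₁ (towerSides 1 (cellsY cy)) with hQ₂
  set Q₃ := symmDiff Q₂ (towerSides 0 (cellsX cx)) with hQ₃
  obtain ⟨s0, r0⟩ := reduced_P0
  have r1 : ∀ i j k, dA Q₁ i j k = bit (cz i j ∨ cz (i - 1) j) ∧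
      dB Q₁ i j k = bit (cz i j ∨ cz i (j - 1)) ∧ dC Q₁ i j k = 0 := by
    intro i j k
    obtain ⟨h1, h2, h3⟩ := reduced_pushZ P0 cz i j k
    obtain ⟨g1, g2, g3⟩ := r0 i j k
    have b1 := bit_range (cz i j ∨ cz (i - 1) j)
    have b2 := bit_range (cz i j ∨ cz i (j - 1))
    rw [h1, h2, h3, g1, g2, g3]
    omega
  have r2 : ∀ i j k, dA Q₂ i j k = (bit (cz i j ∨ cz (i - 1) j) + bit (cy i k ∨ cy (i - 1) k)) % 2 ∧
      dB Q₂ i j k = bit (cz i j ∨ cz i (j - 1)) ∧ dC Q₂ i j k = bit (cy i k ∨ cy i (k - 1)) := by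
    intro i j k
    obtain ⟨h1, h2, h3⟩ := reduced_pushY Q₁ cy i j k
    obtain ⟨g1, g2, g3⟩ := r1 i j k
    have b1 := bit_range (cy i k ∨ cy i (k - 1))
    rw [h1, h2, h3, g1, g2, g3]
    exact ⟨rfl, rfl, by omega⟩
  have pz : ∀ f ∈ cellsZ cz, IsTower P0 2 f := by
    rintro _ ⟨i, j, k, hc, rfl⟩
    refine isTower_z (c := 0) (by have := hc.1; omega) ?_ ?_ ?_ <;> intros <;> simp only [r0]
  have py : ∀ f ∈ cellsY cy, IsTower Q₁ 1 f := by
    rintro _ ⟨i, j, k, ⟨ho, hi, hi', hk, hk', -⟩, rfl⟩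
    refine isTower_y (b := 0) (by omega) ?_ ?_ ?_
    · intro i' j' k' h1 h2 h3 h4
      rw [(r1 i' j' k').2.1]
      refine bit_of_not ?_
      rintro (h' | h') <;>
        exact not_pair (p := Fst Y) (q := Fst Z) h.not_Fst_Z hi hi' h1 h2 h'.2.1 h'.2.2.1
    · intro i' j₁ j₂ k' h1 h2 h3 h4
      have hz : ¬ Fst Z i' := by
        obtain rfl | rfl : i' = i ∨ i' = i + 1 := by omega
        exacts [h.not_Fst_Z hi, h.not_Fst_Z hi']
      rw [(r1 i' j₁ k').1, (r1 i' j₂ k').1, towerCells_fst hz, towerCells_fst hz]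
    · intro i' j₁ j₂ k' h1 h2 h3 h4
      rw [(r1 i' j₁ k').2.2, (r1 i' j₂ k').2.2]
  have px : ∀ f ∈ cellsX cx, IsTower Q₂ 0 f := by
    rintro _ ⟨i, j, k, ⟨ho, hj, hj', hk, hk', -⟩, rfl⟩
    refine isTower_x (a := 0) (by omega) ?_ ?_ ?_
    · intro i' j' k' h1 h2 h3 h4
      have e1 : bit (cz i' j' ∨ cz (i' - 1) j') = 0 := by
        refine bit_of_not ?_
        rintro (h' | h') <;>
          exact not_pair (p := Fst X) (q := Snd Z) h.not_Snd_Z hj hj' h1 h2 h'.2.2.2.1 h'.2.2.2.2.1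
      have e2 : bit (cy i' k' ∨ cy (i' - 1) k') = 0 := by
        refine bit_of_not ?_
        rintro (h' | h') <;>
          exact not_pair (p := Snd X) (q := Snd Y) h.not_Snd_Y hk hk' h3 h4 h'.2.2.2.1 h'.2.2.2.2.1
      rw [(r2 i' j' k').1, e1, e2]
      rfl
    · intro i₁ i₂ j' k' h1 h2 h3 h4
      have hz : ¬ Snd Z j' := by
        obtain rfl | rfl : j' = j ∨ j' = j + 1 := by omega
        exacts [h.not_Snd_Z hj, h.not_Snd_Z hj']
      rw [(r2 i₁ j' k').2.1, (r2 i₂ j' k').2.1, towerCells_snd hz, towerCells_snd hz]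
    · intro i₁ i₂ j' k' h1 h2 h3 h4
      have hy : ¬ Snd Y k' := by
        obtain rfl | rfl : k' = k ∨ k' = k + 1 := by omega
        exacts [h.not_Snd_Y hk, h.not_Snd_Y hk']
      rw [(r2 i₁ j' k').2.2, (r2 i₂ j' k').2.2, towerCells_snd hy, towerCells_snd hy]
  refine .inl ⟨Q₁, Q₂, ⟨_, pz, rfl⟩, ⟨_, py, rfl⟩, ⟨_, px, ?_⟩⟩
  have s3 : OnlySquares Q₃ := ((s0.symmDiff (onlySquares_sidesZ _)).symmDiff
    (onlySquares_sidesY _)).symmDiff (onlySquares_sidesX _)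
  suffices key : ∀ i j k, dA P i j k = dA Q₃ i j k ∧ dB P i j k = dB Q₃ i j k ∧
      dC P i j k = dC Q₃ i j k from
    hs.ext s3 (fun i j k => (key i j k).1) (fun i j k => (key i j k).2.1)
      fun i j k => (key i j k).2.2
  intro i j k
  obtain ⟨h1, h2, h3⟩ := reduced_pushX Q₂ cx i j k
  obtain ⟨g1, g2, g3⟩ := r2 i j k
  have rg := reduced_range P i j k
  rw [h1, h2, h3, g1, g2, g3]
  refine ⟨?_, ?_, ?_⟩
  -- A plane belongs to at most one kind of towers, so of the two contributions to the coordinate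
  -- one vanishes and the other one is given by `eq_towers`.
  · by_cases hi : Fst Y i
    · have e := ty1 i k j (h.not_Fst_Z hi)
      rw [towerCells_fst (h.not_Fst_Z hi), ← e]
      omega
    · have e := tz1 i j k hi
      rw [towerCells_fst hi, ← e]
      omega
  · by_cases hj : Fst X j
    · have e := tx1 j k i (h.not_Snd_Z hj)
      rw [towerCells_snd (h.not_Snd_Z hj), ← e]
      omega
    · have e := tz2 i j k hj
      rw [towerCells_fst hj, ← e]
      omega
  · by_cases hk : Snd X k
    · have e := tx2 j k i (h.not_Snd_Y hk)
      rw [towerCells_snd (h.not_Snd_Y hk), ← e]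
      omega
    · have e := ty2 i k j hk
      rw [towerCells_snd hk, ← e]
      omega

end CubicPolyhedra

/-! ### Conclusion of the three-axis case -/

namespace CubicPolyhedra

variable {P : Set Pt} {X Y Z : ℤ → ℤ → Prop}

theorem Ruled.congruent_isPushed_of_uniform (h : Ruled P X Y Z) (nX : ∃ j k, X j k)
    (nY : ∃ i k, Y i k) (nZ : ∃ i j, Z i j) (hYZ : Rules.FullY X Y Z ↔ Rules.FullZ X Y Z) :
    ∃ P', IsPushed P' ∧ Congruent P P' := by
  obtain ⟨a, ha⟩ := h.rules.uniformX hYZ nX nY nZ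
  obtain ⟨b, c, habc, hb, hc⟩ := h.rules.boundary_values nX nY nZ ha
  -- This translation adds `b + c`, `b` and `c` to the three coordinates. All three constants become
  -- even, the first because `a + b + c` is even.
  refine ⟨CubicPolyhedra.translate ![0, c, b] P, ?_, congruent_translate _ _⟩
  have e : ∀ {R : ℤ → ℤ → Prop} {x y : ℤ}, (∃ i j, R i j) → ∃ i j, R (i - x) (j - y) :=
    fun ⟨i, j, h'⟩ => ⟨_, _, by rwa [add_sub_cancel_right, add_sub_cancel_right]⟩
  have s : ∀ {R : ℤ → ℤ → Prop} (x y j : ℤ), Snd (fun i j => R (i - x) (j - y)) j ↔ Snd R (j - y) :=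
    fun {R} x y j => ⟨fun ⟨i, h'⟩ => ⟨_, h'⟩, fun ⟨i, h'⟩ => ⟨i + x, by
      change R _ _
      rwa [add_sub_cancel_right]⟩⟩
  refine (h.translate 0 c b).isPushed (e nX) (e nY) (e nZ) ?_ ?_ ?_
  · intro i j k hj hk
    rw [s] at hj hk
    rw [(reduced_translate P _ _ _ _ _ _).1, ha _ _ _ hj hk]
    omega
  · intro i j k hj hk
    rw [s] at hj hk
    rw [(reduced_translate P _ _ _ _ _ _).2.1, hb _ _ _ hj hk]
    omega
  · intro i j k hj hk
    rw [s] at hj hk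
    rw [(reduced_translate P _ _ _ _ _ _).2.2, hc _ _ _ hj hk]
    omega

/-- Two of the three truth values `FullX`, `FullY`, `FullZ` agree by pigeonhole; a permutation of
the axes turns these two into `FullY` and `FullZ`. -/
theorem Ruled.congruent_isPushed (h : Ruled P X Y Z) (nX : ∃ j k, X j k)
    (nY : ∃ i k, Y i k) (nZ : ∃ i j, Z i j) : ∃ P', IsPushed P' ∧ Congruent P P' := by
  have key : ∀ {P X Y Z}, Ruled P X Y Z → (∃ j k, X j k) → (∃ i k, Y i k) → (∃ i j, Z i j) →
      (Rules.FullX X Y Z ↔ Rules.FullZ X Y Z) → ∃ P', IsPushed P' ∧ Congruent P P' := by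
    intro P X Y Z h nX nY nZ hXZ
    obtain ⟨P', h1, h2⟩ := h.swap_xy.congruent_isPushed_of_uniform nY nX (exists_comm.1 nZ)
      (hXZ.trans ⟨fun h' i j hi hj => h' j i hj hi, fun h' i j hi hj => h' j i hj hi⟩)
    exact ⟨P', h1, (congruent_permute _ _).trans h2⟩
  by_cases h1 : Rules.FullY X Y Z ↔ Rules.FullZ X Y Z
  · exact h.congruent_isPushed_of_uniform nX nY nZ h1
  by_cases h2 : Rules.FullX X Y Z ↔ Rules.FullZ X Y Z
  · exact key h nX nY nZ h2
  have h3 : Rules.FullX X Y Z ↔ Rules.FullY X Y Z := by tauto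
  obtain ⟨P', h1, h2⟩ := key h.swap_yz (exists_comm.1 nX) nZ nY
    (Iff.trans ⟨fun h' i j hi hj => h' j i hj hi, fun h' i j hi hj => h' j i hj hi⟩ h3)
  exact ⟨P', h1, (congruent_permute _ _).trans h2⟩

theorem insertSlabs_refl (n : Fin 3) (P : Set Pt) : InsertSlabs n P P :=
  ⟨∅, 0, Set.empty_ne_univ, fun _ _ => rfl, fun _ h => h.elim, fun v _ => by
    rw [Pi.zero_apply, add_zero]⟩

end CubicPolyhedra

namespace CubicPolyhedra

/-! ### Polyhedra without vertical lines of screws -/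

/-- The rules for reduced coordinates `a` (normal `x`), `b` (normal `y`) and `C` (normal `z`) in the
absence of vertical lines of screws. -/
structure Flat (a b : ℤ → ℤ → ℤ) (C : ℤ → ℤ → ℤ → ℤ) (X Y : ℤ → ℤ → Prop) : Prop where
  range_a : ∀ i k, 0 ≤ a i k ∧ a i k < 2
  range_b : ∀ j k, 0 ≤ b j k ∧ b j k < 2
  range_C : ∀ i j k, 0 ≤ C i j k ∧ C i j k < 2
  Ya : ∀ i k, Y i k ↔ a i (k - 1) ≠ a i k
  YC : ∀ i j k, Y i k ↔ C (i - 1) j k ≠ C i j k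
  Xb : ∀ j k, X j k ↔ b j (k - 1) ≠ b j k
  XC : ∀ i j k, X j k ↔ C i (j - 1) k ≠ C i j k
  not_XY : ∀ {i j k}, X j k → ¬ Y i k
  lineX : ∀ i {j k}, X j k → (b j k + C i j k + 1 + j + k) % 2 = 0
  lineY : ∀ {i} j {k}, Y i k → (a i k + C i j k + 1 + i + k) % 2 = 0
  vertex : ∀ {i j k}, ¬ X j k → ¬ Y i k → (a i k + b j k + C i j k) % 2 = 0

theorem Rules.A_eq_of_not_Z {A B C : ℤ → ℤ → ℤ → ℤ} {X Y Z : ℤ → ℤ → Prop} (h : Rules A B C X Y Z)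
    (hZ : ∀ i j, ¬ Z i j) (i j k : ℤ) : A i j k = A i 0 k :=
  h.A_const_j (fun ⟨j, h'⟩ => hZ i j h') j 0 k

theorem Rules.B_eq_of_not_Z {A B C : ℤ → ℤ → ℤ → ℤ} {X Y Z : ℤ → ℤ → Prop} (h : Rules A B C X Y Z)
    (hZ : ∀ i j, ¬ Z i j) (i j k : ℤ) : B i j k = B 0 j k :=
  h.B_const_i (fun ⟨i, h'⟩ => hZ i j h') i 0 k

theorem Rules.flat {A B C : ℤ → ℤ → ℤ → ℤ} {X Y Z : ℤ → ℤ → Prop} (h : Rules A B C X Y Z)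
    (hZ : ∀ i j, ¬ Z i j) : Flat (fun i k => A i 0 k) (fun j k => B 0 j k) C X Y where
  range_a _ _ := h.rangeA _ _ _
  range_b _ _ := h.rangeB _ _ _
  range_C := h.rangeC
  Ya i k := h.YA i 0 k
  YC := h.YC
  Xb j k := h.XB 0 j k
  XC := h.XC
  not_XY := h.not_XY
  lineX i j k h' := by
    rw [← h.B_eq_of_not_Z hZ i]
    exact h.lineX i h'
  lineY j k h' := by
    rw [← h.A_eq_of_not_Z hZ _ j]
    exact h.lineY j h'
  vertex {i j k} h1 h2 := by
    rw [← h.A_eq_of_not_Z hZ _ j, ← h.B_eq_of_not_Z hZ i]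
    exact h.vertex h1 h2 (hZ i j)

/-- In the layer at height `k` there are no lines `Y`, and the coordinate `a` is constant on both
sides of the layer. -/
structure Straight (Y : ℤ → ℤ → Prop) (a : ℤ → ℤ → ℤ) (k : ℤ) : Prop where
  not_line : ∀ i, ¬ Y i k
  below : ∀ i i', a i (k - 1) = a i' (k - 1)
  above : ∀ i i', a i k = a i' k

namespace Flat

variable {a b : ℤ → ℤ → ℤ} {C : ℤ → ℤ → ℤ → ℤ} {X Y : ℤ → ℤ → Prop}

theorem swap (h : Flat a b C X Y) : Flat b a (fun i j k => C j i k) Y X where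
  range_a := h.range_b
  range_b := h.range_a
  range_C _ _ _ := h.range_C _ _ _
  Ya := h.Xb
  YC _ _ _ := h.XC _ _ _
  Xb := h.Ya
  XC _ _ _ := h.YC _ _ _
  not_XY h1 h2 := h.not_XY h2 h1
  lineX _ _ _ h1 := h.lineY _ h1
  lineY _ _ h1 := h.lineX _ h1
  vertex h1 h2 := by have := h.vertex h2 h1; omega

/-- In a row `j` without a line `X` all vertices are saddles, and neither `b` nor `C` depends on `i`
there; so `a` does not either. -/
theorem straight (h : Flat a b C X Y) {k : ℤ} (hY : ∀ i, ¬ Y i k) (hX : ¬ ∀ j, X j k) :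
    Straight Y a k := by
  push Not at hX
  obtain ⟨j, hj⟩ := hX
  have e : ∀ i, a i (k - 1) = a i k := fun i => by
    by_contra h'
    exact hY i ((h.Ya i k).2 h')
  have e' : ∀ i i', a i k = a i' k := by
    refine const_of_step (f := fun i => a i k) fun i => ?_
    have hC : C (i - 1) j k = C i j k := by
      by_contra h'
      exact hY i ((h.YC i j k).2 h')
    have h1 := h.vertex hj (hY (i - 1))
    have h2 := h.vertex hj (hY i)
    have r1 := h.range_a (i - 1) k
    have r2 := h.range_a i k
    show a (i - 1) k = a i k
    omega
  exact ⟨hY, fun i i' => by rw [e, e, e' i i'], e'⟩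

/-- `C` alternates from row to row since every row is a line, and so does the checkerboard term in
the line relation; hence `b` stays the same. -/
theorem const_of_full (h : Flat a b C X Y) {k : ℤ} (hX : ∀ j, X j k) :
    (∀ j j', b j (k - 1) = b j' (k - 1)) ∧ ∀ j j', b j k = b j' k := by
  have e' : ∀ j j', b j k = b j' k := by
    refine const_of_step (f := fun j => b j k) fun j => ?_
    have h1 := h.lineX 0 (hX (j - 1))
    have h2 := h.lineX 0 (hX j)
    have h3 := (h.XC 0 j k).1 (hX j)
    have r1 := h.range_b (j - 1) k
    have r2 := h.range_b j k
    have r3 := h.range_C 0 j k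
    have r4 := h.range_C 0 (j - 1) k
    show b (j - 1) k = b j k
    omega
  refine ⟨fun j j' => ?_, e'⟩
  have h1 := (h.Xb j k).1 (hX j)
  have h2 := (h.Xb j' k).1 (hX j')
  have h3 := e' j j'
  have r1 := h.range_b j (k - 1)
  have r2 := h.range_b j' (k - 1)
  have r3 := h.range_b j k
  omega

/-- One formula for rows of screws and rows of saddles: over a saddle row `b` is the same above and
below, and over a screw row parity selects the side. A straight layer is thus determined by the
coordinates on its two sides. -/
theorem C_eq (h : Flat a b C X Y) {k : ℤ} (hY : Straight Y a k) (i j : ℤ) :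
    (C i j k + a 0 k + if (j + k + a 0 k) % 2 = 1 then b j k else b j (k - 1)) % 2 = 0 := by
  have e := hY.above i 0
  have r1 := h.range_b j k
  have r2 := h.range_b j (k - 1)
  by_cases hx : X j k
  · have h1 := h.lineX i hx
    have h2 := (h.Xb j k).1 hx
    split_ifs <;> omega
  · have h1 := h.vertex hx (hY.not_line i)
    have h2 : b j (k - 1) = b j k := by
      by_contra h'
      exact hx ((h.Xb j k).2 h')
    split_ifs <;> omega

theorem a_eq_of_straight (h : Flat a b C X Y) {k : ℤ} (hY : Straight Y a k) :
    a 0 (k - 1) = a 0 k := by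
  by_contra h'
  exact hY.not_line 0 ((h.Ya 0 k).2 h')

/-- Rows `j` and `j + 1` of suitable parity take `C` from the same side of the layer by `C_eq`, and
`C` jumps between them exactly if `b` jumps at row `j + 1`. So the values of `b` on that side agree
in pairs: these are the two sides of a tower cell along `x`. -/
theorem pairing (h : Flat a b C X Y) {k : ℤ} (hY : Straight Y a k) (j : ℤ) :
    ((j + k + a 0 k) % 2 = 1 → b j k = b (j + 1) k) ∧
      ((j + (k - 1) + a 0 (k - 1)) % 2 = 1 → b j (k - 1) = b (j + 1) (k - 1)) := by
  have e := h.a_eq_of_straight hY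
  have c1 := h.C_eq hY 0 j
  have c2 := h.C_eq hY 0 (j + 1)
  have x1 := h.Xb (j + 1) k
  have x2 := h.XC 0 (j + 1) k
  rw [add_sub_cancel_right] at x2
  have r1 := h.range_b j k
  have r2 := h.range_b j (k - 1)
  have r3 := h.range_b (j + 1) k
  have r4 := h.range_b (j + 1) (k - 1)
  have r5 := h.range_C 0 j k
  have r6 := h.range_C 0 (j + 1) k
  have x : C 0 j k = C 0 (j + 1) k ↔ b (j + 1) (k - 1) = b (j + 1) k :=
    not_iff_not.1 (x2.symm.trans x1)
  clear x1 x2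
  refine ⟨fun ho => ?_, fun ho => ?_⟩
  · rw [if_pos ho] at c1
    rw [if_neg (by omega)] at c2
    omega
  · rw [if_neg (by omega)] at c1
    rw [if_pos (by omega)] at c2
    omega

/-- Either all layers consist of screws with the same axis, or some layer is not a slab that can be
removed. -/
theorem trichotomy (h : Flat a b C X Y) :
    (∀ k j, X j k) ∨ (∀ k i, Y i k) ∨ ∃ k, Straight Y a k ∨ Straight X b k := by
  by_contra hn
  push Not at hn
  obtain ⟨nX, nY, hn⟩ := hn
  have full : ∀ k, ¬ (∀ j, X j k) → ∀ i, Y i k := by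
    intro k hX
    by_contra hY
    by_cases h' : ∃ i, Y i k
    · obtain ⟨i, hi⟩ := h'
      exact (hn k).2 (h.swap.straight (fun j hj => h.not_XY hj hi) hY)
    · exact (hn k).1 (h.straight (fun i hi => h' ⟨i, hi⟩) hX)
  -- A full layer makes the coordinates on both sides constant across its lines. If the neighbouring
  -- layer were full of lines in the other direction, this would make it straight.
  have step : ∀ k, (∀ j, X j (k - 1)) = ∀ j, X j k := by
    intro k
    have key : ∀ {a b : ℤ → ℤ → ℤ} {C : ℤ → ℤ → ℤ → ℤ} {X Y : ℤ → ℤ → Prop}, Flat a b C X Y →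
        (∀ j, X j (k - 1)) → (∀ i, Y i k) → Straight Y a (k - 1) := by
      intro a b C X Y h h1 h2
      have hc := (h.swap.const_of_full h2).1
      have e : ∀ i, a i (k - 1 - 1) = a i (k - 1) := fun i => by
        by_contra h'
        exact h.not_XY (h1 0) ((h.Ya i (k - 1)).2 h')
      exact ⟨fun i => h.not_XY (h1 0), fun i i' => by rw [e, e, hc i i'], hc⟩
    refine propext ⟨fun h1 => ?_, fun h1 => ?_⟩
    · by_contra h2
      exact (hn _).1 (key h h1 (full k h2))
    · by_contra h2
      exact (hn _).2 (key h.swap (full _ h2) h1)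
  have hall := const_of_step (f := fun k => ∀ j, X j k) step
  obtain ⟨k, j, hj⟩ := nX
  obtain ⟨k', i, hi⟩ := nY
  have h1 : ¬ ∀ j, X j k' := by
    rw [hall k' k]
    exact fun h' => hj (h' j)
  exact hi (full k' h1 i)

end Flat

end CubicPolyhedra

/-! ### Layers full of lines are slabs; polyhedra full of lines are `P_σ` -/

namespace CubicPolyhedra

/-- The mirror symmetry along `y` holds because `B` is constant in `j` on both sides of the layer,
`A` does not depend on `j`, and `C` jumps at every row, so that it agrees in every second one. -/
theorem Ruled.isSlab_x {P : Set Pt} {X Y Z : ℤ → ℤ → Prop} (h : Ruled P X Y Z)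
    (hZ : ∀ i j, ¬ Z i j) {k : ℤ} (hX : ∀ j, X j k) : IsSlab P 2 0 1 k := by
  refine ⟨by decide, by decide, by decide, ?_⟩
  rintro v rfl
  have hf := h.rules.flat hZ
  have eB := h.rules.B_eq_of_not_Z hZ
  obtain ⟨b1, b2⟩ := hf.const_of_full hX
  have hB : ∀ i j j' (u : ℤˣ), dB P i j (v 2 + off u) = dB P i j' (v 2 + off u) := by
    intro i j j' u
    rw [eB i j, eB i j']
    rcases Int.units_eq_one_or u with rfl | rfl
    · rw [off_one, add_zero]
      exact b2 j j'
    · rw [off_neg_one, ← sub_eq_add_neg]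
      exact b1 j j'
  refine ⟨?_, mirrored_y ?_ ?_ ?_⟩
  · have key : ∀ s : ℤˣ, IsFlange P v (0, s) := by
      intro s
      have h1 := h.rules.lineX (v 0 + off s) (hX (v 1))
      have h2 := (h.rules.XB (v 0 + off s) _ _).1 (hX (v 1))
      have h3 := (h.rules.XC (v 0 + off s) _ _).1 (hX (v 1))
      have r1 := h.rules.rangeB (v 0 + off s) (v 1) (v 2)
      have r2 := h.rules.rangeB (v 0 + off s) (v 1) (v 2 - 1)
      have r3 := h.rules.rangeC (v 0 + off s) (v 1) (v 2)
      have r4 := h.rules.rangeC (v 0 + off s) (v 1 - 1) (v 2)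
      rcases Int.emod_two_eq_zero_or_one (dB P (v 0 + off s) (v 1) (v 2) + (v 0 + off s) + v 2)
        with ho | ho
      · refine ⟨(1, 1), ?_, ?_⟩
        · rw [adj_xy, mZ_iff, off_one, add_zero]
          omega
        · rw [adj_xy, mZ_iff, off_neg_one, ← sub_eq_add_neg]
          omega
      · refine ⟨(2, 1), ?_, ?_⟩
        · rw [adj_xz, mY_iff, off_one, add_zero]
          omega
        · rw [adj_xz, mY_iff, off_neg_one, ← sub_eq_add_neg]
          omega
    exact ⟨key 1, key (-1)⟩
  · intro s u
    rw [mY_iff, mY_iff, hB _ (v 1 + 1) (v 1)]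
  · intro u
    rw [mX_iff, mX_iff, h.rules.A_eq_of_not_Z hZ, h.rules.A_eq_of_not_Z hZ (j := v 1 + 1)]
    omega
  · intro u
    have h1 := (h.rules.XC (v 0 + off u) _ _).1 (hX (v 1))
    have h2 := (h.rules.XC (v 0 + off u) _ _).1 (hX (v 1 + 1))
    rw [add_sub_cancel_right] at h2
    have r3 := h.rules.rangeC (v 0 + off u) (v 1) (v 2)
    have r4 := h.rules.rangeC (v 0 + off u) (v 1 - 1) (v 2)
    have r5 := h.rules.rangeC (v 0 + off u) (v 1 + 1) (v 2)
    rw [mZ_iff, mZ_iff]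
    omega

theorem Ruled.isSlab_y {P : Set Pt} {X Y Z : ℤ → ℤ → Prop} (h : Ruled P X Y Z)
    (hZ : ∀ i j, ¬ Z i j) {k : ℤ} (hY : ∀ i, Y i k) : IsSlab P 2 1 0 k := by
  refine ⟨by decide, by decide, by decide, ?_⟩
  rintro v rfl
  have hf := h.rules.flat hZ
  have eA := h.rules.A_eq_of_not_Z hZ
  obtain ⟨b1, b2⟩ := hf.swap.const_of_full hY
  have hA : ∀ j i i' (u : ℤˣ), dA P i j (v 2 + off u) = dA P i' j (v 2 + off u) := by
    intro j i i' u
    rw [eA i j, eA i' j]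
    rcases Int.units_eq_one_or u with rfl | rfl
    · rw [off_one, add_zero]
      exact b2 i i'
    · rw [off_neg_one, ← sub_eq_add_neg]
      exact b1 i i'
  refine ⟨?_, mirrored_x ?_ ?_ ?_⟩
  · have key : ∀ s : ℤˣ, IsFlange P v (1, s) := by
      intro s
      have h1 := h.rules.lineY (v 1 + off s) (hY (v 0))
      have h2 := (h.rules.YA _ (v 1 + off s) _).1 (hY (v 0))
      have h3 := (h.rules.YC _ (v 1 + off s) _).1 (hY (v 0))
      have r1 := h.rules.rangeA (v 0) (v 1 + off s) (v 2)
      have r2 := h.rules.rangeA (v 0) (v 1 + off s) (v 2 - 1)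
      have r3 := h.rules.rangeC (v 0) (v 1 + off s) (v 2)
      have r4 := h.rules.rangeC (v 0 - 1) (v 1 + off s) (v 2)
      rcases Int.emod_two_eq_zero_or_one (dA P (v 0) (v 1 + off s) (v 2) + (v 1 + off s) + v 2)
        with ho | ho
      · refine ⟨(0, 1), ?_, ?_⟩
        · rw [adj_yx, mZ_iff, off_one, add_zero]
          omega
        · rw [adj_yx, mZ_iff, off_neg_one, ← sub_eq_add_neg]
          omega
      · refine ⟨(2, 1), ?_, ?_⟩
        · rw [adj_yz, mX_iff, off_one, add_zero]
          omega
        · rw [adj_yz, mX_iff, off_neg_one, ← sub_eq_add_neg]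
          omega
    exact ⟨key 1, key (-1)⟩
  · intro s u
    rw [mX_iff, mX_iff, hA _ (v 0 + 1) (v 0)]
  · intro u
    rw [mY_iff, mY_iff, h.rules.B_eq_of_not_Z hZ, h.rules.B_eq_of_not_Z hZ (i := v 0 + 1)]
    omega
  · intro u
    have h1 := (h.rules.YC _ (v 1 + off u) _).1 (hY (v 0))
    have h2 := (h.rules.YC _ (v 1 + off u) _).1 (hY (v 0 + 1))
    rw [add_sub_cancel_right] at h2
    have r3 := h.rules.rangeC (v 0) (v 1 + off u) (v 2)
    have r4 := h.rules.rangeC (v 0 - 1) (v 1 + off u) (v 2)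
    have r5 := h.rules.rangeC (v 0 + 1) (v 1 + off u) (v 2)
    rw [mZ_iff, mZ_iff]
    omega

/-- If all vertices lie on vertical lines of screws, then the polyhedron is some `P_σ`. -/
theorem Ruled.congruent_Psigma {P : Set Pt} {X Y Z : ℤ → ℤ → Prop} (h : Ruled P X Y Z)
    (hZ : ∀ i j, Z i j) : ∃ σ, Congruent P (Psigma σ) := by
  have r := h.rules
  have nY : ∀ i k, ¬ Y i k := fun i k h' => r.not_YZ h' (hZ i 0)
  have nX : ∀ j k, ¬ X j k := fun j k h' => r.not_XZ h' (hZ 0 j)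
  have eA : ∀ i j k, dA P i j k = dA P i j 0 := fun i j k =>
    r.A_const_k (fun ⟨k, h'⟩ => nY i k h') j k 0
  have eB : ∀ i j k, dB P i j k = dB P i j 0 := fun i j k =>
    r.B_const_k (fun ⟨k, h'⟩ => nX j k h') i k 0
  have eC : ∀ i j k, dC P i j k = dC P 0 0 k := fun i j k => by
    rw [r.C_const_i (fun ⟨i, h'⟩ => nY i k h') i 0, r.C_const_j (fun ⟨j, h'⟩ => nX j k h') 0 j 0]
  -- `A` jumps at every `j`. It does not depend on `i`, because in the line relation both `B` and
  -- the term `i` change at each step.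
  have kA : ∀ i j, (dA P i j 0 - j) % 2 = (dA P 0 0 0 - 0) % 2 := by
    have h1 : ∀ i j j', (dA P i j 0 - j) % 2 = (dA P i j' 0 - j') % 2 := fun i =>
      const_of_step (f := fun j => (dA P i j 0 - j) % 2) fun j => by
        have h1 := (r.ZA i j 0).1 (hZ i j)
        have r1 := r.rangeA i j 0
        have r2 := r.rangeA i (j - 1) 0
        show (dA P i (j - 1) 0 - (j - 1)) % 2 = (dA P i j 0 - j) % 2
        omega
    have h2 : ∀ i i', dA P i 0 0 = dA P i' 0 0 :=
      const_of_step (f := fun i => dA P i 0 0) fun i => by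
        have h1 := (r.ZB i 0 0).1 (hZ i 0)
        have h2 := r.lineZ 0 (hZ i 0)
        have h3 := r.lineZ 0 (hZ (i - 1) 0)
        have r1 := r.rangeA i 0 0
        have r2 := r.rangeA (i - 1) 0 0
        have r3 := r.rangeB i 0 0
        have r4 := r.rangeB (i - 1) 0 0
        show dA P (i - 1) 0 0 = dA P i 0 0
        omega
    intro i j
    rw [h1 i j 0, h2 i 0]
  set a := dA P 0 0 0 with ha
  have hlA : ∀ i j k, (dA P i j k - a - j) % 2 = 0 := fun i j k => by
    have := kA i j
    rw [eA]
    omega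
  have hlB : ∀ i j k, (dB P i j k - a - 1 - i) % 2 = 0 := fun i j k => by
    have := hlA i j k
    have := r.lineZ k (hZ i j)
    omega
  classical
  -- The vertical translation by `a` normalises `A` to `j`, so the handedness at height `k` is read
  -- at height `k - a` of `P`.
  set σ : ℤ → ℤˣ := fun k => if (dC P 0 0 (k - a) + k) % 2 = 0 then 1 else -1 with hσ
  suffices e : CubicPolyhedra.translate ![0, 0, a] P = Psigma σ from
    ⟨σ, by
      rw [← e]
      exact congruent_translate _ _⟩
  obtain ⟨s, rs⟩ := reduced_Psigma σ
  refine (h.squares.translate _).ext s (fun i j k => ?_) (fun i j k => ?_) fun i j k => ?_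
  · rw [(reduced_translate P _ _ _ _ _ _).1, (rs i j k).1]
    have := hlA (i - 0) (j - 0) (k - a)
    omega
  · rw [(reduced_translate P _ _ _ _ _ _).2.1, (rs i j k).2.1]
    have := hlB (i - 0) (j - 0) (k - a)
    omega
  · rw [(reduced_translate P _ _ _ _ _ _).2.2, (rs i j k).2.2, eC]
    have := one_ne_neg_one_units.symm
    have := r.rangeC 0 0 (k - a)
    by_cases hk : (dC P 0 0 (k - a) + k) % 2 = 0 <;> simp [hσ, hk, this] <;> omega

end CubicPolyhedra

/-! ### Pushing towers in `P_τ`; heights after the removal of slabs -/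

namespace CubicPolyhedra

/-- Pushing the towers in the cells `cy` along `y` and then those in the cells `cx` along `x` in the
polyhedron `P_τ`. -/
theorem isPushed_of_cells {τ : ℤ → Layer} {α β : ℤ → ℤ}
    (hα : ∀ n, α (n + 1) = α n + bit (τ n = .ySlab)) (hβ : ∀ n, β (n + 1) = β n + bit (τ n = .xSlab))
    (r : ∀ i j k, dA (Ptau τ) i j k = α (k + 1) % 2 ∧
      dB (Ptau τ) i j k = β (k + 1) % 2 ∧ dC (Ptau τ) i j k = (α k + β k +
        bit (τ k = .xSlab) * (α k + j + k) + bit (τ k = .ySlab) * (β k + i + k)) % 2)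
    {cy cx : ℤ → ℤ → Prop}
    (hy : ∀ i m, cy i m → (β (m + 1) + i + m) % 2 = 1 ∧ τ m ≠ .xSlab ∧ τ (m + 1) ≠ .xSlab)
    (hx : ∀ j m, cx j m → (α (m + 1) + j + m) % 2 = 1 ∧ τ m ≠ .ySlab ∧ τ (m + 1) ≠ .ySlab)
    (hd : ∀ i j m m', cx j m → cy i m' → m - 1 ≤ m' → m' ≤ m + 1 → False) :
    ∃ Q, IsPushed Q ∧ ∀ i j k,
      dA Q i j k = (α (k + 1) + bit (cy i k ∨ cy (i - 1) k)) % 2 ∧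
      dB Q i j k = (β (k + 1) + bit (cx j k ∨ cx (j - 1) k)) % 2 ∧
      dC Q i j k = (α k + β k + bit (τ k = .xSlab) * (α k + j + k) +
        bit (τ k = .ySlab) * (β k + i + k) + bit (cy i k ∨ cy i (k - 1)) +
        bit (cx j k ∨ cx j (k - 1))) % 2 := by
  have cα : ∀ {n}, τ n ≠ .ySlab → α (n + 1) = α n := fun {n} h => by rw [hα, bit_of_not h, add_zero]
  have cβ : ∀ {n}, τ n ≠ .xSlab → β (n + 1) = β n := fun {n} h => by rw [hβ, bit_of_not h, add_zero]
  have rC : ∀ i j k, dC (Ptau τ) i j k = (α k + β k +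
        bit (τ k = .xSlab) * (α k + j + k) + bit (τ k = .ySlab) * (β k + i + k)) % 2 :=
    fun i j k => (r i j k).2.2
  set Q₁ := symmDiff (Ptau τ) (towerSides 1 (cellsY cy)) with hQ₁
  have r1 : ∀ i j k, dA Q₁ i j k = (α (k + 1) + bit (cy i k ∨ cy (i - 1) k)) % 2 ∧
      dB Q₁ i j k = β (k + 1) % 2 ∧
      dC Q₁ i j k = (dC (Ptau τ) i j k + bit (cy i k ∨ cy i (k - 1))) % 2 := by
    intro i j k
    obtain ⟨h1, h2, h3⟩ := reduced_pushY (Ptau τ) cy i j k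
    obtain ⟨g1, g2, g3⟩ := r i j k
    rw [h1, h2, h3, g1, g2]
    omega
  refine ⟨symmDiff Q₁ (towerSides 0 (cellsX cx)), .inr ⟨τ, Q₁, ⟨cellsY cy, ?_, rfl⟩,
    ⟨cellsX cx, ?_, rfl⟩⟩, fun i j k => ?_⟩
  · rintro _ ⟨i, j, k, hc, rfl⟩
    obtain ⟨ho, h0, h1⟩ := hy i k hc
    have e0 := cβ h0
    have e1 := cβ h1
    -- Neither of the layers at heights `k` and `k + 1` has axis `x`, so `B` is the same just below,
    -- between and just above them, and their `C` does not depend on `j`.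
    refine isTower_y (b := β (k + 1) % 2) (by omega) ?_ ?_ ?_
    · intro i' j' k' _ _ hk hk'
      rw [(r _ _ _).2.1]
      obtain rfl | rfl | rfl : k' = k - 1 ∨ k' = k ∨ k' = k + 1 := by omega
      · rw [sub_add_cancel, e0]
      · rfl
      · rw [e1]
    · intro i' j₁ j₂ k' _ _ _ _
      rw [(r _ _ _).1, (r _ _ _).1]
    · intro i' j₁ j₂ k' _ _ hk hk'
      have h2 : τ k' ≠ .xSlab := by
        obtain rfl | rfl : k' = k ∨ k' = k + 1 := by omega
        exacts [h0, h1]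
      rw [rC, rC, bit_of_not h2, zero_mul, zero_mul]
  · rintro _ ⟨i, j, k, hc, rfl⟩
    obtain ⟨ho, h0, h1⟩ := hx j k hc
    have e0 := cα h0
    have e1 := cα h1
    refine isTower_x (a := α (k + 1) % 2) (by omega) ?_ ?_ ?_
    · intro i' j' k' _ _ hk hk'
      -- No tower along `y` was pushed at this height or next to it, so the towers of `P_τ` along
      -- `x` are still towers after the first push.
      have hn : ∀ i, ¬ cy i k' := fun i h' => hd i j k k' hc h' hk hk'
      rw [(r1 _ _ _).1, bit_of_not (by simp [hn]), add_zero]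
      obtain rfl | rfl | rfl : k' = k - 1 ∨ k' = k ∨ k' = k + 1 := by omega
      · rw [sub_add_cancel, e0]
      · rfl
      · rw [e1]
    · intro i₁ i₂ j' k' _ _ _ _
      rw [(r1 _ _ _).2.1, (r1 _ _ _).2.1]
    · intro i₁ i₂ j' k' _ _ hk hk'
      have h2 : τ k' ≠ .ySlab := by
        obtain rfl | rfl : k' = k ∨ k' = k + 1 := by omega
        exacts [h0, h1]
      have hn : ∀ i, ¬ cy i k' := fun i h' => hd i j k k' hc h' (by omega) (by omega)
      have hn' : ∀ i, ¬ cy i (k' - 1) := fun i h' => hd i j k _ hc h' (by omega) (by omega)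
      rw [(r1 _ _ _).2.2, (r1 _ _ _).2.2, bit_of_not (by simp [hn, hn']),
        bit_of_not (by simp [hn, hn']), rC, rC, bit_of_not h2, zero_mul, zero_mul]
  · obtain ⟨h1, h2, h3⟩ := reduced_pushX Q₁ cx i j k
    obtain ⟨g1, g2, g3⟩ := r1 i j k
    rw [h1, h2, h3, g1, g2, g3, rC]
    omega

/-- The value of a coordinate next to pushed towers, when the states `L` are paired. -/
theorem state_eq {s o : ℤ} {L : ℤ → ℤ} {c : ℤ → Prop} (hL : ∀ i, 0 ≤ L i ∧ L i < 2)
    (hc : ∀ i, c i ↔ (i + o) % 2 = 1 ∧ L i ≠ s % 2)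
    (hp : ∀ i, (i + o) % 2 = 1 → L i = L (i + 1)) (i : ℤ) :
    (s + bit (c i ∨ c (i - 1))) % 2 = L i := by
  have h1 := hL i
  have h2 := hp (i - 1)
  rw [sub_add_cancel] at h2
  rw [hc, hc]
  rcases bit_cases (((i + o) % 2 = 1 ∧ L i ≠ s % 2) ∨ ((i - 1 + o) % 2 = 1 ∧ L (i - 1) ≠ s % 2)) with
    ⟨h3, h4⟩ | ⟨h3, h4⟩ <;> rw [h4] <;> omega

theorem exists_sum {M : Type*} [AddCommGroup M] (f : ℤ → M) (k₀ : ℤ) (u : M) :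
    ∃ t : ℤ → M, t k₀ = u ∧ ∀ k, t (k + 1) = t k + f k := by
  suffices h : ∃ t : ℤ → M, ∀ k, t (k + 1) = t k + f k by
    obtain ⟨t, ht⟩ := h
    refine ⟨fun k => t k - t k₀ + u, by simp, fun k => ?_⟩
    beta_reduce
    rw [ht]
    abel
  exact ⟨fun n => ∑ m ∈ Finset.Ico 0 n, f m - ∑ m ∈ Finset.Ico n 0, f m, sum_Ico_succ f⟩

/-- In this and the following lemmas, `κ k` stands for the height that layer `k` gets when slabs are
removed: it grows by one after a kept layer and stays the same after a removed one. -/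
theorem mono_of_steps {κ : ℤ → ℤ} (hκ : ∀ k, κ (k + 1) = κ k ∨ κ (k + 1) = κ k + 1)
    {k k' : ℤ} (h : k ≤ k') : κ k ≤ κ k' := by
  obtain ⟨n, rfl⟩ := Int.le.dest h
  induction n with
  | zero => simp
  | succ n ih =>
    have h1 := hκ (k + n)
    have h2 := ih (by omega)
    rw [add_assoc] at h1
    push_cast
    omega

theorem eq_of_steps {κ : ℤ → ℤ} (hκ : ∀ k, κ (k + 1) = κ k ∨ κ (k + 1) = κ k + 1)
    {ι : Type*} {f : ℤ → ι} (hf : ∀ k, κ (k + 1) = κ k → f (k + 1) = f k) {k k' : ℤ}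
    (h : κ k = κ k') : f k = f k' := by
  wlog hk : k ≤ k' generalizing k k'
  · exact (this h.symm (by omega)).symm
  obtain ⟨n, rfl⟩ := Int.le.dest hk
  clear hk
  induction n with
  | zero => simp
  | succ n ih =>
    have h1 := mono_of_steps hκ (show k ≤ k + n by omega)
    have h2 := mono_of_steps hκ (show k + n ≤ k + (n + 1 : ℕ) by omega)
    have h3 := hf (k + n) (by push_cast at h2 h; rw [add_assoc]; omega)
    push_cast
    rw [← add_assoc, h3]
    exact ih (by omega)

theorem exists_step {κ : ℤ → ℤ} (hκ : ∀ k, κ (k + 1) = κ k ∨ κ (k + 1) = κ k + 1)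
    {k k' m : ℤ} (h : κ k = m) (h' : κ k' = m + 1) :
    ∃ l, κ l = m ∧ κ (l + 1) = m + 1 := by
  have hk : k ≤ k' := by
    by_contra hn
    have := mono_of_steps hκ (show k' ≤ k by omega)
    omega
  obtain ⟨n, rfl⟩ := Int.le.dest hk
  clear hk
  induction n with
  | zero => simp at h'; omega
  | succ n ih =>
    have h1 := mono_of_steps hκ (show k ≤ k + n by omega)
    rcases hκ (k + n) with h2 | h2 <;> push_cast at h' <;> rw [← add_assoc] at h'
    · exact ih (by omega)
    · exact ⟨k + n, by omega, by omega⟩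

theorem unique_step {κ : ℤ → ℤ} (hκ : ∀ k, κ (k + 1) = κ k ∨ κ (k + 1) = κ k + 1)
    {k k' : ℤ} (h : κ k = κ k') (hk : κ (k + 1) = κ k + 1)
    (hk' : κ (k' + 1) = κ k' + 1) : k = k' := by
  rcases lt_trichotomy k k' with h1 | h1 | h1
  · have := mono_of_steps hκ (show k + 1 ≤ k' by omega)
    omega
  · exact h1
  · have := mono_of_steps hκ (show k' + 1 ≤ k by omega)
    omega

end CubicPolyhedra

/-! ### Coordinates between layers under the removal of slabs -/

namespace CubicPolyhedra

/-- The coordinate below the layer at height `k`, after a translation by `x k` along the first axis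
that changes the coordinates by `s k`. -/
def state (a : ℤ → ℤ → ℤ) (x s : ℤ → ℤ) (k i : ℤ) : ℤ := (a (i - x k) (k - 1) + s k) % 2

theorem state_range (a : ℤ → ℤ → ℤ) (x s : ℤ → ℤ) (k i : ℤ) :
    0 ≤ state a x s k i ∧ state a x s k i < 2 := by
  unfold state
  omega

/-- The layers that are not removed. -/
def Kept (X Y : ℤ → ℤ → Prop) (a b : ℤ → ℤ → ℤ) (k : ℤ) : Prop := Straight Y a k ∨ Straight X b k

/-- The value of the coordinate `C` in a layer without lines `Y`, next to pushed towers. -/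
theorem layer_eq {α β β' e j m l l' : ℤ} {c c' : Prop} (he : e = 0 ∨ e = 1) (hβ : β' = β + e)
    (hl : 0 ≤ l ∧ l < 2) (hl' : 0 ≤ l' ∧ l' < 2) (hc : c ↔ (j + (α + m)) % 2 = 1 ∧ l' ≠ β' % 2)
    (hc' : c' ↔ (j + (α + (m - 1))) % 2 = 1 ∧ l ≠ β % 2) :
    (α + β + e * (α + j + m) + bit (c ∨ c')) % 2 =
      (α + if (j + m + α) % 2 = 1 then l' else l) % 2 := by
  subst hβ
  rw [hc, hc']
  rcases bit_cases (((j + (α + m)) % 2 = 1 ∧ l' ≠ (β + e) % 2) ∨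
    ((j + (α + (m - 1))) % 2 = 1 ∧ l ≠ β % 2)) with ⟨h1, h2⟩ | ⟨h1, h2⟩ <;> rw [h2] <;>
    rcases he with rfl | rfl <;> split_ifs <;> omega

namespace Flat

variable {a b : ℤ → ℤ → ℤ} {C : ℤ → ℤ → ℤ → ℤ} {X Y : ℤ → ℤ → Prop} {x y z : ℤ → ℤ} {k : ℤ}

/-- A layer has lines of at most one direction; if it is full of neither, `straight` applies in the
direction that does not occur. -/
theorem full_of_not_kept (h : Flat a b C X Y) (hk : ¬ Kept X Y a b k) :
    (∀ j, X j k) ∨ ∀ i, Y i k := by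
  by_contra hn
  push Not at hn
  obtain ⟨⟨j, hj⟩, i, hi⟩ := hn
  by_cases hY : ∃ i, Y i k
  · obtain ⟨i', hi'⟩ := hY
    exact hk (.inr (h.swap.straight (fun j hj => h.not_XY hj hi') fun h' => hi (h' i)))
  · exact hk (.inl (h.straight (fun i hi => hY ⟨i, hi⟩) fun h' => hj (h' j)))

/-- The states are not changed when a slab with axis `x` is removed. -/
theorem state_of_full (h : Flat a b C X Y) (hX : ∀ j, X j k) (hx : x (k + 1) = x k)
    (hy : y (k + 1) = y k + 1) (hz : z (k + 1) = z k - 1) :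
    (∀ i, state a x (fun k => y k + z k) (k + 1) i = state a x (fun k => y k + z k) k i) ∧
    (∀ j, state b y (fun k => x k + z k) (k + 1) j = state b y (fun k => x k + z k) k j) ∧
    ∀ j j', state b y (fun k => x k + z k) k j = state b y (fun k => x k + z k) k j' := by
  obtain ⟨c1, c2⟩ := h.const_of_full hX
  unfold state
  simp only [hx, hy, hz, add_sub_cancel_right]
  refine ⟨fun i => ?_, fun j => ?_, fun j j' => ?_⟩
  · have e : a (i - x k) (k - 1) = a (i - x k) k := by
      by_contra h'
      exact h.not_XY (hX 0) ((h.Ya _ _).2 h')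
    rw [e]
    omega
  -- The jump of `b` across the slab is cancelled by the change of the checkerboard under the
  -- translation, since `x + z` drops by one.
  · have h1 := (h.Xb 0 k).1 (hX 0)
    have r1 := h.range_b 0 k
    have r2 := h.range_b 0 (k - 1)
    rw [c1 _ 0, c2 _ 0]
    omega
  · rw [c1 _ (j' - y k)]

/-- The states at a layer without lines `Y`. -/
theorem state_of_straight (h : Flat a b C X Y) (hY : Straight Y a k) (hx : x (k + 1) = x k)
    (hy : y (k + 1) = y k) (hz : z (k + 1) = z k) :
    (∀ i, state a x (fun k => y k + z k) k i = state a x (fun k => y k + z k) k 0) ∧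
    (∀ i, state a x (fun k => y k + z k) (k + 1) i = state a x (fun k => y k + z k) k 0) ∧
    (∀ j, (j + (state a x (fun k => y k + z k) k 0 + (k + z k - 1))) % 2 = 1 →
      state b y (fun k => x k + z k) k j = state b y (fun k => x k + z k) k (j + 1)) ∧
    (∀ j, (j + (state a x (fun k => y k + z k) k 0 + (k + z k))) % 2 = 1 →
      state b y (fun k => x k + z k) (k + 1) j = state b y (fun k => x k + z k) (k + 1) (j + 1)) ∧
    ∀ i j, (C i j k + x k + y k) % 2 = (state a x (fun k => y k + z k) k 0 +
      if (j + y k + (k + z k) + state a x (fun k => y k + z k) k 0) % 2 = 1 then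
        state b y (fun k => x k + z k) (k + 1) (j + y k) else
        state b y (fun k => x k + z k) k (j + y k)) % 2 := by
  have e := h.a_eq_of_straight hY
  unfold state
  simp only [hx, hy, hz, add_sub_cancel_right]
  rw [hY.below (0 - x k) 0]
  refine ⟨fun i => ?_, fun i => ?_, fun j ho => ?_, fun j ho => ?_, fun i j => ?_⟩
  · rw [hY.below _ 0]
  · rw [hY.above _ 0, e]
  · rw [(h.pairing hY (j - y k)).2 (by omega), show j - y k + 1 = j + 1 - y k by ring]
  · rw [(h.pairing hY (j - y k)).1 (by omega), show j - y k + 1 = j + 1 - y k by ring]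
  · have hC := h.C_eq hY i j
    rw [e]
    by_cases ho : (j + k + a 0 k) % 2 = 1
    · rw [if_pos ho] at hC
      rw [if_pos (by omega)]
      omega
    · rw [if_neg ho] at hC
      rw [if_neg (by omega)]
      omega

end Flat

end CubicPolyhedra

/-! ### The pushed polyhedron formed by the kept layers -/

namespace CubicPolyhedra

/-- Removal of slabs leaves a pushed polyhedron: the translations `(x k, y k, z k)` fit the layers
that are kept together, and their coordinates are those of a pushed polyhedron. -/
theorem Flat.exists_pushed {a b : ℤ → ℤ → ℤ} {C : ℤ → ℤ → ℤ → ℤ} {X Y : ℤ → ℤ → Prop}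
    {x y z : ℤ → ℤ} (h : Flat a b C X Y)
    (tk : ∀ k, Kept X Y a b k → x (k + 1) = x k ∧ y (k + 1) = y k ∧ z (k + 1) = z k)
    (tn : ∀ k, ¬ Kept X Y a b k →
      ((∀ j, X j k) ∧ x (k + 1) = x k ∧ y (k + 1) = y k + 1 ∧ z (k + 1) = z k - 1) ∨
      ((∀ i, Y i k) ∧ x (k + 1) = x k + 1 ∧ y (k + 1) = y k ∧ z (k + 1) = z k - 1))
    {k₀ : ℤ} (hz : k₀ + z k₀ = 0) (ha₀ : state a x (fun k => y k + z k) k₀ 0 = 0)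
    (hb₀ : state b y (fun k => x k + z k) k₀ 0 = 0) :
    ∃ Q, IsPushed Q ∧ ∀ k, Kept X Y a b k → ∀ i j,
      dA Q i j (k + z k - 1) = state a x (fun k => y k + z k) k i ∧
      dA Q i j (k + z k) = state a x (fun k => y k + z k) (k + 1) i ∧
      dB Q i j (k + z k - 1) = state b y (fun k => x k + z k) k j ∧
      dB Q i j (k + z k) = state b y (fun k => x k + z k) (k + 1) j ∧
      dC Q (i + x k) (j + y k) (k + z k) = (C i j k + x k + y k) % 2 := by
  classical
  have ra := state_range a x (fun k => y k + z k)
  have rb := state_range b y (fun k => x k + z k)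
  have stepn : ∀ k, ¬ Kept X Y a b k →
      (∀ i, state a x (fun k => y k + z k) (k + 1) i = state a x (fun k => y k + z k) k i) ∧
      (∀ j, state b y (fun k => x k + z k) (k + 1) j = state b y (fun k => x k + z k) k j) ∧
      ((∀ i i', state a x (fun k => y k + z k) k i = state a x (fun k => y k + z k) k i') ∨
      ∀ j j', state b y (fun k => x k + z k) k j = state b y (fun k => x k + z k) k j') := by
    intro k hk
    rcases tn k hk with ⟨hX, h1, h2, h3⟩ | ⟨hY, h1, h2, h3⟩
    · obtain ⟨e1, e2, e3⟩ := h.state_of_full hX h1 h2 h3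
      exact ⟨e1, e2, .inr e3⟩
    · obtain ⟨e1, e2, e3⟩ := h.swap.state_of_full hY h2 h1 h3
      exact ⟨e2, e1, .inl e3⟩
  have keptY : ∀ k, Straight Y a k → _ := fun k hk =>
    h.state_of_straight hk (tk k (.inl hk)).1 (tk k (.inl hk)).2.1 (tk k (.inl hk)).2.2
  have keptX : ∀ k, Straight X b k → _ := fun k hk =>
    h.swap.state_of_straight hk (tk k (.inr hk)).2.1 (tk k (.inr hk)).1 (tk k (.inr hk)).2.2
  have stY : ∀ k, Kept X Y a b k → (state a x (fun k => y k + z k) k 0 ≠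
      state a x (fun k => y k + z k) (k + 1) 0 ↔ Y (-x k) k) := by
    intro k hk
    obtain ⟨h1, h2, h3⟩ := tk k hk
    have r1 := h.range_a (-x k) (k - 1)
    have r2 := h.range_a (-x k) k
    rw [h.Ya]
    simp only [state, h1, h2, h3, add_sub_cancel_right, zero_sub]
    omega
  have stX : ∀ k, Kept X Y a b k → (state b y (fun k => x k + z k) k 0 ≠
      state b y (fun k => x k + z k) (k + 1) 0 ↔ X (-y k) k) := by
    intro k hk
    obtain ⟨h1, h2, h3⟩ := tk k hk
    have r1 := h.range_b (-y k) (k - 1)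
    have r2 := h.range_b (-y k) k
    rw [h.Xb]
    simp only [state, h1, h2, h3, add_sub_cancel_right, zero_sub]
    omega
  set La := state a x (fun k => y k + z k) with hLa
  set Lb := state b y (fun k => x k + z k) with hLb
  set κ : ℤ → ℤ := fun k => k + z k with hκd
  have κk : ∀ k, Kept X Y a b k → κ (k + 1) = κ k + 1 := fun k hk => by
    have := (tk k hk).2.2
    simp only [hκd]
    omega
  have κn : ∀ k, ¬ Kept X Y a b k → κ (k + 1) = κ k := fun k hk => by
    simp only [hκd]
    rcases tn k hk with ⟨-, -, -, h3⟩ | ⟨-, -, -, h3⟩ <;> omega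
  have hκ : ∀ k, κ (k + 1) = κ k ∨ κ (k + 1) = κ k + 1 := fun k => by
    by_cases hk : Kept X Y a b k
    exacts [.inr (κk k hk), .inl (κn k hk)]
  have kept_iff : ∀ k, κ (k + 1) = κ k + 1 → Kept X Y a b k := fun k hk => by
    by_contra hn
    have := κn k hn
    omega
  have not_kept : ∀ k, κ (k + 1) = κ k → ¬ Kept X Y a b k := fun k hk hn => by
    have := κk k hn
    omega
  have La_eq : ∀ {k k'}, κ k = κ k' → La k = La k' := fun e =>
    eq_of_steps hκ (f := La) (fun k hk => funext (stepn k (not_kept k hk)).1) e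
  have Lb_eq : ∀ {k k'}, κ k = κ k' → Lb k = Lb k' := fun e =>
    eq_of_steps hκ (f := Lb) (fun k hk => funext (stepn k (not_kept k hk)).2.1) e
  have uniq : ∀ {k k'}, Kept X Y a b k → Kept X Y a b k' → κ k = κ k' → k = k' :=
    fun hk hk' e => unique_step hκ e (κk _ hk) (κk _ hk')
  -- The lines at `y = 0` and `x = 0` of the new polyhedron serve as reference: `-y k` and `-x k`
  -- are their positions in layer `k` before the translation. Heights that no kept layer reaches, as
  -- when slabs fill a half-space, get sheets.
  set τ : ℤ → Layer := fun m =>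
    if ∃ k, Kept X Y a b k ∧ κ k = m ∧ X (-y k) k then .xSlab
    else if ∃ k, Kept X Y a b k ∧ κ k = m ∧ Y (-x k) k then .ySlab else .sheet with hτ
  have τx : ∀ m, τ m = .xSlab ↔ ∃ k, Kept X Y a b k ∧ κ k = m ∧ X (-y k) k := by
    intro m
    simp only [hτ]
    split_ifs with h1 h2 <;> simp [h1]
  have τy : ∀ m, τ m = .ySlab ↔ ∃ k, Kept X Y a b k ∧ κ k = m ∧ Y (-x k) k := by
    intro m
    simp only [hτ]
    split_ifs with h1 h2
    · simp only [reduceCtorEq, false_iff]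
      rintro ⟨k, hk, e, hY⟩
      obtain ⟨k', hk', e', hX⟩ := h1
      obtain rfl := uniq hk hk' (e.trans e'.symm)
      exact h.not_XY hX hY
    · simp [h2]
    · simp [h2]
  obtain ⟨α, β, α0, β0, hα, hβ, -, r⟩ := reduced_Ptau τ
  -- Both sides change at the same layers, namely at kept ones with a reference line along `y`, and
  -- both vanish at `k₀`.
  have hαL : ∀ k, α (κ k) % 2 = La k 0 := by
    intro k
    have key := const_of_step (f := fun k => (α (κ k) - La k 0) % 2) (fun k => by
      show (α (κ (k - 1)) - La (k - 1) 0) % 2 = (α (κ k) - La k 0) % 2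
      obtain ⟨l, rfl⟩ : ∃ l, k = l + 1 := ⟨k - 1, by ring⟩
      rw [add_sub_cancel_right]
      by_cases hl : Kept X Y a b l
      · rw [κk l hl, hα]
        have h1 := stY l hl
        have h2 : τ (κ l) = .ySlab ↔ Y (-x l) l := by
          rw [τy]
          refine ⟨fun ⟨k', hk', e, hY⟩ => ?_, fun h' => ⟨l, hl, rfl, h'⟩⟩
          rwa [uniq hk' hl e] at hY
        rw [← h2] at h1
        have r1 := ra l 0
        have r2 := ra (l + 1) 0
        rcases bit_cases (τ (κ l) = .ySlab) with ⟨h3, h4⟩ | ⟨h3, h4⟩ <;> rw [h4]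
        · have := h1.2 h3
          omega
        · have : La l 0 = La (l + 1) 0 := by
            by_contra h'
            exact h3 (h1.1 h')
          omega
      · rw [κn l hl, (stepn l hl).1]) k k₀
    have e : κ k₀ = 0 := hz
    have r1 := ra k 0
    simp only [e, α0, ha₀] at key
    omega
  have hβL : ∀ k, β (κ k) % 2 = Lb k 0 := by
    intro k
    have key := const_of_step (f := fun k => (β (κ k) - Lb k 0) % 2) (fun k => by
      show (β (κ (k - 1)) - Lb (k - 1) 0) % 2 = (β (κ k) - Lb k 0) % 2
      obtain ⟨l, rfl⟩ : ∃ l, k = l + 1 := ⟨k - 1, by ring⟩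
      rw [add_sub_cancel_right]
      by_cases hl : Kept X Y a b l
      · rw [κk l hl, hβ]
        have h1 := stX l hl
        have h2 : τ (κ l) = .xSlab ↔ X (-y l) l := by
          rw [τx]
          refine ⟨fun ⟨k', hk', e, hX⟩ => ?_, fun h' => ⟨l, hl, rfl, h'⟩⟩
          rwa [uniq hk' hl e] at hX
        rw [← h2] at h1
        have r1 := rb l 0
        have r2 := rb (l + 1) 0
        rcases bit_cases (τ (κ l) = .xSlab) with ⟨h3, h4⟩ | ⟨h3, h4⟩ <;> rw [h4]
        · have := h1.2 h3
          omega
        · have : Lb l 0 = Lb (l + 1) 0 := by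
            by_contra h'
            exact h3 (h1.1 h')
          omega
      · rw [κn l hl, (stepn l hl).2.1]) k k₀
    have e : κ k₀ = 0 := hz
    have r1 := rb k 0
    simp only [e, β0, hb₀] at key
    omega
  have xconst : ∀ k, Straight Y a k → (∀ i, La k i = La k 0) ∧ ∀ i, La (k + 1) i = La (k + 1) 0 :=
    fun k hk => ⟨(keptY k hk).1, fun i => by rw [(keptY k hk).2.1, (keptY k hk).2.1 0]⟩
  have yconst : ∀ k, Straight X b k → (∀ j, Lb k j = Lb k 0) ∧ ∀ j, Lb (k + 1) j = Lb (k + 1) 0 :=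
    fun k hk => ⟨(keptX k hk).1, fun i => by rw [(keptX k hk).2.1, (keptX k hk).2.1 0]⟩
  -- The cell lies between the heights `m` and `m + 1`, which is below any layer `k` with `κ k = m +
  -- 1`. The parity selects the cells with normal faces; a tower is pushed where the state differs
  -- from the reference value. At heights without such a `k` nothing is pushed.
  set cy : ℤ → ℤ → Prop := fun i m =>
    (i + (β (m + 1) + m)) % 2 = 1 ∧ ∃ k, κ k = m + 1 ∧ La k i ≠ α (m + 1) % 2 with hcy
  set cx : ℤ → ℤ → Prop := fun j m =>
    (j + (α (m + 1) + m)) % 2 = 1 ∧ ∃ k, κ k = m + 1 ∧ Lb k j ≠ β (m + 1) % 2 with hcx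
  have cy_iff : ∀ {k m} i, κ k = m + 1 →
      (cy i m ↔ (i + (β (m + 1) + m)) % 2 = 1 ∧ La k i ≠ α (m + 1) % 2) := by
    intro k m i e
    refine and_congr_right fun _ => ⟨fun ⟨k', e', hk'⟩ => ?_, fun h' => ⟨k, e, h'⟩⟩
    rwa [La_eq (e.trans e'.symm)]
  have cx_iff : ∀ {k m} j, κ k = m + 1 →
      (cx j m ↔ (j + (α (m + 1) + m)) % 2 = 1 ∧ Lb k j ≠ β (m + 1) % 2) := by
    intro k m i e
    refine and_congr_right fun _ => ⟨fun ⟨k', e', hk'⟩ => ?_, fun h' => ⟨k, e, h'⟩⟩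
    rwa [Lb_eq (e.trans e'.symm)]
  have cy_not : ∀ {k m}, κ k = m + 1 → (∀ i, La k i = La k 0) → ∀ i, ¬ cy i m := by
    intro k m e hc i h'
    refine ((cy_iff i e).1 h').2 ?_
    rw [hc, ← hαL, e]
  have cx_not : ∀ {k m}, κ k = m + 1 → (∀ j, Lb k j = Lb k 0) → ∀ j, ¬ cx j m := by
    intro k m e hc i h'
    refine ((cx_iff i e).1 h').2 ?_
    rw [hc, ← hβL, e]
  -- Next to any layer, kept or removed, at least one of the two states is constant, so towers of
  -- both directions never occur at the same height.
  have const_or : ∀ k, (∀ i, La k i = La k 0) ∨ ∀ j, Lb k j = Lb k 0 := by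
    intro k
    by_cases hk : Kept X Y a b k
    · rcases hk with hs | hs
      exacts [.inl (xconst k hs).1, .inr (yconst k hs).1]
    · rcases (stepn k hk).2.2 with hs | hs
      exacts [.inl fun i => hs i 0, .inr fun j => hs j 0]
  have sX : ∀ {m}, τ m = .xSlab → ∃ k, Straight Y a k ∧ κ k = m ∧ κ (k + 1) = m + 1 := by
    intro m hm
    obtain ⟨k, hk, e, hX⟩ := (τx m).1 hm
    refine ⟨k, hk.resolve_right fun hs => hs.not_line _ hX, e, ?_⟩
    rw [κk k hk, e]
  have sY : ∀ {m}, τ m = .ySlab → ∃ k, Straight X b k ∧ κ k = m ∧ κ (k + 1) = m + 1 := by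
    intro m hm
    obtain ⟨k, hk, e, hY⟩ := (τy m).1 hm
    refine ⟨k, hk.resolve_left fun hs => hs.not_line _ hY, e, ?_⟩
    rw [κk k hk, e]
  have hcross : ∀ {k k' m}, κ k = m → κ k' = m + 1 → ∃ l, κ l = m ∧ κ (l + 1) = m + 1 ∧
      (Straight Y a l ∨ Straight X b l) := by
    intro k k' m e e'
    obtain ⟨l, e1, e2⟩ := exists_step hκ e e'
    exact ⟨l, e1, e2, kept_iff l (by omega)⟩
  obtain ⟨Q, hQ, hr⟩ := isPushed_of_cells hα hβ r (cy := cy) (cx := cx) (by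
      intro i m hc
      refine ⟨by have := hc.1; omega, fun hm => ?_, fun hm => ?_⟩
      · obtain ⟨k, hs, -, e⟩ := sX hm
        exact cy_not e (xconst k hs).2 i hc
      · obtain ⟨k, hs, e, -⟩ := sX hm
        exact cy_not e (xconst k hs).1 i hc) (by
      intro i m hc
      refine ⟨by have := hc.1; omega, fun hm => ?_, fun hm => ?_⟩
      · obtain ⟨k, hs, -, e⟩ := sY hm
        exact cx_not e (yconst k hs).2 i hc
      · obtain ⟨k, hs, e, -⟩ := sY hm
        exact cx_not e (yconst k hs).1 i hc) (by
      intro i j m m' hx hy h1 h2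
      obtain ⟨-, k, e, -⟩ := id hx
      obtain ⟨-, k', e', -⟩ := id hy
      -- For adjacent heights, the kept layer between them is straight in one direction; this makes
      -- the corresponding state constant on both of its sides and excludes one of the two towers.
      obtain rfl | rfl | rfl : m' = m ∨ m' = m - 1 ∨ m' = m + 1 := by omega
      · rcases const_or k with hs | hs
        exacts [cy_not e hs _ hy, cx_not e hs _ hx]
      · obtain ⟨l, e1, e2, hs | hs⟩ := hcross e' (e.trans (by ring))
        · exact cy_not e1 (xconst l hs).1 _ hy
        · exact cx_not (e2.trans (by ring)) (yconst l hs).2 _ hx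
      · obtain ⟨l, e1, e2, hs | hs⟩ := hcross e e'
        · exact cy_not e2 (xconst l hs).2 _ hy
        · exact cx_not e1 (yconst l hs).1 _ hx)
  refine ⟨Q, hQ, fun k hk i j => ?_⟩
  have e0 : κ k = κ k - 1 + 1 := by ring
  have e1 := κk k hk
  have a0 := hαL k
  have a1 := hαL (k + 1)
  have b0 := hβL k
  have b1 := hβL (k + 1)
  have pY := keptY k
  have pX := keptX k
  change dA Q i j (κ k - 1) = _ ∧ dA Q i j (κ k) = _ ∧ dB Q i j (κ k - 1) = _ ∧
    dB Q i j (κ k) = _ ∧ dC Q (i + x k) (j + y k) (κ k) = _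
  change Straight Y a k → _ ∧ _ ∧ (∀ j, (j + (La k 0 + (κ k - 1))) % 2 = 1 → _) ∧
    (∀ j, (j + (La k 0 + κ k)) % 2 = 1 → _) ∧ ∀ i j, _ = (La k 0 +
      if (j + y k + κ k + La k 0) % 2 = 1 then _ else _) % 2 at pY
  change Straight X b k → _ ∧ _ ∧ (∀ j, (j + (Lb k 0 + (κ k - 1))) % 2 = 1 → _) ∧
    (∀ j, (j + (Lb k 0 + κ k)) % 2 = 1 → _) ∧ ∀ i j, _ = (Lb k 0 +
      if (j + x k + κ k + Lb k 0) % 2 = 1 then _ else _) % 2 at pX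
  rw [e1] at a1 b1
  set m := κ k with hm
  have qy0 := fun i => cy_iff i e0
  have qy1 := fun i => cy_iff i e1
  have qx0 := fun i => cx_iff i e0
  have qx1 := fun i => cx_iff i e1
  rw [← e0] at qy0 qx0
  refine ⟨?_, ?_, ?_, ?_, ?_⟩
  · rw [(hr _ _ _).1, ← e0]
    refine state_eq (ra k) qy0 (fun i ho => ?_) i
    rcases hk with hs | hs
    · rw [(pY hs).1, (pY hs).1 (i + 1)]
    · exact (pX hs).2.2.1 i (by omega)
  · rw [(hr _ _ _).1]
    refine state_eq (ra (k + 1)) qy1 (fun i ho => ?_) i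
    rcases hk with hs | hs
    · rw [(pY hs).2.1, (pY hs).2.1 (i + 1)]
    · have := (pX hs).2.1 0
      exact (pX hs).2.2.2.1 i (by omega)
  · rw [(hr _ _ _).2.1, ← e0]
    refine state_eq (rb k) qx0 (fun i ho => ?_) j
    rcases hk with hs | hs
    · exact (pY hs).2.2.1 i (by omega)
    · rw [(pX hs).1, (pX hs).1 (i + 1)]
  · rw [(hr _ _ _).2.1]
    refine state_eq (rb (k + 1)) qx1 (fun i ho => ?_) j
    rcases hk with hs | hs
    · have := (pY hs).2.1 0
      exact (pY hs).2.2.2.1 i (by omega)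
    · rw [(pX hs).2.1, (pX hs).2.1 (i + 1)]
  · rw [(hr _ _ _).2.2]
    rcases hk with hs | hs
    · have ny : τ m ≠ .ySlab := fun h' => by
        obtain ⟨l, hl, el, hY⟩ := (τy m).1 h'
        rw [uniq hl (.inl hs) el] at hY
        exact hs.not_line _ hY
      have eα : α (m + 1) = α m := by rw [hα, bit_of_not ny, add_zero]
      have n0 := cy_not e0 (xconst k hs).1
      have n1 := cy_not e1 (xconst k hs).2
      have c := (pY hs).2.2.2.2 i j
      have key := layer_eq (α := α m) (m := m) (j := j + y k) (c := cx (j + y k) m)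
        (by have := bit_range (τ m = .xSlab); omega) (hβ m) (rb k (j + y k)) (rb (k + 1) (j + y k))
        (by rw [qx1, eα]) (qx0 (j + y k))
      rw [bit_of_not ny, zero_mul, bit_of_not (p := cy _ _ ∨ _) (by simp [n0, n1]), add_zero,
        add_zero, key, c]
      by_cases ho : (j + y k + m + α m) % 2 = 1
      · rw [if_pos ho, if_pos (by omega)]
        omega
      · rw [if_neg ho, if_neg (by omega)]
        omega
    · have nx : τ m ≠ .xSlab := fun h' => by
        obtain ⟨l, hl, el, hX⟩ := (τx m).1 h'
        rw [uniq hl (.inr hs) el] at hX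
        exact hs.not_line _ hX
      have eβ : β (m + 1) = β m := by rw [hβ, bit_of_not nx, add_zero]
      have n0 := cx_not e0 (yconst k hs).1
      have n1 := cx_not e1 (yconst k hs).2
      have c := (pX hs).2.2.2.2 j i
      have key := layer_eq (α := β m) (m := m) (j := i + x k) (c := cy (i + x k) m)
        (by have := bit_range (τ m = .ySlab); omega) (hα m) (ra k (i + x k)) (ra (k + 1) (i + x k))
        (by rw [qy1, eβ]) (qy0 (i + x k))
      rw [bit_of_not nx, zero_mul, bit_of_not (p := cx _ _ ∨ _) (by simp [n0, n1]), add_zero,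
        add_zero, add_comm (α m), key, add_right_comm (C i j k), c]
      by_cases ho : (i + x k + m + β m) % 2 = 1
      · rw [if_pos ho, if_pos (by omega)]
        omega
      · rw [if_neg ho, if_neg (by omega)]
        omega

end CubicPolyhedra

/-! ### Insertion of slabs and the final case distinction -/

namespace CubicPolyhedra

/-- Vertices whose squares have the same coordinates have the same link. -/
theorem link_eq {P Q : Set Pt} {v w : Pt}
    (hX : ∀ s u, mX Q (w 0) (w 1 + off s) (w 2 + off u) ↔ mX P (v 0) (v 1 + off s) (v 2 + off u))
    (hY : ∀ s u, mY Q (w 0 + off s) (w 1) (w 2 + off u) ↔ mY P (v 0 + off s) (v 1) (v 2 + off u))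
    (hZ : ∀ s u, mZ Q (w 0 + off s) (w 1 + off u) (w 2) ↔ mZ P (v 0 + off s) (v 1 + off u) (v 2)) :
    link Q w = link P v := by
  ext ⟨i, s⟩ ⟨j, u⟩
  fin_cases i <;> fin_cases j <;>
    simp only [Fin.zero_eta, Fin.mk_one, Fin.reduceFinMk, adj_xy, adj_xz, adj_yx, adj_yz, adj_zx,
      adj_zy, hX, hY, hZ, not_adj_same]

/-- If some layer is not a removable slab, then the polyhedron is obtained by inserting
slabs into a pushed polyhedron. -/
theorem Ruled.insertSlabs {P : Set Pt} {X Y Z : ℤ → ℤ → Prop} (h : Ruled P X Y Z)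
    (hZ : ∀ i j, ¬ Z i j) {k₀ : ℤ}
    (hk₀ : Kept X Y (fun i k => dA P i 0 k) (fun j k => dB P 0 j k) k₀) :
    ∃ Q, IsPushed Q ∧ InsertSlabs 2 Q P := by
  classical
  have hf := h.rules.flat hZ
  have eA := h.rules.A_eq_of_not_Z hZ
  have eB := h.rules.B_eq_of_not_Z hZ
  set a := fun i k => dA P i 0 k with ha
  set b := fun j k => dB P 0 j k with hb
  -- The two normalisations are coupled, since each shift appears inside the other coordinate. On
  -- the sides of the kept layer one of `a`, `b` is constant, so its equation can be solved first
  -- and the other one afterwards.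
  obtain ⟨u₀, u₁, hu, hu'⟩ : ∃ u₀ u₁ : ℤ, (a (0 - u₀) (k₀ - 1) + (u₁ - k₀)) % 2 = 0 ∧
      (b (0 - u₁) (k₀ - 1) + (u₀ - k₀)) % 2 = 0 := by
    rcases hk₀ with hs | hs
    · refine ⟨k₀ + b (0 - (k₀ + a 0 (k₀ - 1))) (k₀ - 1), k₀ + a 0 (k₀ - 1), ?_, by omega⟩
      rw [hs.below _ 0]
      omega
    · refine ⟨k₀ + b 0 (k₀ - 1), k₀ + a (0 - (k₀ + b 0 (k₀ - 1))) (k₀ - 1), by omega, ?_⟩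
      rw [hs.below _ 0]
      omega
  -- The third component `-k₀` puts the layer `k₀` at height `0`, where `α` and `β` of `P_τ` start.
  obtain ⟨t, t0, ht⟩ := exists_sum (fun k : ℤ => if Kept X Y a b k then (0 : Pt) else
    if ∀ j, X j k then Pi.single 1 1 - Pi.single 2 1 else Pi.single 0 1 - Pi.single 2 1) k₀
    ![u₀, u₁, -k₀]
  have tk : ∀ k, Kept X Y a b k → t (k + 1) = t k := fun k hk => by rw [ht, if_pos hk, add_zero]
  have tx : ∀ k, ¬ Kept X Y a b k → (∀ j, X j k) →
      t (k + 1) = t k - Pi.single 2 1 + Pi.single 1 1 := fun k hk hX => by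
    rw [ht, if_neg hk, if_pos hX]
    abel
  have ty : ∀ k, ¬ Kept X Y a b k → (∀ i, Y i k) →
      t (k + 1) = t k - Pi.single 2 1 + Pi.single 0 1 := fun k hk hY => by
    rw [ht, if_neg hk, if_neg fun hX => hf.not_XY (hX 0) (hY 0)]
    abel
  have t00 : t k₀ 0 = u₀ := by rw [t0]; rfl
  have t01 : t k₀ 1 = u₁ := by rw [t0]; rfl
  have t02 : t k₀ 2 = -k₀ := by rw [t0]; rfl
  obtain ⟨Q, hQ, hr⟩ := hf.exists_pushed (x := fun k => t k 0) (y := fun k => t k 1)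
    (z := fun k => t k 2) (k₀ := k₀)
    (fun k hk => by simp [tk k hk])
    (fun k hk => by
      rcases hf.full_of_not_kept hk with hX | hY
      · exact .inl ⟨hX, by simp [tx k hk hX]⟩
      · exact .inr ⟨hY, by simp [ty k hk hY]⟩)
    (by simp [t02]) (by simp only [state, t00, t01, t02]; omega)
    (by simp only [state, t00, t01, t02]; omega)
  -- The removed slabs are exactly the layers that are not kept. A full layer that is also straight
  -- is not removed but becomes a slab of `P_τ`.
  refine ⟨Q, hQ, {k | ¬ Kept X Y a b k}, t, ?_, fun k hk => tk k (not_not.1 hk), fun k hk => ?_,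
    fun v hv => ?_⟩
  · intro e
    exact (e.symm ▸ Set.mem_univ k₀ : k₀ ∈ {k | ¬ Kept X Y a b k}) hk₀
  · rcases hf.full_of_not_kept hk with hX | hY
    · exact ⟨0, 1, h.isSlab_x hZ hX, tx k hk hX⟩
    · exact ⟨1, 0, h.isSlab_y hZ hY, ty k hk hY⟩
  · replace hv : Kept X Y a b (v 2) := not_not.1 hv
    have e := tk _ hv
    have r := hr _ hv
    simp only [state, e, add_sub_cancel_right] at r
    have w0 : (v + t (v 2)) 0 = v 0 + t (v 2) 0 := rfl
    have w1 : (v + t (v 2)) 1 = v 1 + t (v 2) 1 := rfl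
    have w2 : (v + t (v 2)) 2 = v 2 + t (v 2) 2 := rfl
    refine link_eq (fun s u => ?_) (fun s u => ?_) fun s u => ?_
    · rw [mX_iff, mX_iff, w0, w1, w2]
      have q := r (v 0 + t (v 2) 0) (v 1 + t (v 2) 1 + off s)
      rw [add_sub_cancel_right] at q
      rcases Int.units_eq_one_or u with rfl | rfl
      · rw [off_one, add_zero, add_zero, q.2.1, eA]
        change ((a _ _ + _) % 2 + _ + _) % 2 = 1 ↔ (a _ _ + _ + _) % 2 = 1
        omega
      · rw [off_neg_one, ← sub_eq_add_neg, ← sub_eq_add_neg, q.1, eA]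
        change ((a _ _ + _) % 2 + _ + _) % 2 = 1 ↔ (a _ _ + _ + _) % 2 = 1
        omega
    · rw [mY_iff, mY_iff, w0, w1, w2]
      have q := r (v 0 + t (v 2) 0 + off s) (v 1 + t (v 2) 1)
      rw [add_sub_cancel_right (v 1)] at q
      rcases Int.units_eq_one_or u with rfl | rfl
      · rw [off_one, add_zero, add_zero, q.2.2.2.1, eB]
        change ((b _ _ + _) % 2 + _ + _) % 2 = 1 ↔ (b _ _ + _ + _) % 2 = 1
        omega
      · rw [off_neg_one, ← sub_eq_add_neg, ← sub_eq_add_neg, q.2.2.1, eB]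
        change ((b _ _ + _) % 2 + _ + _) % 2 = 1 ↔ (b _ _ + _ + _) % 2 = 1
        omega
    · rw [mZ_iff, mZ_iff, w0, w1, w2]
      have q := (r (v 0 + off s) (v 1 + off u)).2.2.2.2
      rw [add_right_comm (v 0), add_right_comm (v 1), q]
      omega

theorem congruent_refl (P : Set Pt) : Congruent P P :=
  ⟨1, 1, 0, by simp⟩

/-- The theorem for polyhedra without vertical lines of screws. -/
theorem Ruled.classification_of_not_Z {P : Set Pt} {X Y Z : ℤ → ℤ → Prop} (h : Ruled P X Y Z)
    (hZ : ∀ i j, ¬ Z i j) : (∃ σ, Congruent P (Psigma σ)) ∨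
      ∃ Q P', IsPushed Q ∧ InsertSlabs 2 Q P' ∧ Congruent P P' := by
  rcases (h.rules.flat hZ).trichotomy with hX | hY | ⟨k, hk⟩
  · obtain ⟨σ, hσ⟩ := h.swap_xy.swap_yz.congruent_Psigma fun i j => hX j i
    exact .inl ⟨σ, (congruent_permute _ _).trans ((congruent_permute _ _).trans hσ)⟩
  · obtain ⟨σ, hσ⟩ := h.swap_yz.congruent_Psigma fun i j => hY j i
    exact .inl ⟨σ, (congruent_permute _ _).trans hσ⟩
  · obtain ⟨Q, hQ, hI⟩ := h.insertSlabs hZ hk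
    exact .inr ⟨Q, P, hQ, hI, congruent_refl P⟩

theorem Ruled.classification {P : Set Pt} {X Y Z : ℤ → ℤ → Prop} (h : Ruled P X Y Z) :
    (∃ σ, Congruent P (Psigma σ)) ∨
      ∃ Q P', IsPushed Q ∧ InsertSlabs 2 Q P' ∧ Congruent P P' := by
  have key : ∀ {P'}, Congruent P P' → ((∃ σ, Congruent P' (Psigma σ)) ∨
      ∃ Q P'', IsPushed Q ∧ InsertSlabs 2 Q P'' ∧ Congruent P' P'') →
      (∃ σ, Congruent P (Psigma σ)) ∨
      ∃ Q P'', IsPushed Q ∧ InsertSlabs 2 Q P'' ∧ Congruent P P'' := by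
    rintro P' h1 (⟨σ, h2⟩ | ⟨Q, P'', h2, h3, h4⟩)
    exacts [.inl ⟨σ, h1.trans h2⟩, .inr ⟨Q, P'', h2, h3, h1.trans h4⟩]
  by_cases nZ : ∃ i j, Z i j
  swap
  · push Not at nZ
    exact h.classification_of_not_Z nZ
  by_cases nY : ∃ i k, Y i k
  swap
  · push Not at nY
    exact key (congruent_permute _ _) (h.swap_yz.classification_of_not_Z nY)
  by_cases nX : ∃ j k, X j k
  swap
  · push Not at nX
    exact key ((congruent_permute _ _).trans (congruent_permute _ _))
      (h.swap_xy.swap_yz.classification_of_not_Z fun i j => nX i j)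
  -- With lines along all three axes the polyhedron itself is pushed, up to congruence, and no slabs
  -- are inserted.
  obtain ⟨P', h1, h2⟩ := h.congruent_isPushed nX nY nZ
  exact .inr ⟨P', P', h1, insertSlabs_refl 2 P', h2⟩

end CubicPolyhedra

/-- Every cubic polyhedron is, up to congruence, some `P_σ`, or it is obtained by inserting
slabs into a pushed polyhedron. -/
theorem mainTheorem1 (P : Set CubicPolyhedra.Pt) (hP : CubicPolyhedra.IsCubicPolyhedron P) :
    (∃ σ : ℤ → ℤˣ, CubicPolyhedra.Congruent P (CubicPolyhedra.Psigma σ)) ∨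
      ∃ Q P' : Set CubicPolyhedra.Pt, CubicPolyhedra.IsPushed Q ∧
        CubicPolyhedra.InsertSlabs 2 Q P' ∧ CubicPolyhedra.Congruent P P' := by
  obtain ⟨X, Y, Z, h⟩ := hP.rules
  exact (CubicPolyhedra.Ruled.mk hP.isSquare h).classification
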